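/- Let $d\ge 1$ and write $\mathscr S=\mathscr S(\mathbb R^d)$ for the Schwartz space and $\mathscr S'$ for the tempered distributions. Fix a smooth radial $\chi:\mathbb R^d\to[0,1]$ with $\chi(\xi)=1$ for $|\xi|\le 1$ and $\chi(\xi)=0$ for $|\xi|>3/2$, put $\psi(\xi)=\chi(\xi)-\chi(2\xi)$, and let $\mathcal R_{-1}v=\mathcal F^{-1}(\chi\,\mathcal F v)$, $\mathcal R_jv=\mathcal F^{-1}(\psi(2^{-j}\cdot)\mathcal F v)$ for $j\ge 0$ and $v\in\mathscr S'$, where $\mathcal F$ is the Fourier transform with kernel $e^{-i\xi\cdot x}$. For $s\in\mathbb R$ and $p,q\in[1,\infty]$ put $$\|v\|_{\mathbf B^s_{p,q}}=\Big[\sum_{j\ge -1}\big(2^{sj}\|\mathcal R_jv\|_{L^p}\big)^q\Big]^{1/q}\in[0,\infty]$$ (the supremum over $j$ if $q=\infty$; $\|\cdot\|_{L^p}=\infty$ for a distribution that is not an $L^p$ function), and for $v:[0,T]\to\mathscr S'$ let $\|v\|_{\mathbb L^q_T(\mathbf B^s_{p,q})}$ be the $L^q([0,T])$-norm of $t\mapsto\|v(t)\|_{\mathbf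 B^s_{p,q}}$. For $\alpha\in(0,2)$ and $\varphi\in\mathscr S$ let $$\Delta^{\alpha/2}\varphi(x)=\frac12\int_{\mathbb R^d}\big(\varphi(x+z)+\varphi(x-z)-2\varphi(x)\big)|z|^{-d-\alpha}\,dz .$$ This function is smooth, but in general not rapidly decreasing. For $v\in\mathscr S'$ the pairing $\langle v,\Delta^{\alpha/2}\varphi\rangle$ is the limit $\lim_{R\to\infty}\langle v,\theta(\cdot/R)\,\Delta^{\alpha/2}\varphi\rangle$, when this limit exists for every $\theta\in C_c^\infty(\mathbb R^d)$ with $\theta=1$ near $0$ and does not depend on $\theta$. **Lemma.** Let $\alpha\in(0,2)$, $\beta\in\mathbb R$ and $p,q\in[1,\infty]$. There is a constant $c=c(d,\alpha,\beta,p,q)>0$ (for the fixed $\chi$) such that for all $T>0$, all $u_0\in\mathscr S'$ and all $u,f:[0,T]\to\mathscr S'$ that satisfy $\partial_tu=\Delta^{\alpha/2}u+f$, $u(0)=u_0$ weakly, that is, $$\langle u(t),\varphi\rangle=\langle u_0,\varphi\rangle+\int_0^t\langle u(s),\Delta^{\alpha/2}\varphi\rangle\,ds+\int_0^t\langle f(s),\varphi\rangle\,ds\qquad\text{for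 all }\varphi\in\mathscr S,\ t\in[0,T],$$ where for each $\varphi$ the first integrand is defined for almost every $s$ and both integrands are integrable on $[0,T]$, one has $$\|u\|_{\mathbb L^q_T(\mathbf B^{\alpha+\beta}_{p,q})}\le c\Big(T^{1/q}\|u_0\|_{\mathbf B^{\alpha+\beta}_{p,q}}+(1+T)\|f\|_{\mathbb L^q_T(\mathbf B^{\beta}_{p,q})}\Big),$$ with $T^{1/q}=1$ for $q=\infty$. -/

import Mathlib

open MeasureTheory Filter Topology
open scoped ENNReal SchwartzMap

noncomputable section

/-- A Littlewood-Paley cutoff on `ℝ^d`: a smooth radial function with values in `[0,1]`, equal to `1`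
for `|ξ| ≤ 1` and to `0` for `|ξ| > 3/2`. -/
structure IsLPCutoff {d : ℕ} (χ : EuclideanSpace ℝ (Fin d) → ℝ) : Prop where
  smooth : ContDiff ℝ ((⊤ : ℕ∞) : WithTop ℕ∞) χ
  radial : ∀ ξ η : EuclideanSpace ℝ (Fin d), ‖ξ‖ = ‖η‖ → χ ξ = χ η
  mem_Icc : ∀ ξ, χ ξ ∈ Set.Icc (0 : ℝ) 1
  eq_one : ∀ ξ, ‖ξ‖ ≤ 1 → χ ξ = 1
  eq_zero : ∀ ξ, 3 / 2 < ‖ξ‖ → χ ξ = 0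

/-- The symbols of the dyadic blocks, numbered by `n = j + 1`, `j ≥ -1`: the symbol of the block `-1`
is `χ`, and that of the block `j ≥ 0` is `ψ (2⁻ʲ ξ)` with `ψ ξ = χ ξ - χ (2 ξ)`. -/
def blockSymbol {d : ℕ} (χ : EuclideanSpace ℝ (Fin d) → ℝ) : ℕ → EuclideanSpace ℝ (Fin d) → ℝ
  | 0, ξ => χ ξ
  | j + 1, ξ => χ ((2 ^ j : ℝ)⁻¹ • ξ) - χ ((2 : ℝ) • ((2 ^ j : ℝ)⁻¹ • ξ))

/-- The block operator `R_{n-1}` on tempered distributions. The symbols refer to the Fourier transform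
with kernel `e^{-i ξ·x}`; Mathlib's has the kernel `e^{-2πi ξ·x}`, whence the dilation by `2π`. -/
def block {d : ℕ} (χ : EuclideanSpace ℝ (Fin d) → ℝ) (n : ℕ)
    (v : 𝓢'(EuclideanSpace ℝ (Fin d), ℂ)) : 𝓢'(EuclideanSpace ℝ (Fin d), ℂ) :=
  TemperedDistribution.fourierMultiplierCLM ℂ
    (fun ξ => ((blockSymbol χ n ((2 * Real.pi) • ξ) : ℝ) : ℂ)) v

/-- The `L^p` norm of a tempered distribution: the norm of the (unique) `L^p` function that represents
it, and `∞` if there is none. -/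
def distLpNorm {d : ℕ} (p : ℝ≥0∞) [Fact (1 ≤ p)]
    (v : 𝓢'(EuclideanSpace ℝ (Fin d), ℂ)) : ℝ≥0∞ :=
  ⨅ (g : Lp ℂ p (volume : Measure (EuclideanSpace ℝ (Fin d))))
    (_ : Lp.toTemperedDistribution g = v), ‖g‖ₑ

/-- The norm of the inhomogeneous Besov space `B^s_{p,q}`, with values in `[0,∞]`; the space consists
of the tempered distributions for which it is finite. -/
def besovNorm {d : ℕ} (χ : EuclideanSpace ℝ (Fin d) → ℝ) (s : ℝ) (p q : ℝ≥0∞) [Fact (1 ≤ p)]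
    (v : 𝓢'(EuclideanSpace ℝ (Fin d), ℂ)) : ℝ≥0∞ :=
  if q = ⊤ then ⨆ n : ℕ, (2 : ℝ≥0∞) ^ (s * ((n : ℝ) - 1)) * distLpNorm p (block χ n v)
  else (∑' n : ℕ, ((2 : ℝ≥0∞) ^ (s * ((n : ℝ) - 1)) * distLpNorm p (block χ n v)) ^ q.toReal) ^
    (1 / q.toReal)

/-- The norm of `L^q([0,T]; B^s_{p,q})`, with values in `[0,∞]`. -/
def timeBesovNorm {d : ℕ} (χ : EuclideanSpace ℝ (Fin d) → ℝ) (T s : ℝ) (p q : ℝ≥0∞)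
    [Fact (1 ≤ p)] (v : ℝ → 𝓢'(EuclideanSpace ℝ (Fin d), ℂ)) : ℝ≥0∞ :=
  eLpNorm (fun t => besovNorm χ s p q (v t)) q (volume.restrict (Set.Icc 0 T))

/-- The fractional Laplacian `Δ^{α/2} φ` of a Schwartz function, as the absolutely convergent integral
`½ ∫ (φ (x+z) + φ (x-z) - 2 φ x) |z|^{-d-α} dz`. -/
def fracLaplacian {d : ℕ} (α : ℝ) (φ : 𝓢(EuclideanSpace ℝ (Fin d), ℂ))
    (x : EuclideanSpace ℝ (Fin d)) : ℂ :=
  (1 / 2 : ℂ) * ∫ z : EuclideanSpace ℝ (Fin d),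
    (φ (x + z) + φ (x - z) - 2 * φ x) * ((‖z‖ ^ (-(d : ℝ) - α) : ℝ) : ℂ)

/-- `⟨v, g⟩ = a` for a tempered distribution `v` and a smooth function `g` that need not decay
rapidly: for every `θ ∈ C_c^∞` that equals `1` near the origin, the functions `θ (·/R) g` are Schwartz
and `⟨v, θ (·/R) g⟩ → a` as `R → ∞`. If `g` is Schwartz, this says `v g = a`. It is needed since
`Δ^{α/2} φ` is smooth but in general only of size `|x|^{-d-α}` at infinity. -/
def HasPairing {d : ℕ} (v : 𝓢'(EuclideanSpace ℝ (Fin d), ℂ))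
    (g : EuclideanSpace ℝ (Fin d) → ℂ) (a : ℂ) : Prop :=
  ∀ θ : EuclideanSpace ℝ (Fin d) → ℂ, ContDiff ℝ ((⊤ : ℕ∞) : WithTop ℕ∞) θ →
    HasCompactSupport θ → (∀ᶠ x in 𝓝 0, θ x = 1) →
    ∃ η : ℝ → 𝓢(EuclideanSpace ℝ (Fin d), ℂ),
      (∀ R : ℝ, 0 < R → ∀ x, η R x = θ (R⁻¹ • x) * g x) ∧
      Tendsto (fun R => v (η R)) atTop (𝓝 a)

/-- `u` solves `∂_t u = Δ^{α/2} u + f`, `u(0) = u₀` weakly on `[0,T]`: for every Schwartz function `φ`,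
`⟨u(t),φ⟩ = ⟨u₀,φ⟩ + ∫₀ᵗ ⟨u(s),Δ^{α/2}φ⟩ ds + ∫₀ᵗ ⟨f(s),φ⟩ ds` for all `t ∈ [0,T]`, where the pairing
`w s = ⟨u(s),Δ^{α/2}φ⟩` exists for almost every `s` and both integrands are integrable. -/
def IsWeakSolution {d : ℕ} (α T : ℝ) (u₀ : 𝓢'(EuclideanSpace ℝ (Fin d), ℂ))
    (u f : ℝ → 𝓢'(EuclideanSpace ℝ (Fin d), ℂ)) : Prop :=
  ∀ φ : 𝓢(EuclideanSpace ℝ (Fin d), ℂ),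
    IntervalIntegrable (fun s => f s φ) volume 0 T ∧
    ∃ w : ℝ → ℂ,
      (∀ᵐ s ∂(volume.restrict (Set.Icc 0 T)), HasPairing (u s) (fracLaplacian α φ) (w s)) ∧
      IntervalIntegrable w volume 0 T ∧
      ∀ t ∈ Set.Icc 0 T, u t φ = u₀ φ + (∫ s in (0 : ℝ)..t, w s) + ∫ s in (0 : ℝ)..t, f s φ

end

open scoped FourierTransform

noncomputable section

section

/-- Young's inequality for the convolution of a nonnegative function with a finite measure. -/
theorem eLpNorm_lintegral_sub_le {G : Type*} [AddCommGroup G] [MeasurableSpace G]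
    [MeasurableAdd₂ G] [MeasurableNeg G] (μ : Measure G) [SFinite μ] [μ.IsAddRightInvariant]
    (ν : Measure G) [IsFiniteMeasure ν] {p : ℝ≥0∞} (hp : 1 ≤ p) {f : G → ℝ≥0∞}
    (hf : Measurable f) :
    eLpNorm (fun x => ∫⁻ z, f (x - z) ∂ν) p μ ≤ ν Set.univ * eLpNorm f p μ := by
  have hm : Measurable fun y : G × G => f (y.1 - y.2) := hf.comp (by fun_prop)
  rcases eq_or_ne p ⊤ with rfl | hpt
  · rw [eLpNorm_exponent_top, eLpNorm_exponent_top]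
    have h1 : ∀ᵐ x ∂μ, f x ≤ eLpNormEssSup f μ := by
      simpa using enorm_ae_le_eLpNormEssSup f μ
    have h2 : ∀ᵐ x ∂μ, ∀ᵐ z ∂ν, f (x - z) ≤ eLpNormEssSup f μ := by
      have : ∀ᵐ z ∂ν, ∀ᵐ x ∂μ, f (x - z) ≤ eLpNormEssSup f μ :=
        Eventually.of_forall fun z =>
          (measurePreserving_sub_right μ z).quasiMeasurePreserving.ae h1
      have hms : MeasurableSet {y : G × G | f (y.1 - y.2) ≤ eLpNormEssSup f μ} :=
        hm measurableSet_Iic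
      exact (Measure.ae_ae_comm hms).2 this
    refine eLpNormEssSup_le_of_ae_enorm_bound ?_
    filter_upwards [h2] with x hx
    calc ‖∫⁻ z, f (x - z) ∂ν‖ₑ = ∫⁻ z, f (x - z) ∂ν := rfl
      _ ≤ ∫⁻ _, eLpNormEssSup f μ ∂ν := lintegral_mono_ae hx
      _ = ν Set.univ * eLpNormEssSup f μ := by rw [lintegral_const, mul_comm]
  · have hp0 : p ≠ 0 := (zero_lt_one.trans_le hp).ne'
    set r := p.toReal with hr
    have hr1 : 1 ≤ r := by
      rw [hr]; simpa using (ENNReal.toReal_le_toReal ENNReal.one_ne_top hpt).2 hp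
    have hr0 : 0 < r := by linarith
    rw [eLpNorm_eq_lintegral_rpow_enorm_toReal hp0 hpt, eLpNorm_eq_lintegral_rpow_enorm_toReal hp0 hpt,
      ← hr]
    simp only [enorm_eq_self]
    have key : ∀ x, (∫⁻ z, f (x - z) ∂ν) ^ r ≤
        ν Set.univ ^ (r - 1) * ∫⁻ z, f (x - z) ^ r ∂ν := by
      intro x
      have hfx : Measurable fun z => f (x - z) := hf.comp (by fun_prop)
      have h := eLpNorm_le_eLpNorm_mul_rpow_measure_univ (μ := ν) (f := fun z => f (x - z)) hp
        hfx.aestronglyMeasurable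
      rw [eLpNorm_one_eq_lintegral_enorm, eLpNorm_eq_lintegral_rpow_enorm_toReal hp0 hpt, ← hr] at h
      simp only [enorm_eq_self] at h
      calc (∫⁻ z, f (x - z) ∂ν) ^ r ≤ _ := ENNReal.rpow_le_rpow h hr0.le
        _ = _ := by
          rw [ENNReal.mul_rpow_of_nonneg _ _ hr0.le, ← ENNReal.rpow_mul, ← ENNReal.rpow_mul,
            one_div_mul_cancel hr0.ne', ENNReal.rpow_one, mul_comm]
          congr 2
          simp only [ENNReal.toReal_one]
          field_simp
    calc (∫⁻ x, (∫⁻ z, f (x - z) ∂ν) ^ r ∂μ) ^ (1 / r)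
        ≤ (ν Set.univ ^ r * ∫⁻ x, f x ^ r ∂μ) ^ (1 / r) := by
          refine ENNReal.rpow_le_rpow ?_ (by positivity)
          calc _ ≤ ∫⁻ x, ν Set.univ ^ (r - 1) * ∫⁻ z, f (x - z) ^ r ∂ν ∂μ := lintegral_mono key
            _ = ν Set.univ ^ (r - 1) * ∫⁻ z, ∫⁻ x, f (x - z) ^ r ∂μ ∂ν := by
              rw [lintegral_const_mul _ (hm.pow_const r).lintegral_prod_right', lintegral_lintegral_swap]
              exact (hm.pow_const r).aemeasurable
            _ = ν Set.univ ^ (r - 1) * ∫⁻ _, ∫⁻ x, f x ^ r ∂μ ∂ν := by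
              congr 2
              ext z
              exact lintegral_sub_right_eq_self (fun x => f x ^ r) z
            _ = _ := by
              rw [lintegral_const, mul_comm (∫⁻ x, f x ^ r ∂μ), ← mul_assoc]
              congr 1
              nth_rw 2 [← ENNReal.rpow_one (ν Set.univ)]
              rw [← ENNReal.rpow_add_of_nonneg _ _ (by linarith) zero_le_one]
              ring_nf
      _ = _ := by
          rw [ENNReal.mul_rpow_of_nonneg _ _ (by positivity), ← ENNReal.rpow_mul,
            mul_one_div_cancel hr0.ne', ENNReal.rpow_one]

section Multiplier

variable {E : Type*} [NormedAddCommGroup E] [InnerProductSpace ℝ E] [FiniteDimensional ℝ E]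
  [MeasurableSpace E] [BorelSpace E]

/-- The Fourier multiplier with symbol `a` on Schwartz functions. -/
abbrev mult (a : E → ℂ) : 𝓢(E, ℂ) →L[ℂ] 𝓢(E, ℂ) := SchwartzMap.fourierMultiplierCLM ℂ a

theorem fourier_mult {a : E → ℂ} (ha : a.HasTemperateGrowth) (φ : 𝓢(E, ℂ)) (ξ : E) :
    𝓕 (mult a φ) ξ = a ξ * 𝓕 φ ξ := by
  simp [mult, SchwartzMap.fourierMultiplierCLM_apply, SchwartzMap.smulLeftCLM_apply_apply ha]

theorem schwartz_ext_fourier {φ ψ : 𝓢(E, ℂ)} (h : ∀ ξ, 𝓕 φ ξ = 𝓕 ψ ξ) : φ = ψ := by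
  have : 𝓕 φ = 𝓕 ψ := SchwartzMap.ext h
  simpa using congrArg (fun χ : 𝓢(E, ℂ) => (𝓕⁻ χ : 𝓢(E, ℂ))) this

theorem mult_comm {a b : E → ℂ} (ha : a.HasTemperateGrowth) (hb : b.HasTemperateGrowth)
    (φ : 𝓢(E, ℂ)) : mult a (mult b φ) = mult b (mult a φ) := by
  refine schwartz_ext_fourier fun ξ => ?_
  rw [fourier_mult ha, fourier_mult hb, fourier_mult hb, fourier_mult ha]; ring

/-- The `L^p` norm of a Schwartz function as a real number. -/
def lpn (p : ℝ≥0∞) (φ : 𝓢(E, ℂ)) : ℝ := ‖φ.toLp p (volume : Measure E)‖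

theorem lpn_nonneg (p : ℝ≥0∞) (φ : 𝓢(E, ℂ)) : 0 ≤ lpn p φ := by
  rw [lpn, SchwartzMap.norm_toLp]; exact ENNReal.toReal_nonneg

theorem ofReal_lpn (p : ℝ≥0∞) (φ : 𝓢(E, ℂ)) :
    ENNReal.ofReal (lpn p φ) = eLpNorm φ p (volume : Measure E) := by
  rw [lpn, SchwartzMap.norm_toLp, ENNReal.ofReal_toReal (φ.eLpNorm_lt_top p volume).ne]

theorem lpn_add_le (p : ℝ≥0∞) [Fact (1 ≤ p)] (φ ψ : 𝓢(E, ℂ)) :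
    lpn p (φ + ψ) ≤ lpn p φ + lpn p ψ := by
  have := map_add (SchwartzMap.toLpCLM ℂ ℂ p (volume : Measure E)) φ ψ
  simp only [SchwartzMap.toLpCLM_apply] at this
  rw [lpn, this]; exact norm_add_le _ _

theorem lpn_smul (p : ℝ≥0∞) [Fact (1 ≤ p)] (c : ℂ) (φ : 𝓢(E, ℂ)) :
    lpn p (c • φ) = ‖c‖ * lpn p φ := by
  have := map_smul (SchwartzMap.toLpCLM ℂ ℂ p (volume : Measure E)) c φ
  simp only [SchwartzMap.toLpCLM_apply] at this
  rw [lpn, this, norm_smul, lpn]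

theorem lpn_sub_le (p : ℝ≥0∞) [Fact (1 ≤ p)] (φ ψ : 𝓢(E, ℂ)) :
    lpn p (φ - ψ) ≤ lpn p φ + lpn p ψ := by
  have := map_sub (SchwartzMap.toLpCLM ℂ ℂ p (volume : Measure E)) φ ψ
  simp only [SchwartzMap.toLpCLM_apply] at this
  rw [lpn, this]; exact norm_sub_le _ _

theorem lpn_zero (p : ℝ≥0∞) [Fact (1 ≤ p)] : lpn p (0 : 𝓢(E, ℂ)) = 0 := by
  have := lpn_smul p 0 (0 : 𝓢(E, ℂ)); simpa using this

theorem lpn_sum_le (p : ℝ≥0∞) [Fact (1 ≤ p)] {ι : Type*} (s : Finset ι) (φ : ι → 𝓢(E, ℂ)) :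
    lpn p (∑ i ∈ s, φ i) ≤ ∑ i ∈ s, lpn p (φ i) := by
  classical
  induction s using Finset.induction_on with
  | empty => simp [lpn_zero]
  | insert i s hi ih =>
    rw [Finset.sum_insert hi, Finset.sum_insert hi]
    exact (lpn_add_le p _ _).trans (by linarith)

/-- Bounds on the `L^p` norm by a convolution with a nonnegative kernel. -/
theorem lpn_le_of_enorm_le (p : ℝ≥0∞) [hp : Fact (1 ≤ p)] (φ ψ : 𝓢(E, ℂ)) {k : E → ℝ≥0∞}
    (hk : Measurable k) {C : ℝ} (hC : 0 ≤ C) (hkC : ∫⁻ z, k z ≤ ENNReal.ofReal C)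
    (h : ∀ x, ‖ψ x‖ₑ ≤ ∫⁻ z, ‖φ (x - z)‖ₑ * k z) :
    lpn p ψ ≤ C * lpn p φ := by
  have hfin : IsFiniteMeasure ((volume : Measure E).withDensity k) :=
    isFiniteMeasure_withDensity (hkC.trans_lt ENNReal.ofReal_lt_top).ne
  have := eLpNorm_lintegral_sub_le (volume : Measure E) ((volume : Measure E).withDensity k)
    hp.out (f := fun x => ‖φ x‖ₑ) φ.continuous.enorm.measurable
  rw [← ENNReal.ofReal_le_ofReal_iff (by have := lpn_nonneg p φ; positivity),
    ENNReal.ofReal_mul hC, ofReal_lpn, ofReal_lpn]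
  calc eLpNorm ψ p volume
      ≤ eLpNorm (fun x => ∫⁻ z, ‖φ (x - z)‖ₑ ∂((volume : Measure E).withDensity k)) p volume := by
        refine eLpNorm_mono_enorm fun x => ?_
        rw [enorm_eq_self, lintegral_withDensity_eq_lintegral_mul _ hk]
        · simpa [mul_comm] using h x
        · exact (φ.continuous.enorm.measurable).comp (by fun_prop)
    _ ≤ _ := this
    _ ≤ _ := by
      rw [withDensity_apply _ MeasurableSet.univ, Measure.restrict_univ, eLpNorm_enorm]
      gcongr

theorem mult_apply_eq_integral (σ φ : 𝓢(E, ℂ)) (x : E) :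
    mult (σ : E → ℂ) φ x = ∫ z, 𝓕⁻ σ z * φ (x - z) := by
  have h := SchwartzMap.convolution_apply (ContinuousLinearMap.mul ℂ ℂ) (𝓕⁻ σ) φ x
  have h2 : mult (σ : E → ℂ) φ = SchwartzMap.convolution (ContinuousLinearMap.mul ℂ ℂ) (𝓕⁻ σ) φ := by
    refine schwartz_ext_fourier fun ξ => ?_
    rw [fourier_mult σ.hasTemperateGrowth, SchwartzMap.fourier_convolution,
      SchwartzMap.pairing_apply_apply]
    simp
  rw [h2, h]; rfl

theorem mult_apply_eq_integral' (σ φ : 𝓢(E, ℂ)) (x : E) :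
    mult (σ : E → ℂ) φ x = ∫ z, 𝓕⁻ σ (x - z) * φ z := by
  rw [mult_apply_eq_integral, ← integral_sub_left_eq_self _ volume x]
  simp

/-- The `L¹` norm of the kernel of a Fourier multiplier. -/
def kernelNorm (σ : 𝓢(E, ℂ)) : ℝ := ∫ z, ‖𝓕⁻ σ z‖

theorem kernelNorm_nonneg (σ : 𝓢(E, ℂ)) : 0 ≤ kernelNorm σ :=
  integral_nonneg fun _ => norm_nonneg _

theorem lintegral_enorm_schwartz (φ : 𝓢(E, ℂ)) :
    ∫⁻ z, ‖φ z‖ₑ = ENNReal.ofReal (∫ z, ‖φ z‖) := by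
  rw [ofReal_integral_norm_eq_lintegral_enorm φ.integrable]

theorem lpn_mult_le (p : ℝ≥0∞) [Fact (1 ≤ p)] (σ φ : 𝓢(E, ℂ)) :
    lpn p (mult (σ : E → ℂ) φ) ≤ kernelNorm σ * lpn p φ := by
  refine lpn_le_of_enorm_le p φ _ (k := fun z => ‖𝓕⁻ σ z‖ₑ)
    (𝓕⁻ σ).continuous.enorm.measurable (kernelNorm_nonneg σ) (lintegral_enorm_schwartz _).le
    fun x => ?_
  rw [mult_apply_eq_integral]
  refine (enorm_integral_le_lintegral_enorm _).trans (le_of_eq ?_)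
  simp [mul_comm]

theorem lpn_mult_le_L1 (p : ℝ≥0∞) [Fact (1 ≤ p)] (σ φ : 𝓢(E, ℂ)) :
    lpn p (mult (σ : E → ℂ) φ) ≤ (∫ z, ‖φ z‖) * lpn p (𝓕⁻ σ) := by
  refine lpn_le_of_enorm_le p (𝓕⁻ σ) _ (k := fun z => ‖φ z‖ₑ)
    φ.continuous.enorm.measurable (integral_nonneg fun _ => norm_nonneg _)
    (lintegral_enorm_schwartz _).le fun x => ?_
  rw [mult_apply_eq_integral']
  refine (enorm_integral_le_lintegral_enorm _).trans (le_of_eq ?_)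
  simp

end Multiplier

end

section

section SymbolBounds

variable {E : Type*} [NormedAddCommGroup E] [NormedSpace ℝ E]

theorem norm_iteratedFDeriv_smulLeftCLM_le {b : E → ℂ} (hb : b.HasTemperateGrowth) (φ : 𝓢(E, ℂ))
    (n : ℕ) (x : E) :
    ‖iteratedFDeriv ℝ n (SchwartzMap.smulLeftCLM ℂ b φ) x‖ ≤
      ∑ i ∈ Finset.range (n + 1),
        (n.choose i : ℝ) * ‖iteratedFDeriv ℝ i b x‖ * ‖iteratedFDeriv ℝ (n - i) φ x‖ := by
  have h : (SchwartzMap.smulLeftCLM ℂ b φ : E → ℂ) = fun y => b y * φ y := by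
    ext y; simp [SchwartzMap.smulLeftCLM_apply_apply hb]
  rw [h]
  exact norm_iteratedFDeriv_mul_le (N := ((⊤ : ℕ∞) : WithTop ℕ∞)) hb.1 φ.smooth' x
    (by exact_mod_cast le_top)

/-- Multiplication by a symbol with bounded derivatives preserves the decay weight. -/
theorem seminorm_smulLeftCLM_le {b : E → ℂ} (hb : b.HasTemperateGrowth) {n : ℕ} {M : ℝ}
    (hM : ∀ j ≤ n, ∀ x, ‖iteratedFDeriv ℝ j b x‖ ≤ M) (k : ℕ) (φ : 𝓢(E, ℂ)) :
    SchwartzMap.seminorm ℂ k n (SchwartzMap.smulLeftCLM ℂ b φ) ≤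
      M * ∑ i ∈ Finset.range (n + 1), (n.choose i : ℝ) * SchwartzMap.seminorm ℂ k (n - i) φ := by
  have hM0 : 0 ≤ M := (norm_nonneg _).trans (hM 0 (Nat.zero_le _) 0)
  refine SchwartzMap.seminorm_le_bound ℂ k n _ (by positivity) fun x => ?_
  calc ‖x‖ ^ k * ‖iteratedFDeriv ℝ n (SchwartzMap.smulLeftCLM ℂ b φ) x‖
      ≤ ‖x‖ ^ k * ∑ i ∈ Finset.range (n + 1),
        (n.choose i : ℝ) * ‖iteratedFDeriv ℝ i b x‖ * ‖iteratedFDeriv ℝ (n - i) φ x‖ := by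
        gcongr; exact norm_iteratedFDeriv_smulLeftCLM_le hb φ n x
    _ = ∑ i ∈ Finset.range (n + 1), (n.choose i : ℝ) * (‖iteratedFDeriv ℝ i b x‖ *
          (‖x‖ ^ k * ‖iteratedFDeriv ℝ (n - i) φ x‖)) := by
        rw [Finset.mul_sum]; exact Finset.sum_congr rfl fun i _ => by ring
    _ ≤ ∑ i ∈ Finset.range (n + 1), (n.choose i : ℝ) * (M * SchwartzMap.seminorm ℂ k (n - i) φ) := by
        refine Finset.sum_le_sum fun i hi => ?_
        gcongr
        · exact hM i (by simpa [Nat.lt_succ_iff] using hi) x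
        · exact SchwartzMap.le_seminorm ℂ k (n - i) φ x
    _ = _ := by rw [Finset.mul_sum]; exact Finset.sum_congr rfl fun i _ => by ring

theorem seminorm_smulLeftCLM_le_of_linear {b : E → ℂ} (hb : b.HasTemperateGrowth) {n : ℕ} {M : ℝ}
    (hM : ∀ j ≤ n, ∀ x, ‖iteratedFDeriv ℝ j b x‖ ≤ M * (1 + ‖x‖)) (k : ℕ) (φ : 𝓢(E, ℂ)) :
    SchwartzMap.seminorm ℂ k n (SchwartzMap.smulLeftCLM ℂ b φ) ≤
      M * ∑ i ∈ Finset.range (n + 1), (n.choose i : ℝ) *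
        (SchwartzMap.seminorm ℂ k (n - i) φ + SchwartzMap.seminorm ℂ (k + 1) (n - i) φ) := by
  have hM0 : 0 ≤ M := by
    have := (norm_nonneg _).trans (hM 0 (Nat.zero_le _) 0); simpa using this
  refine SchwartzMap.seminorm_le_bound ℂ k n _ (by positivity) fun x => ?_
  calc ‖x‖ ^ k * ‖iteratedFDeriv ℝ n (SchwartzMap.smulLeftCLM ℂ b φ) x‖
      ≤ ‖x‖ ^ k * ∑ i ∈ Finset.range (n + 1),
        (n.choose i : ℝ) * ‖iteratedFDeriv ℝ i b x‖ * ‖iteratedFDeriv ℝ (n - i) φ x‖ := by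
        gcongr; exact norm_iteratedFDeriv_smulLeftCLM_le hb φ n x
    _ ≤ ‖x‖ ^ k * ∑ i ∈ Finset.range (n + 1),
        (n.choose i : ℝ) * (M * (1 + ‖x‖)) * ‖iteratedFDeriv ℝ (n - i) φ x‖ := by
        gcongr with i hi
        exact hM i (by simpa [Nat.lt_succ_iff] using hi) x
    _ = M * ∑ i ∈ Finset.range (n + 1), (n.choose i : ℝ) *
          (‖x‖ ^ k * ‖iteratedFDeriv ℝ (n - i) φ x‖ +
            ‖x‖ ^ (k + 1) * ‖iteratedFDeriv ℝ (n - i) φ x‖) := by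
        rw [Finset.mul_sum, Finset.mul_sum]; exact Finset.sum_congr rfl fun i _ => by ring
    _ ≤ _ := by
        gcongr
        · exact SchwartzMap.le_seminorm ℂ k _ φ x
        · exact SchwartzMap.le_seminorm ℂ (k + 1) _ φ x

theorem exists_bound_iteratedFDeriv_of_hasCompactSupport {b : E → ℂ}
    (hb : ContDiff ℝ ((⊤ : ℕ∞) : WithTop ℕ∞) b) (hs : HasCompactSupport b) (n : ℕ) :
    ∃ M, 0 ≤ M ∧ ∀ j ≤ n, ∀ x, ‖iteratedFDeriv ℝ j b x‖ ≤ M := by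
  set φ := hs.toSchwartzMap hb
  refine ⟨∑ j ∈ Finset.range (n + 1), SchwartzMap.seminorm ℝ 0 j φ,
    Finset.sum_nonneg fun i _ => apply_nonneg _ _, fun j hj x => ?_⟩
  have h1 : ‖iteratedFDeriv ℝ j b x‖ ≤ SchwartzMap.seminorm ℝ 0 j φ := by
    have := SchwartzMap.le_seminorm ℝ 0 j φ x
    rwa [pow_zero, one_mul] at this
  exact h1.trans (Finset.single_le_sum (f := fun j => SchwartzMap.seminorm ℝ 0 j φ)
    (fun i _ => apply_nonneg _ _) (Finset.mem_range.2 (by omega)))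

theorem contDiff_dilate {b : E → ℂ} (hb : ContDiff ℝ ((⊤ : ℕ∞) : WithTop ℕ∞) b) (c : ℝ) :
    ContDiff ℝ ((⊤ : ℕ∞) : WithTop ℕ∞) fun x => b (c • x) :=
  hb.comp (contDiff_const_smul c)

theorem hasCompactSupport_dilate {b : E → ℂ} (hs : HasCompactSupport b) {c : ℝ} (hc : c ≠ 0) :
    HasCompactSupport fun x => b (c • x) :=
  hs.comp_homeomorph (Homeomorph.smulOfNeZero c hc)

/-- A smooth cutoff `θ (x / R)` converges to the identity on the Schwartz space. -/
theorem tendsto_cutoff {θ : E → ℂ} (hθ : ContDiff ℝ ((⊤ : ℕ∞) : WithTop ℕ∞) θ)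
    (hs : HasCompactSupport θ) (h1 : ∀ᶠ x in 𝓝 0, θ x = 1) (φ : 𝓢(E, ℂ)) :
    Tendsto (fun R : ℝ => SchwartzMap.smulLeftCLM ℂ (fun x => θ (R⁻¹ • x)) φ) atTop (𝓝 φ) := by
  rw [(schwartz_withSeminorms ℂ E ℂ).tendsto_nhds]
  rintro ⟨k, n⟩ ε hε
  obtain ⟨M, hM0, hM⟩ := exists_bound_iteratedFDeriv_of_hasCompactSupport hθ hs n
  obtain ⟨δ, hδ, hδ1⟩ := Metric.eventually_nhds_iff.1 h1
  set M' := max M ((M + 1) / δ) with hM'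
  have htg : ∀ R : ℝ, 0 < R → (fun x => θ (R⁻¹ • x)).HasTemperateGrowth := fun R hR =>
    (hasCompactSupport_dilate hs (inv_ne_zero hR.ne')).hasTemperateGrowth (contDiff_dilate hθ _)
  have hbound : ∀ R : ℝ, 1 ≤ R → ∀ j ≤ n, ∀ x,
      ‖iteratedFDeriv ℝ j (fun x => θ (R⁻¹ • x) - 1) x‖ ≤ M' * R⁻¹ * (1 + ‖x‖) := by
    intro R hR j hj x
    have hR0 : 0 < R := by linarith
    rcases Nat.eq_zero_or_pos j with rfl | hj0
    · rw [norm_iteratedFDeriv_zero]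
      by_cases hx : ‖R⁻¹ • x‖ < δ
      · rw [hδ1 (by simpa using hx)]; simp; positivity
      · rw [not_lt] at hx
        calc ‖θ (R⁻¹ • x) - 1‖ ≤ ‖θ (R⁻¹ • x)‖ + 1 := by
              simpa using norm_sub_le (θ (R⁻¹ • x)) 1
          _ ≤ M + 1 := by
              have := hM 0 (Nat.zero_le _) (R⁻¹ • x); rw [norm_iteratedFDeriv_zero] at this
              linarith
          _ = (M + 1) / δ * δ := by field_simp
          _ ≤ M' * ‖R⁻¹ • x‖ := by gcongr; exact le_max_right _ _
          _ = M' * R⁻¹ * ‖x‖ := by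
              rw [norm_smul, Real.norm_of_nonneg (by positivity)]; ring
          _ ≤ _ := by gcongr; linarith
    · have e : iteratedFDeriv ℝ j (fun x => θ (R⁻¹ • x) - 1) x
          = R⁻¹ ^ j • iteratedFDeriv ℝ j θ (R⁻¹ • x) := by
        have h2 := congrFun (iteratedFDeriv_comp_const_smul (𝕜 := ℝ) (i := j) R⁻¹
          (hθ.of_le (by exact_mod_cast le_top))) x
        rw [← h2]
        have : (fun x => θ (R⁻¹ • x) - 1) = (fun x => θ (R⁻¹ • x)) - fun _ => (1 : ℂ) := rfl
        rw [this, iteratedFDeriv_sub_apply, iteratedFDeriv_const_of_ne hj0.ne']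
        · simp
        · exact ((contDiff_dilate hθ _).of_le (by exact_mod_cast le_top)).contDiffAt
        · exact contDiffAt_const
      rw [e, norm_smul, norm_pow, Real.norm_of_nonneg (by positivity)]
      calc R⁻¹ ^ j * ‖iteratedFDeriv ℝ j θ (R⁻¹ • x)‖ ≤ R⁻¹ * M := by
            gcongr
            · exact pow_le_of_le_one (by positivity) (inv_le_one_of_one_le₀ hR) hj0.ne'
            · exact hM j hj _
        _ ≤ M' * R⁻¹ * 1 := by
            rw [mul_comm, mul_one]; gcongr; exact le_max_left _ _
        _ ≤ _ := by gcongr; simp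
  set S := ∑ i ∈ Finset.range (n + 1), (n.choose i : ℝ) *
        (SchwartzMap.seminorm ℂ k (n - i) φ + SchwartzMap.seminorm ℂ (k + 1) (n - i) φ)
  have hlim : Tendsto (fun R : ℝ => M' * R⁻¹ * S) atTop (𝓝 0) := by
    simpa using (tendsto_inv_atTop_zero.const_mul M').mul_const S
  filter_upwards [hlim.eventually (gt_mem_nhds hε), eventually_ge_atTop 1] with R h2 hR
  have hR0 : 0 < R := by linarith
  have e : SchwartzMap.smulLeftCLM ℂ (fun x => θ (R⁻¹ • x)) φ - φ =
      SchwartzMap.smulLeftCLM ℂ (fun x => θ (R⁻¹ • x) - 1) φ := by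
    ext x
    have : (fun x => θ (R⁻¹ • x) - 1).HasTemperateGrowth :=
      (htg R hR0).sub (Function.HasTemperateGrowth.const (1 : ℂ))
    rw [SchwartzMap.smulLeftCLM_apply_apply this]
    simp [SchwartzMap.smulLeftCLM_apply_apply (htg R hR0), sub_mul]
  rw [e]
  exact (seminorm_smulLeftCLM_le_of_linear
    ((htg R hR0).sub (Function.HasTemperateGrowth.const (1 : ℂ))) (hbound R hR) k φ).trans_lt h2

end SymbolBounds

/-- The pairing with a Schwartz function is the value of the distribution. -/
theorem HasPairing.eq_apply {d : ℕ} {v : 𝓢'(EuclideanSpace ℝ (Fin d), ℂ)}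
    {φ : 𝓢(EuclideanSpace ℝ (Fin d), ℂ)} {a : ℂ} (h : HasPairing v φ a) : a = v φ := by
  let B : ContDiffBump (0 : EuclideanSpace ℝ (Fin d)) := ⟨1, 2, one_pos, one_lt_two⟩
  set θ : EuclideanSpace ℝ (Fin d) → ℂ := fun x => ((B x : ℝ) : ℂ)
  have hθ : ContDiff ℝ ((⊤ : ℕ∞) : WithTop ℕ∞) θ := Complex.ofRealCLM.contDiff.comp B.contDiff
  have hs : HasCompactSupport θ := B.hasCompactSupport.comp_left Complex.ofReal_zero
  have h1 : ∀ᶠ x in 𝓝 0, θ x = 1 := by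
    filter_upwards [B.eventuallyEq_one] with x hx
    simp [θ, hx]
  obtain ⟨η, hη, hlim⟩ := h θ hθ hs h1
  refine tendsto_nhds_unique hlim ?_
  refine (((map_continuous v).tendsto φ).comp (tendsto_cutoff hθ hs h1 φ)).congr' ?_
  filter_upwards [eventually_gt_atTop 0] with R hR
  have : (fun x => θ (R⁻¹ • x)).HasTemperateGrowth :=
    (hasCompactSupport_dilate hs (inv_ne_zero hR.ne')).hasTemperateGrowth (contDiff_dilate hθ _)
  refine congrArg v (SchwartzMap.ext fun x => ?_)
  rw [hη R hR, SchwartzMap.smulLeftCLM_apply_apply this]; rfl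

end

section

variable {d : ℕ}

theorem enorm_apply_le_distLpNorm {p p' : ℝ≥0∞} [Fact (1 ≤ p)] [hpp : p.HolderConjugate p']
    (v : 𝓢'(EuclideanSpace ℝ (Fin d), ℂ)) (φ : 𝓢(EuclideanSpace ℝ (Fin d), ℂ)) :
    ‖v φ‖ₑ ≤ distLpNorm p v * ENNReal.ofReal (lpn p' φ) := by
  rw [ofReal_lpn]
  rcases eq_or_ne (eLpNorm φ p' volume) 0 with h0 | h0
  · have hp' : p' ≠ 0 := (ENNReal.HolderConjugate.ne_zero p' p)
    have : φ = 0 := by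
      rw [eLpNorm_eq_zero_iff φ.continuous.aestronglyMeasurable hp'] at h0
      have := (Continuous.ae_eq_iff_eq volume φ.continuous continuous_zero).1 h0
      exact SchwartzMap.ext fun x => congrFun this x
    simp [this]
  · unfold distLpNorm
    simp_rw [ENNReal.iInf_mul_of_ne h0 (φ.eLpNorm_lt_top p' volume).ne]
    refine le_iInf₂ fun g hg => ?_
    rw [← hg, Lp.toTemperedDistribution_apply]
    refine (enorm_integral_le_lintegral_enorm _).trans ?_
    have h2 := eLpNorm_smul_le_mul_eLpNorm (r := 1) (p := p') (q := p) (Lp.aestronglyMeasurable g)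
      φ.continuous.aestronglyMeasurable (μ := volume)
    rw [eLpNorm_one_eq_lintegral_enorm] at h2
    refine h2.trans (le_of_eq ?_)
    rw [mul_comm, Lp.enorm_def]

section Duality

variable {E : Type*} [NormedAddCommGroup E] [InnerProductSpace ℝ E] [FiniteDimensional ℝ E]
  [MeasurableSpace E] [BorelSpace E]

/-- A functional on Schwartz functions that is bounded in `L¹` is given by a locally integrable
function. -/
theorem exists_repr_of_L1_bound (v : 𝓢(E, ℂ) →ₗ[ℂ] ℂ) {C : ℝ} (hC : 0 ≤ C)
    (hv : ∀ φ, ‖v φ‖ ≤ C * ∫ z, ‖φ z‖) :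
    ∃ G : E → ℂ, StronglyMeasurable G ∧ LocallyIntegrable G volume ∧
      ∀ φ, v φ = ∫ x, φ x * G x := by
  set N : ℝ := Module.finrank ℝ E + 1
  set γ : E → ℂ := fun x => (((1 + ‖x‖ ^ 2) ^ (-N) : ℝ) : ℂ) with hγ
  set γ' : E → ℂ := fun x => (((1 + ‖x‖ ^ 2) ^ N : ℝ) : ℂ) with hγ'
  have hN : (0 : ℝ) < N := by positivity
  have tγ : γ.HasTemperateGrowth := by
    have := Function.hasTemperateGrowth_one_add_norm_sq_rpow E (-N)
    exact Function.HasTemperateGrowth.comp Function.Complex.hasTemperateGrowth_ofReal this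
  have tγ' : γ'.HasTemperateGrowth := by
    have := Function.hasTemperateGrowth_one_add_norm_sq_rpow E N
    exact Function.HasTemperateGrowth.comp Function.Complex.hasTemperateGrowth_ofReal this
  have hγγ' : ∀ x, γ x * γ' x = 1 := fun x => by
    simp only [hγ, hγ']
    rw [← Complex.ofReal_mul, ← Real.rpow_add (by positivity)]; simp
  have hγ2 : MemLp γ 2 volume := by
    rw [memLp_two_iff_integrable_sq_norm tγ.1.continuous.aestronglyMeasurable]
    have := integrable_rpow_neg_one_add_norm_sq (E := E) (μ := volume) (r := 4 * N)
      (by have : (Module.finrank ℝ E : ℝ) < N := by simp [N]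
          linarith)
    refine this.congr (Eventually.of_forall fun x => ?_)
    simp only [hγ, Complex.norm_real]
    rw [Real.norm_of_nonneg (by positivity), ← Real.rpow_mul_natCast (by positivity)]
    congr 1; push_cast; ring
  set L2 := Lp ℂ 2 (volume : Measure E)
  set ι : 𝓢(E, ℂ) →ₗ[ℂ] L2 := (SchwartzMap.toLpCLM ℂ ℂ 2 (volume : Measure E)).toLinearMap
  have hι : Function.Injective ι := SchwartzMap.injective_toLp 2 (volume : Measure E)
  set w : 𝓢(E, ℂ) →ₗ[ℂ] ℂ := v ∘ₗ (SchwartzMap.smulLeftCLM ℂ γ).toLinearMap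
  set K : ℝ := C * (eLpNorm γ 2 volume).toReal
  have hw : ∀ φ, ‖w φ‖ ≤ K * ‖ι φ‖ := by
    intro φ
    have h1 := eLpNorm_smul_le_mul_eLpNorm (r := 1) (p := 2) (q := 2) φ.continuous.aestronglyMeasurable
      tγ.1.continuous.aestronglyMeasurable (μ := (volume : Measure E))
    have h2 : (∫ z, ‖SchwartzMap.smulLeftCLM ℂ γ φ z‖) ≤
        (eLpNorm γ 2 volume).toReal * ‖ι φ‖ := by
      have h3 : ‖ι φ‖ = (eLpNorm φ 2 volume).toReal := SchwartzMap.norm_toLp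
      rw [h3, ← ENNReal.toReal_mul,
        integral_norm_eq_lintegral_enorm (SchwartzMap.continuous _).aestronglyMeasurable]
      refine ENNReal.toReal_mono (ENNReal.mul_ne_top hγ2.2.ne (φ.eLpNorm_lt_top 2 volume).ne) ?_
      rw [eLpNorm_one_eq_lintegral_enorm] at h1
      refine le_trans (le_of_eq ?_) h1
      congr 1; ext x; rw [SchwartzMap.smulLeftCLM_apply_apply tγ]; rfl
    calc ‖w φ‖ ≤ C * ∫ z, ‖SchwartzMap.smulLeftCLM ℂ γ φ z‖ := hv _
      _ ≤ C * ((eLpNorm γ 2 volume).toReal * ‖ι φ‖) := by gcongr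
      _ = K * ‖ι φ‖ := by simp only [K]; ring
  let e := LinearEquiv.ofInjective ι hι
  let f : LinearMap.range ι →ₗ[ℂ] ℂ := w ∘ₗ e.symm.toLinearMap
  have hf : ∀ y, ‖f y‖ ≤ K * ‖y‖ := by
    intro y
    obtain ⟨φ, rfl⟩ := e.surjective y
    simpa [f, e] using hw φ
  obtain ⟨g, hg, -⟩ := exists_extension_norm_eq (LinearMap.range ι) (f.mkContinuous K hf)
  set h := (InnerProductSpace.toDual ℂ L2).symm g
  have hwh : ∀ φ : 𝓢(E, ℂ), w φ = ∫ x, starRingEnd ℂ (h x) * φ x := by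
    intro φ
    have h1 : g (ι φ) = w φ := by
      have := hg (e φ)
      rw [LinearMap.mkContinuous_apply] at this
      simpa [f, e] using this
    have h2 : inner ℂ h (ι φ) = g (ι φ) := by
      simp [h]
    rw [← h1, ← h2, MeasureTheory.L2.inner_def]
    refine integral_congr_ae ?_
    filter_upwards [SchwartzMap.coeFn_toLp φ 2 (volume : Measure E)] with x hx
    have : (ι φ : E → ℂ) x = φ x := hx
    rw [this]; simp [mul_comm]
  refine ⟨fun x => starRingEnd ℂ (h x) * γ' x, ?_, ?_, fun φ => ?_⟩
  · exact (Complex.continuous_conj.comp_stronglyMeasurable (Lp.stronglyMeasurable h)).mul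
      tγ'.1.continuous.stronglyMeasurable
  · have h1 : LocallyIntegrable (fun x => starRingEnd ℂ (h x)) (volume : Measure E) := by
      refine MemLp.locallyIntegrable (p := 2) ?_ one_le_two
      exact (Lp.memLp h).star
    exact h1.mul_continuous tγ'.1.continuous
  · have : φ = SchwartzMap.smulLeftCLM ℂ γ (SchwartzMap.smulLeftCLM ℂ γ' φ) := by
      ext x
      rw [SchwartzMap.smulLeftCLM_apply_apply tγ, SchwartzMap.smulLeftCLM_apply_apply tγ',
        smul_smul, hγγ', one_smul]
    conv_lhs => rw [this]
    change w _ = _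
    rw [hwh]
    congr 1; ext x
    rw [SchwartzMap.smulLeftCLM_apply_apply tγ', smul_eq_mul]; ring

/-- A bound on Schwartz test functions extends to bounded test functions of bounded support. -/
theorem norm_integral_mul_le_of_schwartz {p : ℝ≥0∞} (hp : 1 ≤ p) {G : E → ℂ}
    (hG : LocallyIntegrable G volume) {D : ℝ} (hD : 0 ≤ D)
    (h : ∀ φ : 𝓢(E, ℂ), ‖∫ x, φ x * G x‖ ≤ D * lpn p φ)
    {k : E → ℂ} (hk : StronglyMeasurable k) {B R : ℝ} (hB : ∀ x, ‖k x‖ ≤ B)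
    (hR : ∀ x, R < ‖x‖ → k x = 0) :
    ENNReal.ofReal ‖∫ x, k x * G x‖ ≤ ENNReal.ofReal D * eLpNorm k p volume := by
  have hB0 : 0 ≤ B := (norm_nonneg _).trans (hB 0)
  let b : ℕ → ContDiffBump (0 : E) := fun n =>
    ⟨1 / (2 * (n + 1)), 1 / (n + 1), by positivity, by
      rw [div_lt_div_iff_of_pos_left one_pos (by positivity) (by positivity)]
      have : (0 : ℝ) < n + 1 := by positivity
      linarith⟩
  have hrOut : Tendsto (fun n => (b n).rOut) atTop (𝓝 0) := tendsto_one_div_add_atTop_nhds_zero_nat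
  have hrIn : ∀ᶠ n in atTop, (b n).rOut ≤ 2 * (b n).rIn := Eventually.of_forall fun n => by
    simp only [b]; field_simp; rfl
  have hkc : HasCompactSupport k :=
    HasCompactSupport.intro (isCompact_closedBall (0 : E) R) fun x hx => hR x (by simpa using hx)
  have hkint : Integrable k volume :=
    (integrableOn_iff_integrable_of_support_subset (s := Metric.closedBall 0 R) (by
      intro x hx; by_contra hc; exact hx (hR x (by simpa using hc)))).1
      (Measure.integrableOn_of_bounded (M := B) (isCompact_closedBall _ _).measure_lt_top.ne
        hk.aestronglyMeasurable (Eventually.of_forall hB))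
  have hlim := ContDiffBump.ae_convolution_tendsto_right_of_locallyIntegrable hrOut hrIn
    hkint.locallyIntegrable
  set c : ℕ → E → ℂ := fun n =>
    convolution ((b n).normed volume) k (ContinuousLinearMap.lsmul ℝ ℝ) volume with hc
  have csm : ∀ n, ContDiff ℝ ((⊤ : ℕ∞) : WithTop ℕ∞) (c n) := fun n =>
    (b n).hasCompactSupport_normed.contDiff_convolution_left _ (b n).contDiff_normed
      hkint.locallyIntegrable
  have ccs : ∀ n, HasCompactSupport (c n) := fun n =>
    (b n).hasCompactSupport_normed.convolution _ hkc
  have hce : ∀ n x, c n x = ∫ z, ((b n).normed volume z) • k (x - z) := fun n x => rfl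
  have hbn : ∀ n, ∫⁻ z, ENNReal.ofReal ((b n).normed volume z) = 1 := fun n => by
    rw [← ofReal_integral_eq_lintegral_ofReal]
    · rw [(b n).integral_normed]; simp
    · exact (b n).integrable_normed
    · exact Eventually.of_forall fun x => (b n).nonneg_normed x
  have hcle : ∀ n x, ‖c n x‖ₑ ≤ ∫⁻ z, ‖k (x - z)‖ₑ * ENNReal.ofReal ((b n).normed volume z) := by
    intro n x
    rw [hce]
    refine (enorm_integral_le_lintegral_enorm _).trans (le_of_eq ?_)
    congr 1; ext z
    rw [enorm_smul, mul_comm, Real.enorm_eq_ofReal ((b n).nonneg_normed z)]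
  have hcB : ∀ n x, ‖c n x‖ ≤ B := by
    intro n x
    have : ‖c n x‖ₑ ≤ ENNReal.ofReal B := by
      refine (hcle n x).trans ?_
      calc _ ≤ ∫⁻ z, ENNReal.ofReal B * ENNReal.ofReal ((b n).normed volume z) := by
            gcongr with z
            rw [← ofReal_norm]; exact ENNReal.ofReal_le_ofReal (hB _)
        _ = _ := by
            rw [lintegral_const_mul' _ _ ENNReal.ofReal_ne_top, hbn, mul_one]
    rwa [← ofReal_norm, ENNReal.ofReal_le_ofReal_iff hB0] at this
  have hcR : ∀ n x, R + 1 < ‖x‖ → c n x = 0 := by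
    intro n x hx
    rw [hce]
    refine integral_eq_zero_of_ae (Eventually.of_forall fun z => ?_)
    by_cases hz : z ∈ Metric.ball (0 : E) (b n).rOut
    · have h1 : ‖z‖ < 1 := by
        have h2 : ‖z‖ < 1 / ((n : ℝ) + 1) := by simpa [b] using hz
        refine h2.trans_le ?_
        rw [div_le_one (by positivity)]; simp
      have : R < ‖x - z‖ := by
        have := norm_sub_norm_le x z; linarith
      simp [hR _ this]
    · have : (b n).normed volume z = 0 := by
        rw [← Function.notMem_support, (b n).support_normed_eq]; exact hz
      simp [this]
  have hcp : ∀ n, eLpNorm (c n) p volume ≤ eLpNorm k p volume := by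
    intro n
    have hmeas : Measurable fun z => ENNReal.ofReal ((b n).normed volume z) :=
      ((b n).continuous_normed.measurable).ennreal_ofReal
    have hfin : IsFiniteMeasure ((volume : Measure E).withDensity
        fun z => ENNReal.ofReal ((b n).normed volume z)) :=
      isFiniteMeasure_withDensity (by rw [hbn]; exact ENNReal.one_ne_top)
    have h1 := eLpNorm_lintegral_sub_le (volume : Measure E) ((volume : Measure E).withDensity
        fun z => ENNReal.ofReal ((b n).normed volume z)) hp (f := fun x => ‖k x‖ₑ)
        hk.measurable.enorm
    rw [withDensity_apply _ MeasurableSet.univ, Measure.restrict_univ, hbn, one_mul,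
      eLpNorm_enorm] at h1
    refine (eLpNorm_mono_enorm fun x => ?_).trans h1
    rw [enorm_eq_self, lintegral_withDensity_eq_lintegral_mul _ hmeas]
    · simpa [mul_comm] using hcle n x
    · exact hk.measurable.enorm.comp (by fun_prop)
  have hlim2 : Tendsto (fun n => ∫ x, c n x * G x) atTop (𝓝 (∫ x, k x * G x)) := by
    refine tendsto_integral_of_dominated_convergence
      (fun x => B * (Metric.closedBall (0 : E) (R + 1)).indicator (fun x => ‖G x‖) x) ?_ ?_ ?_ ?_
    · exact fun n => (csm n).continuous.aestronglyMeasurable.mul hG.aestronglyMeasurable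
    · refine Integrable.const_mul ?_ B
      refine IntegrableOn.integrable_indicator ?_ Metric.isClosed_closedBall.measurableSet
      exact (hG.integrableOn_isCompact (isCompact_closedBall _ _)).norm
    · intro n
      refine Eventually.of_forall fun x => ?_
      by_cases hx : R + 1 < ‖x‖
      · rw [hcR n x hx, zero_mul, norm_zero]
        exact mul_nonneg hB0 (Set.indicator_nonneg (fun _ _ => norm_nonneg _) _)
      · rw [Set.indicator_of_mem (by simpa using hx), norm_mul]
        gcongr; exact hcB n x
    · filter_upwards [hlim] with x hx
      exact hx.mul_const _
  have hb : ∀ n, ENNReal.ofReal ‖∫ x, c n x * G x‖ ≤ ENNReal.ofReal D * eLpNorm k p volume := by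
    intro n
    set φ := (ccs n).toSchwartzMap (csm n)
    have h1 := h φ
    calc _ ≤ ENNReal.ofReal (D * lpn p φ) := ENNReal.ofReal_le_ofReal h1
      _ = ENNReal.ofReal D * eLpNorm (c n) p volume := by
        rw [ENNReal.ofReal_mul hD, ofReal_lpn]; rfl
      _ ≤ _ := by gcongr; exact hcp n
  exact le_of_tendsto (ENNReal.tendsto_ofReal hlim2.norm) (Eventually.of_forall hb)

theorem ofReal_norm_integral_indicator {T : Set E} (hT : MeasurableSet T) (hfin : volume T < ⊤)
    {F : E → ℝ} (hF : Measurable F) {B : ℝ} (h0 : ∀ x, 0 ≤ F x) (hB : ∀ x ∈ T, F x ≤ B) :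
    ENNReal.ofReal ‖∫ x, ((T.indicator F x : ℝ) : ℂ)‖ = ∫⁻ x in T, ENNReal.ofReal (F x) := by
  rw [integral_complex_ofReal, Complex.norm_real, integral_indicator hT,
    Real.norm_of_nonneg (integral_nonneg h0), ofReal_integral_eq_lintegral_ofReal]
  · refine Measure.integrableOn_of_bounded (M := B) hfin.ne hF.aestronglyMeasurable ?_
    filter_upwards [ae_restrict_mem hT] with x hx
    rw [Real.norm_of_nonneg (h0 x)]; exact hB x hx
  · exact Eventually.of_forall h0

/-- The `L^p` norm of a function by duality with bounded functions of bounded support. -/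
theorem eLpNorm_le_of_duality {p p' : ℝ≥0∞} [hpp : p.HolderConjugate p'] {G : E → ℂ}
    (hG : StronglyMeasurable G) {D : ℝ} (hD : 0 ≤ D)
    (h : ∀ (k : E → ℂ) (B R : ℝ), StronglyMeasurable k → (∀ x, ‖k x‖ ≤ B) →
      (∀ x, R < ‖x‖ → k x = 0) →
      ENNReal.ofReal ‖∫ x, k x * G x‖ ≤ ENNReal.ofReal D * eLpNorm k p' volume) :
    eLpNorm G p volume ≤ ENNReal.ofReal D := by
  have hGm : Measurable fun x => ‖G x‖ := hG.measurable.norm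
  have hp1 : 1 ≤ p := ENNReal.HolderConjugate.one_le p p'
  set S : ℕ → Set E := fun n => {x | ‖G x‖ ≤ n ∧ ‖x‖ ≤ n} with hS
  have hSm : ∀ n, MeasurableSet (S n) := fun n =>
    (measurableSet_le hGm measurable_const).inter (measurableSet_le measurable_norm measurable_const)
  have hSfin : ∀ n, volume (S n) < ⊤ := fun n =>
    (measure_mono (fun x hx => by simpa using hx.2)).trans_lt
      (isCompact_closedBall (0 : E) n).measure_lt_top
  have hSmono : Monotone S := fun n m hnm x hx =>
    ⟨hx.1.trans (by exact_mod_cast hnm), hx.2.trans (by exact_mod_cast hnm)⟩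
  have hSU : ⋃ n, S n = Set.univ := by
    refine Set.eq_univ_of_forall fun x => Set.mem_iUnion.2 ?_
    obtain ⟨n, hn⟩ := exists_nat_ge (max ‖G x‖ ‖x‖)
    exact ⟨n, (le_max_left _ _).trans hn, (le_max_right _ _).trans hn⟩
  rcases eq_or_ne p ⊤ with rfl | hpt
  · have hp' : p' = 1 := (ENNReal.HolderConjugate.eq_top_iff_eq_one ⊤ p').1 rfl
    subst hp'
    have hT : ∀ n m : ℕ, volume (S n ∩ {x | D + 1 / ((m : ℝ) + 1) ≤ ‖G x‖}) = 0 := by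
      intro n m
      set ε : ℝ := 1 / ((m : ℝ) + 1)
      have hε : 0 < ε := by positivity
      set T := S n ∩ {x | D + ε ≤ ‖G x‖} with hT
      have hTm : MeasurableSet T := (hSm n).inter (measurableSet_le measurable_const hGm)
      have hTfin : volume T < ⊤ := (measure_mono Set.inter_subset_left).trans_lt (hSfin n)
      set k : E → ℂ := T.indicator fun x => ((‖G x‖⁻¹ : ℝ) : ℂ) * starRingEnd ℂ (G x) with hk
      have hkG : ∀ x, k x * G x = ((T.indicator (fun x => ‖G x‖) x : ℝ) : ℂ) := by
        intro x
        by_cases hx : x ∈ T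
        · rw [hk, Set.indicator_of_mem hx, Set.indicator_of_mem hx, mul_assoc, Complex.conj_mul']
          have : ‖G x‖ ≠ 0 := by have := hx.2; simp only [Set.mem_ofPred_eq] at this; linarith
          rw [← Complex.ofReal_pow, ← Complex.ofReal_mul]; congr 1; field_simp
        · simp [hk, Set.indicator_of_notMem hx]
      have hk1 : ∀ x, ‖k x‖ ≤ T.indicator (fun _ => (1 : ℝ)) x := by
        intro x
        by_cases hx : x ∈ T
        · rw [hk, Set.indicator_of_mem hx, Set.indicator_of_mem hx]
          simp only [norm_mul, Complex.norm_real, norm_inv, norm_norm, RCLike.norm_conj]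
          exact inv_mul_le_one
        · simp [hk, Set.indicator_of_notMem hx]
      have hks : StronglyMeasurable k :=
        (((Complex.continuous_ofReal.measurable.comp hGm.inv).mul
          (Complex.continuous_conj.measurable.comp hG.measurable)).indicator hTm).stronglyMeasurable
      have h1 := h k 1 n hks (fun x => (hk1 x).trans (Set.indicator_le_self' (by simp) x)) (by
        intro x hx
        refine Set.indicator_of_notMem (fun hxT => ?_) _
        exact absurd hxT.1.2 (not_le.2 hx))
      have h2 : eLpNorm k 1 volume ≤ volume T := by
        rw [eLpNorm_one_eq_lintegral_enorm, ← lintegral_indicator_one hTm]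
        refine lintegral_mono fun x => ?_
        rw [← ofReal_norm]
        refine (ENNReal.ofReal_le_ofReal (hk1 x)).trans (le_of_eq ?_)
        by_cases hx : x ∈ T <;> simp [hx]
      have h3 : ENNReal.ofReal (D + ε) * volume T ≤ ENNReal.ofReal ‖∫ x, k x * G x‖ := by
        simp_rw [hkG]
        rw [ofReal_norm_integral_indicator hTm hTfin hGm (fun _ => norm_nonneg _)
          (fun x hx => hx.1.1), ← setLIntegral_const]
        exact setLIntegral_mono hGm.ennreal_ofReal fun x hx => ENNReal.ofReal_le_ofReal hx.2
      have h4 : ENNReal.ofReal (D + ε) * volume T ≤ ENNReal.ofReal D * volume T :=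
        h3.trans (h1.trans (by gcongr))
      by_contra h0
      have := (ENNReal.mul_le_mul_iff_left h0 hTfin.ne).1 h4
      rw [ENNReal.ofReal_le_ofReal_iff hD] at this
      linarith
    rw [eLpNorm_exponent_top]
    refine eLpNormEssSup_le_of_ae_bound ?_
    have hall : ∀ᵐ x, ∀ n m : ℕ, x ∉ S n ∩ {x | D + 1 / ((m : ℝ) + 1) ≤ ‖G x‖} := by
      rw [ae_all_iff]; intro n
      rw [ae_all_iff]; intro m
      exact measure_eq_zero_iff_ae_notMem.1 (hT n m)
    filter_upwards [hall] with x hx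
    by_contra hc
    rw [not_le] at hc
    obtain ⟨m, hm⟩ := exists_nat_one_div_lt (sub_pos.2 hc)
    obtain ⟨n, hn⟩ := Set.mem_iUnion.1 (hSU.symm ▸ Set.mem_univ x : x ∈ ⋃ n, S n)
    refine hx n m ⟨hn, ?_⟩
    change D + 1 / ((m : ℝ) + 1) ≤ ‖G x‖
    linarith
  · have hp0 : p ≠ 0 := (zero_lt_one.trans_le hp1).ne'
    set r := p.toReal with hr
    have hr1 : 1 ≤ r := by
      rw [hr]; simpa using (ENNReal.toReal_le_toReal ENNReal.one_ne_top hpt).2 hp1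
    have hr0 : 0 < r := by linarith
    set I : ℕ → ℝ≥0∞ := fun n => ∫⁻ x in S n, ENNReal.ofReal (‖G x‖ ^ r) with hI
    have hGr : Measurable fun x => ‖G x‖ ^ r := hGm.pow_const r
    have hGB : ∀ n, ∀ x ∈ S n, ‖G x‖ ^ r ≤ (n : ℝ) ^ r := fun n x hx =>
      Real.rpow_le_rpow (norm_nonneg _) hx.1 hr0.le
    have hIfin : ∀ n, I n ≠ ⊤ := by
      intro n
      refine ((setLIntegral_mono measurable_const fun x hx =>
        ENNReal.ofReal_le_ofReal (hGB n x hx)).trans_lt ?_).ne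
      rw [setLIntegral_const]
      exact ENNReal.mul_lt_top ENNReal.ofReal_lt_top (hSfin n)
    have key : ∀ n, I n ^ (1 / r) ≤ ENNReal.ofReal D := by
      intro n
      set k : E → ℂ := (S n).indicator fun x =>
        ((‖G x‖ ^ (r - 2) : ℝ) : ℂ) * starRingEnd ℂ (G x) with hk
      have hkG : ∀ x, k x * G x = (((S n).indicator (fun x => ‖G x‖ ^ r) x : ℝ) : ℂ) := by
        intro x
        by_cases hx : x ∈ S n
        · rw [hk, Set.indicator_of_mem hx, Set.indicator_of_mem hx, mul_assoc, Complex.conj_mul',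
            ← Complex.ofReal_pow, ← Complex.ofReal_mul]
          congr 1
          rcases eq_or_ne (‖G x‖) 0 with h0 | h0
          · simp [h0, hr0.ne']
          · rw [← Real.rpow_add_natCast h0]; congr 1; push_cast; ring
        · simp [hk, Set.indicator_of_notMem hx]
      have hk1 : ∀ x, ‖k x‖ ≤ (S n).indicator (fun x => ‖G x‖ ^ (r - 1)) x := by
        intro x
        by_cases hx : x ∈ S n
        · rw [hk, Set.indicator_of_mem hx, Set.indicator_of_mem hx]
          simp only [norm_mul, Complex.norm_real, RCLike.norm_conj]
          rw [Real.norm_of_nonneg (by positivity)]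
          rcases eq_or_ne (‖G x‖) 0 with h0 | h0
          · rw [h0, mul_zero]; positivity
          · rw [← Real.rpow_add_one h0]; apply le_of_eq; congr 1; ring
        · simp [hk, Set.indicator_of_notMem hx]
      have hks : StronglyMeasurable k :=
        (((Complex.continuous_ofReal.measurable.comp (hGm.pow_const _)).mul
          (Complex.continuous_conj.measurable.comp hG.measurable)).indicator
            (hSm n)).stronglyMeasurable
      have h1 := h k ((n : ℝ) ^ (r - 1)) n hks (fun x => (hk1 x).trans (by
        by_cases hx : x ∈ S n
        · rw [Set.indicator_of_mem hx]
          exact Real.rpow_le_rpow (norm_nonneg _) hx.1 (by linarith)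
        · rw [Set.indicator_of_notMem hx]; positivity)) (by
        intro x hx
        refine Set.indicator_of_notMem (fun hxT => ?_) _
        exact absurd hxT.2 (not_le.2 hx))
      simp_rw [hkG] at h1
      rw [ofReal_norm_integral_indicator (hSm n) (hSfin n) hGr
        (fun _ => Real.rpow_nonneg (norm_nonneg _) _) (hGB n)] at h1
      rcases eq_or_lt_of_le hr1 with hr1' | hr1'
      · have hp'top : p' = ⊤ := by
          have : p = 1 := by
            rw [← ENNReal.ofReal_toReal hpt, ← hr, ← hr1', ENNReal.ofReal_one]
          subst this
          exact (ENNReal.HolderConjugate.eq_top_iff_eq_one p' 1).2 rfl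
        have h2 : eLpNorm k p' volume ≤ 1 := by
          rw [hp'top, eLpNorm_exponent_top]
          have := eLpNormEssSup_le_of_ae_bound (μ := (volume : Measure E)) (f := k) (C := 1)
            (Eventually.of_forall fun x => (hk1 x).trans (by
              rw [← hr1', sub_self]
              by_cases hx : x ∈ S n <;> simp [hx]))
          simpa using this
        rw [← hr1', one_div_one, ENNReal.rpow_one]
        refine (le_of_eq ?_).trans (h1.trans (mul_le_of_le_one_right' h2))
        simp only [hI]
      · have hconj : r.HolderConjugate p'.toReal := by
          rw [hr]; exact ENNReal.HolderConjugate.toReal hr1'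
        set r' := p'.toReal
        have hp'0 : p' ≠ 0 := ENNReal.HolderConjugate.ne_zero p' p
        have hp't : p' ≠ ⊤ := by
          intro hc
          have : r' = 0 := by simp [r', hc]
          exact hconj.symm.pos.ne' this
        have h2 : eLpNorm k p' volume ≤ I n ^ (1 / r') := by
          rw [eLpNorm_eq_lintegral_rpow_enorm_toReal hp'0 hp't]
          refine ENNReal.rpow_le_rpow ?_ (by have := hconj.symm.pos; positivity)
          simp only [hI]
          rw [← lintegral_indicator (hSm n)]
          refine lintegral_mono fun x => ?_
          rw [← ofReal_norm, ENNReal.ofReal_rpow_of_nonneg (norm_nonneg _) hconj.symm.pos.le]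
          have h3 := Real.rpow_le_rpow (norm_nonneg _) (hk1 x) hconj.symm.pos.le
          refine (ENNReal.ofReal_le_ofReal h3).trans (le_of_eq ?_)
          by_cases hx : x ∈ S n
          · rw [Set.indicator_of_mem hx, Set.indicator_of_mem hx, ← Real.rpow_mul (norm_nonneg _),
              hconj.sub_one_mul_conj]
          · rw [Set.indicator_of_notMem hx, Set.indicator_of_notMem hx,
              Real.zero_rpow hconj.symm.pos.ne', ENNReal.ofReal_zero]
        have h3 : I n ≤ ENNReal.ofReal D * I n ^ (1 / r') := h1.trans (by gcongr)
        rcases eq_or_ne (I n) 0 with h0 | h0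
        · rw [h0, ENNReal.zero_rpow_of_pos (by positivity)]; exact zero_le
        · have h4 : I n = I n ^ (1 / r) * I n ^ (1 / r') := by
            rw [← ENNReal.rpow_add _ _ h0 (hIfin n)]
            have : 1 / r + 1 / r' = 1 := by simpa using hconj.inv_add_inv_eq_one
            rw [this, ENNReal.rpow_one]
          have h5 : I n ^ (1 / r') ≠ 0 := by simp [ENNReal.rpow_eq_zero_iff, h0, hIfin n]
          have h6 : I n ^ (1 / r') ≠ ⊤ :=
            ENNReal.rpow_ne_top_of_nonneg (by have := hconj.symm.pos; positivity) (hIfin n)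
          rw [h4] at h3
          have h7 : (I n ^ (1 / r) * I n ^ (1 / r')) ^ (1 / r') = I n ^ (1 / r') := by rw [← h4]
          rw [h7] at h3
          exact (ENNReal.mul_le_mul_iff_left h5 h6).1 h3
    have hI2 : ∀ n, I n ≤ ENNReal.ofReal D ^ r := by
      intro n
      have := ENNReal.rpow_le_rpow (key n) hr0.le
      rwa [← ENNReal.rpow_mul, one_div_mul_cancel hr0.ne', ENNReal.rpow_one] at this
    rw [eLpNorm_eq_lintegral_rpow_enorm_toReal hp0 hpt, ← hr]
    have hsup : ∫⁻ x, ‖G x‖ₑ ^ r = ⨆ n, I n := by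
      rw [← setLIntegral_univ, ← hSU, setLIntegral_iUnion_of_directed _ hSmono.directed_le]
      congr 1; ext n
      simp only [hI]
      congr 1; ext x
      rw [← ofReal_norm, ENNReal.ofReal_rpow_of_nonneg (norm_nonneg _) hr0.le]
    rw [hsup]
    calc (⨆ n, I n) ^ (1 / r) ≤ (ENNReal.ofReal D ^ r) ^ (1 / r) :=
          ENNReal.rpow_le_rpow (iSup_le hI2) (by positivity)
      _ = _ := by rw [← ENNReal.rpow_mul, mul_one_div_cancel hr0.ne', ENNReal.rpow_one]

end Duality

/-- A band-limited distribution that is bounded in the dual `L^p` norm is an `L^p` function. -/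
theorem distLpNorm_le_of_forall {p p' : ℝ≥0∞} [Fact (1 ≤ p)] [Fact (1 ≤ p')]
    [hpp : p.HolderConjugate p']
    {v : 𝓢'(EuclideanSpace ℝ (Fin d), ℂ)} {D : ℝ} (hD : 0 ≤ D)
    (h : ∀ φ, ‖v φ‖ ≤ D * lpn p' φ) (σ : 𝓢(EuclideanSpace ℝ (Fin d), ℂ))
    (hσ : ∀ φ, v (mult (σ : EuclideanSpace ℝ (Fin d) → ℂ) φ) = v φ) :
    distLpNorm p v ≤ ENNReal.ofReal D := by
  let v' : 𝓢(EuclideanSpace ℝ (Fin d), ℂ) →ₗ[ℂ] ℂ :=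
    { toFun := v, map_add' := map_add v, map_smul' := map_smul v }
  obtain ⟨G, hG, hGl, hGv⟩ := exists_repr_of_L1_bound v' (C := D * lpn p' (𝓕⁻ σ))
    (mul_nonneg hD (lpn_nonneg _ _)) (fun φ => by
      change ‖v φ‖ ≤ _
      rw [← hσ φ]
      calc _ ≤ D * lpn p' (mult (σ : EuclideanSpace ℝ (Fin d) → ℂ) φ) := h _
        _ ≤ D * ((∫ z, ‖φ z‖) * lpn p' (𝓕⁻ σ)) := by gcongr; exact lpn_mult_le_L1 p' σ φ
        _ = _ := by ring)
  have hb : eLpNorm G p volume ≤ ENNReal.ofReal D :=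
    eLpNorm_le_of_duality (p' := p') hG hD fun k B R hk hB hR =>
      norm_integral_mul_le_of_schwartz (Fact.out : 1 ≤ p') hGl hD
        (fun φ => by rw [← hGv]; exact h φ) hk hB hR
  have hmem : MemLp G p volume := ⟨hG.aestronglyMeasurable, hb.trans_lt ENNReal.ofReal_lt_top⟩
  refine (iInf₂_le (hmem.toLp G) ?_).trans ?_
  · ext φ
    rw [Lp.toTemperedDistribution_apply]
    refine Eq.trans (integral_congr_ae ?_) (hGv φ).symm
    filter_upwards [hmem.coeFn_toLp] with x hx
    rw [hx, smul_eq_mul]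
  · rw [Lp.enorm_toLp]; exact hb

end

section

/-- Euclidean space. -/
abbrev Eu (d : ℕ) := EuclideanSpace ℝ (Fin d)

variable {d : ℕ}

/-- The second difference of a function. -/
def secondDiff {E F : Type*} [AddCommGroup E] [AddCommGroup F] (φ : E → F) (z x : E) : F :=
  φ (x + z) + φ (x - z) - (2 : ℕ) • φ x

/-- The density of the `α`-stable Lévy measure. -/
def levy (α : ℝ) (z : Eu d) : ℝ := ‖z‖ ^ (-(d : ℝ) - α)

theorem levy_nonneg (α : ℝ) (z : Eu d) : 0 ≤ levy α z := Real.rpow_nonneg (norm_nonneg _) _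

theorem measurable_levy (α : ℝ) : Measurable (levy α : Eu d → ℝ) := measurable_norm.pow_const _

theorem fracLaplacian_eq (α : ℝ) (φ : 𝓢(Eu d, ℂ)) (x : Eu d) :
    fracLaplacian α φ x = (1 / 2 : ℂ) * ∫ z, secondDiff φ z x * ((levy α z : ℝ) : ℂ) := by
  simp [fracLaplacian, secondDiff, levy]

set_option synthInstance.maxHeartbeats 200000 in
theorem exists_secondDiff_le (φ : 𝓢(Eu d, ℂ)) :
    ∃ C, 0 ≤ C ∧ ∀ z x : Eu d, ‖z‖ ≤ 1 →
      ‖secondDiff φ z x‖ ≤ C * ‖z‖ ^ 2 * (1 + ‖x‖) ^ (-((d : ℝ) + 1)) := by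
  set φ1 : 𝓢(Eu d, Eu d →L[ℝ] ℂ) := SchwartzMap.fderivCLM ℝ (Eu d) ℂ φ with hφ1
  set φ2 : 𝓢(Eu d, Eu d →L[ℝ] Eu d →L[ℝ] ℂ) :=
    SchwartzMap.fderivCLM ℝ (Eu d) (Eu d →L[ℝ] ℂ) φ1 with hφ2
  have h1 : ∀ x, HasFDerivAt φ (φ1 x) x := fun x => φ.hasFDerivAt x
  have h2 : ∀ x, HasFDerivAt φ1 (φ2 x) x := fun x => φ1.hasFDerivAt x
  obtain ⟨A, hA⟩ : ∃ A, ∀ y, (1 + ‖y‖) ^ (d + 1) * ‖φ2 y‖ ≤ A := ⟨_, fun y => by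
    have := SchwartzMap.one_add_le_sup_seminorm_apply (𝕜 := ℝ) (m := (d + 1, 0)) (le_refl (d + 1))
      (le_refl 0) φ2 y
    rwa [norm_iteratedFDeriv_zero] at this⟩
  have hA0 : 0 ≤ A := le_trans (by positivity) (hA 0)
  refine ⟨A * 3 ^ (d + 1), by positivity, fun z x hz => ?_⟩
  have hx0 : 0 < 1 + ‖x‖ := by positivity
  set M : ℝ := A * 3 ^ (d + 1) * (1 + ‖x‖) ^ (-((d : ℝ) + 1)) with hM
  have hM0 : 0 ≤ M := by positivity
  have hball : ∀ y ∈ Metric.closedBall x 2, ‖φ2 y‖ ≤ M := by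
    intro y hy
    have hy' : 1 + ‖x‖ ≤ 3 * (1 + ‖y‖) := by
      have h3 : ‖x‖ ≤ ‖y‖ + ‖y - x‖ := by
        have := norm_sub_norm_le x y; rw [norm_sub_rev] at this; linarith
      have h4 : ‖y - x‖ ≤ 2 := by simpa [dist_eq_norm] using hy
      have := norm_nonneg y; linarith
    have hy0 : 0 < 1 + ‖y‖ := by positivity
    have e : (1 + ‖x‖) ^ (-((d : ℝ) + 1)) = ((1 + ‖x‖) ^ (d + 1))⁻¹ := by
      rw [Real.rpow_neg hx0.le, ← Real.rpow_natCast]; push_cast; rfl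
    rw [hM, e, ← div_eq_mul_inv, le_div_iff₀ (by positivity)]
    calc ‖φ2 y‖ * (1 + ‖x‖) ^ (d + 1) ≤ ‖φ2 y‖ * (3 * (1 + ‖y‖)) ^ (d + 1) := by gcongr
      _ = ((1 + ‖y‖) ^ (d + 1) * ‖φ2 y‖) * 3 ^ (d + 1) := by rw [mul_pow]; ring
      _ ≤ _ := by gcongr; exact hA y
  have hconv := convex_closedBall x 2
  have hbound : ∀ y ∈ Metric.closedBall x 1, ‖φ1 (y + z) - φ1 y‖ ≤ M * ‖z‖ := by
    intro y hy
    have := hconv.norm_image_sub_le_of_norm_hasFDerivWithin_le (f := φ1) (f' := φ2) (C := M)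
      (fun y _ => (h2 y).hasFDerivWithinAt) hball (x := y) (y := y + z)
      (Metric.closedBall_subset_closedBall (by norm_num) hy) (by
        rw [Metric.mem_closedBall, dist_eq_norm] at hy ⊢
        calc ‖y + z - x‖ = ‖(y - x) + z‖ := by congr 1; abel
          _ ≤ ‖y - x‖ + ‖z‖ := norm_add_le _ _
          _ ≤ 2 := by linarith)
    simpa using this
  have hlip := (convex_closedBall x 1).norm_image_sub_le_of_norm_hasFDerivWithin_le
    (f := fun y => φ (y + z) - φ y) (f' := fun y => φ1 (y + z) - φ1 y) (C := M * ‖z‖)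
    (fun y _ => ((((h1 (y + z)).comp y ((hasFDerivAt_id y).add_const z)).sub
      (h1 y))).hasFDerivWithinAt) hbound (x := x - z) (y := x) (by simpa [dist_eq_norm] using hz)
      (by simp)
  have e : secondDiff φ z x = (φ (x + z) - φ x) - (φ (x - z + z) - φ (x - z)) := by
    simp [secondDiff]; ring
  rw [e]
  refine hlip.trans (le_of_eq ?_)
  rw [sub_sub_cancel, hM]; ring

theorem integrable_one_add_norm_rpow :
    Integrable (fun x : Eu d => (1 + ‖x‖) ^ (-((d : ℝ) + 1))) volume :=
  integrable_one_add_norm (by simp)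

/-- Uniform and `L¹` bounds on second differences. -/
theorem exists_secondDiff_bounds (φ : 𝓢(Eu d, ℂ)) :
    ∃ C, 0 ≤ C ∧ (∀ z x : Eu d, ‖secondDiff φ z x‖ ≤ C * min 1 (‖z‖ ^ 2)) ∧
      ∀ z : Eu d, ∫⁻ x, ‖secondDiff φ z x‖ₑ ≤ ENNReal.ofReal (C * min 1 (‖z‖ ^ 2)) := by
  obtain ⟨C, hC0, hC⟩ := exists_secondDiff_le φ
  set S := SchwartzMap.seminorm ℝ 0 0 φ
  have hS : ∀ x, ‖φ x‖ ≤ S := φ.norm_le_seminorm ℝ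
  have hS0 : 0 ≤ S := apply_nonneg _ _
  set J := ∫ x : Eu d, (1 + ‖x‖) ^ (-((d : ℝ) + 1))
  have hJ0 : 0 ≤ J := integral_nonneg fun x => by positivity
  set N := ∫ x, ‖φ x‖
  have hN0 : 0 ≤ N := integral_nonneg fun x => norm_nonneg _
  set K := max (C * max 1 J) (max (4 * S) (4 * N))
  have hK0 : 0 ≤ K := le_trans (by positivity) (le_max_left _ _)
  have htri : ∀ z x, ‖secondDiff φ z x‖ ≤ ‖φ (x + z)‖ + ‖φ (x - z)‖ + 2 * ‖φ x‖ := by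
    intro z x
    refine (norm_sub_le _ _).trans ?_
    gcongr
    · exact norm_add_le _ _
    · rw [nsmul_eq_mul, norm_mul]; simp
  refine ⟨K, hK0, fun z x => ?_, fun z => ?_⟩
  · rcases le_total ‖z‖ 1 with hz | hz
    · rw [min_eq_right (by nlinarith [norm_nonneg z])]
      refine (hC z x hz).trans ?_
      have h1 : (1 + ‖x‖) ^ (-((d : ℝ) + 1)) ≤ 1 :=
        Real.rpow_le_one_of_one_le_of_nonpos (by simp) (by linarith [(Nat.cast_nonneg d : (0:ℝ) ≤ d)])
      have h2 : C * 1 ≤ K := le_trans (by gcongr; exact le_max_left _ _) (le_max_left _ _)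
      calc _ ≤ C * ‖z‖ ^ 2 * 1 := by gcongr
        _ = C * 1 * ‖z‖ ^ 2 := by ring
        _ ≤ _ := by gcongr
    · rw [min_eq_left (by nlinarith), mul_one]
      refine (htri z x).trans (le_trans ?_ ((le_max_left _ _).trans (le_max_right _ _)))
      linarith [hS (x + z), hS (x - z), hS x]
  · rcases le_total ‖z‖ 1 with hz | hz
    · rw [min_eq_right (by nlinarith [norm_nonneg z])]
      calc ∫⁻ x, ‖secondDiff φ z x‖ₑ
          ≤ ∫⁻ x, ENNReal.ofReal (C * ‖z‖ ^ 2 * (1 + ‖x‖) ^ (-((d : ℝ) + 1))) :=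
            lintegral_mono fun x => by
              rw [← ofReal_norm]; exact ENNReal.ofReal_le_ofReal (hC z x hz)
        _ = ENNReal.ofReal (C * ‖z‖ ^ 2 * J) := by
            rw [← ofReal_integral_eq_lintegral_ofReal (integrable_one_add_norm_rpow.const_mul _)
              (Eventually.of_forall fun x => by positivity), integral_const_mul]
        _ ≤ _ := by
            refine ENNReal.ofReal_le_ofReal ?_
            have h2 : C * J ≤ K := le_trans (by gcongr; exact le_max_right _ _) (le_max_left _ _)
            calc _ = C * J * ‖z‖ ^ 2 := by ring
              _ ≤ _ := by gcongr
    · rw [min_eq_left (by nlinarith), mul_one]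
      have hi : Integrable (fun x => ‖φ x‖) volume := φ.integrable.norm
      have hint : Integrable (fun x => ‖φ (x + z)‖ + ‖φ (x - z)‖ + 2 * ‖φ x‖) volume :=
        ((hi.comp_add_right z).add (hi.comp_sub_right z)).add (hi.const_mul 2)
      calc ∫⁻ x, ‖secondDiff φ z x‖ₑ
          ≤ ∫⁻ x, ENNReal.ofReal (‖φ (x + z)‖ + ‖φ (x - z)‖ + 2 * ‖φ x‖) :=
            lintegral_mono fun x => by
              rw [← ofReal_norm]; exact ENNReal.ofReal_le_ofReal (htri z x)
        _ = ENNReal.ofReal (4 * N) := by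
            rw [← ofReal_integral_eq_lintegral_ofReal hint
              (Eventually.of_forall fun x => by positivity)]
            congr 1
            have e2 : Integrable (fun x => ‖φ (x + z)‖ + ‖φ (x - z)‖) volume :=
              (hi.comp_add_right z).add (hi.comp_sub_right z)
            rw [integral_add e2 (hi.const_mul 2),
              integral_add (hi.comp_add_right z) (hi.comp_sub_right z), integral_const_mul,
              integral_add_right_eq_self (fun x => ‖φ x‖) z,
              integral_sub_right_eq_self (fun x => ‖φ x‖) z]
            simp only [N]; ring
        _ ≤ _ := ENNReal.ofReal_le_ofReal ((le_max_right _ _).trans (le_max_right _ _))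

theorem levy_le_of_one_le {α : ℝ} (hα : 0 < α) {z : Eu d} (hz : 1 ≤ ‖z‖) :
    levy α z ≤ 2 ^ ((d : ℝ) + α) * (1 + ‖z‖) ^ (-((d : ℝ) + α)) := by
  have hz0 : 0 < ‖z‖ := by linarith
  have h : -(d : ℝ) - α = -((d : ℝ) + α) := by ring
  rw [levy, h, Real.rpow_neg (by positivity), Real.rpow_neg (by positivity), ← div_eq_mul_inv,
    le_div_iff₀ (by positivity), inv_mul_le_iff₀ (by positivity),
    ← Real.mul_rpow (by positivity) (by positivity)]
  exact Real.rpow_le_rpow (by positivity) (by linarith) (by positivity)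

theorem integrable_min_mul_levy (hd : 1 ≤ d) {α : ℝ} (hα : α ∈ Set.Ioo (0 : ℝ) 2) :
    Integrable (fun z : Eu d => min 1 (‖z‖ ^ 2) * levy α z) volume := by
  have hm : AEStronglyMeasurable (fun z : Eu d => min 1 (‖z‖ ^ 2) * levy α z) volume :=
    ((measurable_const.min (measurable_norm.pow_const 2)).mul
      (measurable_levy α)).aestronglyMeasurable
  rw [← integrableOn_univ, ← Set.union_compl_self (Metric.ball (0 : Eu d) 1), integrableOn_union]
  constructor
  · refine integrableOn_ball_of_norm_le_rpow (by simpa using hd) (C := 1) (α := d + α - 2)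
      (by simp; linarith [hα.2]) ?_ hm
    refine Eventually.of_forall fun z => ?_
    rw [Real.norm_of_nonneg (mul_nonneg (by positivity) (levy_nonneg _ _)), one_mul]
    rcases eq_or_ne z 0 with rfl | hz
    · simp; positivity
    · have hz0 : 0 < ‖z‖ := norm_pos_iff.2 hz
      calc _ ≤ ‖z‖ ^ 2 * levy α z := by
            gcongr
            · exact levy_nonneg _ _
            · exact min_le_right _ _
        _ = _ := by
            rw [levy, ← Real.rpow_natCast, ← Real.rpow_add hz0]; congr 1; push_cast; ring
  · refine Integrable.mono' (g := fun z => 2 ^ ((d : ℝ) + α) * (1 + ‖z‖) ^ (-((d : ℝ) + α)))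
      ((integrable_one_add_norm (by simp; exact hα.1)).const_mul _).integrableOn hm.restrict ?_
    filter_upwards [ae_restrict_mem Metric.isOpen_ball.measurableSet.compl] with z hz
    have hz1 : 1 ≤ ‖z‖ := by simpa using hz
    rw [Real.norm_of_nonneg (mul_nonneg (by positivity) (levy_nonneg _ _))]
    calc _ ≤ 1 * levy α z := by
          gcongr
          · exact levy_nonneg _ _
          · exact min_le_left _ _
      _ ≤ _ := by rw [one_mul]; exact levy_le_of_one_le hα.1 hz1

theorem continuous_secondDiff (φ : 𝓢(Eu d, ℂ)) :
    Continuous fun y : Eu d × Eu d => secondDiff φ y.2 y.1 := by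
  unfold secondDiff; fun_prop

theorem integrable_secondDiff_mul_levy (hd : 1 ≤ d) {α : ℝ} (hα : α ∈ Set.Ioo (0 : ℝ) 2)
    (φ : 𝓢(Eu d, ℂ)) (x : Eu d) :
    Integrable (fun z => secondDiff φ z x * ((levy α z : ℝ) : ℂ)) volume := by
  obtain ⟨C, -, hC, -⟩ := exists_secondDiff_bounds φ
  refine Integrable.mono' ((integrable_min_mul_levy hd hα).const_mul C) ?_
    (Eventually.of_forall fun z => ?_)
  · exact (((continuous_secondDiff φ).comp (by fun_prop : Continuous fun z => (x, z))).measurable.mul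
      (Complex.measurable_ofReal.comp (measurable_levy α))).aestronglyMeasurable
  · rw [norm_mul, Complex.norm_real, Real.norm_of_nonneg (levy_nonneg _ _), ← mul_assoc]
    exact mul_le_mul_of_nonneg_right (hC z x) (levy_nonneg _ _)

theorem stronglyMeasurable_fracLaplacian (α : ℝ) (φ : 𝓢(Eu d, ℂ)) :
    StronglyMeasurable (fracLaplacian α φ) := by
  have : fracLaplacian α φ = fun x => (1 / 2 : ℂ) *
    ∫ z, secondDiff φ z x * ((levy α z : ℝ) : ℂ) := funext (fracLaplacian_eq α φ)
  rw [this]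
  refine StronglyMeasurable.const_mul ?_ _
  refine StronglyMeasurable.integral_prod_right
    (f := fun x z => secondDiff φ z x * ((levy α z : ℝ) : ℂ)) ?_
  exact ((continuous_secondDiff φ).measurable.mul
    (Complex.measurable_ofReal.comp ((measurable_levy α).comp measurable_snd))).stronglyMeasurable

/-- The fractional Laplacian of a Schwartz function belongs to every `L^p`. -/
theorem memLp_fracLaplacian (hd : 1 ≤ d) {α : ℝ} (hα : α ∈ Set.Ioo (0 : ℝ) 2)
    (φ : 𝓢(Eu d, ℂ)) {p : ℝ≥0∞} (hp : 1 ≤ p) :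
    MemLp (fracLaplacian α φ) p volume := by
  obtain ⟨C, hC0, hC, hC1⟩ := exists_secondDiff_bounds φ
  have hW := integrable_min_mul_levy hd hα
  have hm := stronglyMeasurable_fracLaplacian α φ
  set W := ∫ z : Eu d, min 1 (‖z‖ ^ 2) * levy α z
  have hbdd : ∀ x, ‖fracLaplacian α φ x‖ ≤ 1 / 2 * (C * W) := by
    intro x
    rw [fracLaplacian_eq, norm_mul]
    gcongr
    · simp
    · rw [← integral_const_mul]
      refine norm_integral_le_of_norm_le (hW.const_mul C) (Eventually.of_forall fun z => ?_)
      rw [norm_mul, Complex.norm_real, Real.norm_of_nonneg (levy_nonneg _ _), ← mul_assoc]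
      exact mul_le_mul_of_nonneg_right (hC z x) (levy_nonneg _ _)
  have hint : Integrable (fracLaplacian α φ) volume := by
    refine ⟨hm.aestronglyMeasurable, ?_⟩
    have hmeas : Measurable fun y : Eu d × Eu d =>
        ‖secondDiff φ y.2 y.1‖ₑ * ENNReal.ofReal (levy α y.2) :=
      (continuous_secondDiff φ).measurable.enorm.mul
        ((measurable_levy α).comp measurable_snd).ennreal_ofReal
    calc ∫⁻ x, ‖fracLaplacian α φ x‖ₑ
        ≤ ∫⁻ x, ‖(1 / 2 : ℂ)‖ₑ * ∫⁻ z, ‖secondDiff φ z x‖ₑ * ENNReal.ofReal (levy α z) := by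
          refine lintegral_mono fun x => ?_
          rw [fracLaplacian_eq, enorm_mul]
          gcongr
          refine (enorm_integral_le_lintegral_enorm _).trans (le_of_eq ?_)
          congr 1; ext z
          rw [enorm_mul, ← ofReal_norm (((levy α z : ℝ)) : ℂ), Complex.norm_real,
            Real.norm_of_nonneg (levy_nonneg _ _)]
      _ = ‖(1 / 2 : ℂ)‖ₑ * ∫⁻ z, ∫⁻ x, ‖secondDiff φ z x‖ₑ * ENNReal.ofReal (levy α z) := by
          rw [lintegral_const_mul _ hmeas.lintegral_prod_right', lintegral_lintegral_swap]
          exact hmeas.aemeasurable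
      _ ≤ ‖(1 / 2 : ℂ)‖ₑ * ∫⁻ z, ENNReal.ofReal (C * (min 1 (‖z‖ ^ 2) * levy α z)) := by
          gcongr with z
          rw [lintegral_mul_const' _ _ ENNReal.ofReal_ne_top, ← mul_assoc,
            ENNReal.ofReal_mul (by positivity)]
          gcongr
          exact hC1 z
      _ < ⊤ := by
          refine ENNReal.mul_lt_top enorm_lt_top ?_
          rw [← ofReal_integral_eq_lintegral_ofReal (hW.const_mul C)
            (Eventually.of_forall fun z => mul_nonneg hC0
              (mul_nonneg (by positivity) (levy_nonneg _ _)))]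
          exact ENNReal.ofReal_lt_top
  have h1 : MemLp (fracLaplacian α φ) 1 volume := memLp_one_iff_integrable.2 hint
  have htop : MemLp (fracLaplacian α φ) ⊤ volume :=
    memLp_top_of_bound hm.aestronglyMeasurable _ (Eventually.of_forall hbdd)
  rcases eq_or_ne p ⊤ with rfl | hpt
  · exact htop
  · refine ⟨hm.aestronglyMeasurable, ?_⟩
    have hp0 : p ≠ 0 := (zero_lt_one.trans_le hp).ne'
    have hr : 1 ≤ p.toReal := by
      simpa using (ENNReal.toReal_le_toReal ENNReal.one_ne_top hpt).2 hp
    refine (eLpNorm_lt_top_iff_lintegral_rpow_enorm_lt_top hp0 hpt).2 ?_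
    have hB : ∀ x, ‖fracLaplacian α φ x‖ₑ ≤ ENNReal.ofReal (1 / 2 * (C * W)) := fun x => by
      rw [← ofReal_norm]; exact ENNReal.ofReal_le_ofReal (hbdd x)
    calc ∫⁻ x, ‖fracLaplacian α φ x‖ₑ ^ p.toReal
        ≤ ∫⁻ x, ENNReal.ofReal (1 / 2 * (C * W)) ^ (p.toReal - 1) * ‖fracLaplacian α φ x‖ₑ := by
          refine lintegral_mono fun x => ?_
          calc ‖fracLaplacian α φ x‖ₑ ^ p.toReal
              = ‖fracLaplacian α φ x‖ₑ ^ ((p.toReal - 1) + 1) := by rw [sub_add_cancel]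
            _ = ‖fracLaplacian α φ x‖ₑ ^ (p.toReal - 1) * ‖fracLaplacian α φ x‖ₑ := by
                rw [ENNReal.rpow_add_of_nonneg _ _ (by linarith) zero_le_one, ENNReal.rpow_one]
            _ ≤ _ := by
                gcongr
                exact hB x
      _ < ⊤ := by
          have ht : ENNReal.ofReal (1 / 2 * (C * W)) ^ (p.toReal - 1) ≠ ⊤ :=
            ENNReal.rpow_ne_top_of_nonneg (by linarith) ENNReal.ofReal_ne_top
          rw [lintegral_const_mul' _ _ ht]
          exact ENNReal.mul_lt_top ht.lt_top hint.2

end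

section

variable {d : ℕ}

/-- The symbol of `-Δ^{α/2}`. -/
def levySymbol (α : ℝ) (ξ : Eu d) : ℝ :=
  ∫ z, (1 - Real.cos (2 * Real.pi * inner ℝ ξ z)) * levy α z

theorem one_sub_cos_le (ξ z : Eu d) :
    1 - Real.cos (2 * Real.pi * inner ℝ ξ z) ≤
      (2 + 2 * Real.pi ^ 2 * ‖ξ‖ ^ 2) * min 1 (‖z‖ ^ 2) := by
  rcases le_total ‖z‖ 1 with hz | hz
  · rw [min_eq_right (by nlinarith [norm_nonneg z])]
    have h1 := Real.one_sub_sq_div_two_le_cos (x := 2 * Real.pi * inner ℝ ξ z)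
    have h2 : (inner ℝ ξ z) ^ 2 ≤ ‖ξ‖ ^ 2 * ‖z‖ ^ 2 := by
      rw [← mul_pow, ← sq_abs]
      exact pow_le_pow_left₀ (abs_nonneg _) (abs_real_inner_le_norm ξ z) 2
    nlinarith [sq_nonneg ‖z‖, mul_le_mul_of_nonneg_left h2 (sq_nonneg Real.pi)]
  · rw [min_eq_left (by nlinarith)]
    have := Real.neg_one_le_cos (2 * Real.pi * inner ℝ ξ z)
    have : 0 ≤ Real.pi ^ 2 * ‖ξ‖ ^ 2 := by positivity
    linarith

theorem one_sub_cos_nonneg (x : ℝ) : 0 ≤ 1 - Real.cos x := by linarith [Real.cos_le_one x]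

theorem integrable_levySymbol (hd : 1 ≤ d) {α : ℝ} (hα : α ∈ Set.Ioo (0 : ℝ) 2) (ξ : Eu d) :
    Integrable (fun z => (1 - Real.cos (2 * Real.pi * inner ℝ ξ z)) * levy α z) volume := by
  refine Integrable.mono' ((integrable_min_mul_levy hd hα).const_mul
    (2 + 2 * Real.pi ^ 2 * ‖ξ‖ ^ 2)) ?_ (Eventually.of_forall fun z => ?_)
  · exact ((by fun_prop : Continuous fun z : Eu d =>
      1 - Real.cos (2 * Real.pi * inner ℝ ξ z)).measurable.mul
      (measurable_levy α)).aestronglyMeasurable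
  · rw [Real.norm_of_nonneg (mul_nonneg (one_sub_cos_nonneg _) (levy_nonneg _ _)), ← mul_assoc]
    exact mul_le_mul_of_nonneg_right (one_sub_cos_le ξ z) (levy_nonneg _ _)

theorem levySymbol_nonneg (α : ℝ) (ξ : Eu d) : 0 ≤ levySymbol α ξ :=
  integral_nonneg fun _ => mul_nonneg (one_sub_cos_nonneg _) (levy_nonneg _ _)

theorem integral_comp_smul_mul_levy {F : Type*} [NormedAddCommGroup F] [NormedSpace ℝ F]
    (α : ℝ) (f : Eu d → F) {c : ℝ} (hc : 0 < c) :
    ∫ z, levy α z • f (c • z) = c ^ α • ∫ z, levy α z • f z := by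
  have h : ∀ z : Eu d, levy α z • f (c • z) =
      c ^ ((d : ℝ) + α) • ((fun y => levy α y • f y) (c • z)) := by
    intro z
    simp only [levy, norm_smul, Real.norm_of_nonneg hc.le]
    rw [Real.mul_rpow hc.le (norm_nonneg _), ← mul_smul, ← mul_assoc, ← Real.rpow_add hc]
    simp
  simp_rw [h]
  rw [integral_smul, Measure.integral_comp_smul volume (fun y => levy α y • f y) c, ← mul_smul]
  congr 1
  rw [finrank_euclideanSpace_fin, abs_of_nonneg (by positivity), Real.rpow_add hc,
    Real.rpow_natCast]
  field_simp

theorem levySymbol_smul (α : ℝ) {c : ℝ} (hc : 0 < c) (ξ : Eu d) :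
    levySymbol α (c • ξ) = c ^ α * levySymbol α ξ := by
  have := integral_comp_smul_mul_levy α
    (fun z : Eu d => 1 - Real.cos (2 * Real.pi * inner ℝ ξ z)) hc
  simp only [smul_eq_mul] at this
  simp only [levySymbol, mul_comm _ (levy α _), ← this, real_inner_smul_left, real_inner_smul_right]

theorem levySymbol_eq_of_norm_eq (α : ℝ) {ξ η : Eu d} (h : ‖ξ‖ = ‖η‖) :
    levySymbol α ξ = levySymbol α η := by
  set L : Eu d ≃ₗᵢ[ℝ] Eu d := (ℝ ∙ (ξ - η))ᗮ.reflection with hL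
  have hLξ : L ξ = η := Submodule.reflection_sub h
  have := L.measurePreserving.integral_comp L.toMeasurableEquiv.measurableEmbedding
    (fun z => (1 - Real.cos (2 * Real.pi * inner ℝ η z)) * levy α z)
  unfold levySymbol
  rw [← this]
  congr 1; ext z
  rw [← hLξ, LinearIsometryEquiv.inner_map_map]
  simp [levy]

theorem exists_levySymbol_eq (hd : 1 ≤ d) {α : ℝ} (hα : 0 < α) :
    ∃ c, ∀ ξ : Eu d, levySymbol α ξ = c * ‖ξ‖ ^ α := by
  set e : Eu d := EuclideanSpace.single ⟨0, hd⟩ 1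
  refine ⟨levySymbol α e, fun ξ => ?_⟩
  rcases eq_or_ne ξ 0 with rfl | hξ
  · simp [levySymbol, Real.zero_rpow hα.ne']
  · have h0 : 0 < ‖ξ‖ := norm_pos_iff.2 hξ
    rw [mul_comm, ← levySymbol_smul α h0]
    exact levySymbol_eq_of_norm_eq α (by simp [norm_smul, e])

theorem fracLaplacian_dilate (α : ℝ) {φ ψ : 𝓢(Eu d, ℂ)} {c : ℝ} (hc : 0 < c)
    (h : ∀ x, ψ x = φ (c • x)) (x : Eu d) :
    fracLaplacian α ψ x = ((c ^ α : ℝ) : ℂ) * fracLaplacian α φ (c • x) := by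
  have := integral_comp_smul_mul_levy α (fun z : Eu d => secondDiff φ z (c • x)) hc
  rw [fracLaplacian_eq, fracLaplacian_eq]
  simp only [Complex.real_smul] at this
  simp only [mul_comm _ ((levy α _ : ℝ) : ℂ)]
  rw [mul_left_comm, ← this]
  simp [secondDiff, h, smul_add, smul_sub]

theorem inversion (φ : 𝓢(Eu d, ℂ)) (x : Eu d) :
    φ x = ∫ ξ, Complex.exp (((2 * Real.pi * inner ℝ ξ x : ℝ) : ℂ) * Complex.I) * 𝓕 φ ξ := by
  have h1 : 𝓕⁻ (𝓕 φ) x = φ x := by rw [FourierTransform.fourierInv_fourier_eq]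
  rw [← h1, SchwartzMap.fourierInv_coe, Real.fourierInv_eq']
  simp

theorem secondDiff_eq (φ : 𝓢(Eu d, ℂ)) (z x : Eu d) :
    secondDiff φ z x = ∫ ξ, Complex.exp (((2 * Real.pi * inner ℝ ξ x : ℝ) : ℂ) * Complex.I) *
      (-2 * ((1 - Real.cos (2 * Real.pi * inner ℝ ξ z) : ℝ) : ℂ) * 𝓕 φ ξ) := by
  have hi : ∀ y : Eu d, Integrable (fun ξ =>
      Complex.exp (((2 * Real.pi * inner ℝ ξ y : ℝ) : ℂ) * Complex.I) * 𝓕 φ ξ) volume := by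
    intro y
    refine (𝓕 φ).integrable.bdd_mul (c := 1) (by fun_prop) (Eventually.of_forall fun ξ => ?_)
    rw [Complex.norm_exp_ofReal_mul_I]
  rw [secondDiff, inversion φ (x + z), inversion φ (x - z), inversion φ x, two_nsmul,
    ← integral_add (hi _) (hi _), ← integral_add (hi _) (hi _), ← integral_sub]
  · congr 1; ext ξ
    have e1 : Complex.exp (((2 * Real.pi * inner ℝ ξ (x + z) : ℝ) : ℂ) * Complex.I) =
        Complex.exp (((2 * Real.pi * inner ℝ ξ x : ℝ) : ℂ) * Complex.I) *
        Complex.exp (((2 * Real.pi * inner ℝ ξ z : ℝ) : ℂ) * Complex.I) := by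
      rw [← Complex.exp_add, inner_add_right]; congr 1; push_cast; ring
    have e2 : Complex.exp (((2 * Real.pi * inner ℝ ξ (x - z) : ℝ) : ℂ) * Complex.I) =
        Complex.exp (((2 * Real.pi * inner ℝ ξ x : ℝ) : ℂ) * Complex.I) *
        Complex.exp (-((2 * Real.pi * inner ℝ ξ z : ℝ) : ℂ) * Complex.I) := by
      rw [← Complex.exp_add, inner_sub_right]; congr 1; push_cast; ring
    rw [e1, e2]
    have e3 := Complex.two_cos ((2 * Real.pi * inner ℝ ξ z : ℝ) : ℂ)
    simp only [Complex.ofReal_sub, Complex.ofReal_one, Complex.ofReal_cos]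
    linear_combination (-Complex.exp (((2 * Real.pi * inner ℝ ξ x : ℝ) : ℂ) * Complex.I) * 𝓕 φ ξ) * e3
  · exact (hi _).add (hi _)
  · exact (hi _).add (hi _)

theorem stronglyMeasurable_levySymbol (α : ℝ) : StronglyMeasurable (levySymbol α : Eu d → ℝ) := by
  refine StronglyMeasurable.integral_prod_right
    (f := fun (ξ z : Eu d) => (1 - Real.cos (2 * Real.pi * inner ℝ ξ z)) * levy α z) ?_
  exact ((by fun_prop : Continuous fun y : Eu d × Eu d =>
      1 - Real.cos (2 * Real.pi * inner ℝ y.1 y.2)).measurable.mul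
      ((measurable_levy α).comp measurable_snd)).stronglyMeasurable

theorem integrable_one_add_sq_mul (φ : 𝓢(Eu d, ℂ)) (C : ℝ) :
    Integrable (fun ξ => (2 + C * ‖ξ‖ ^ 2) * ‖φ ξ‖) volume := by
  have h1 := φ.integrable.norm (μ := volume)
  have h2 := φ.integrable_pow_mul volume 2
  refine ((h1.const_mul 2).add (h2.const_mul C)).congr (Eventually.of_forall fun ξ => ?_)
  simp; ring

theorem levySymbol_le (hd : 1 ≤ d) {α : ℝ} (hα : α ∈ Set.Ioo (0 : ℝ) 2) (ξ : Eu d) :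
    levySymbol α ξ ≤ (2 + 2 * Real.pi ^ 2 * ‖ξ‖ ^ 2) *
      ∫ z : Eu d, min 1 (‖z‖ ^ 2) * levy α z := by
  rw [← integral_const_mul]
  refine integral_mono (integrable_levySymbol hd hα ξ)
    ((integrable_min_mul_levy hd hα).const_mul _) fun z => ?_
  simp only [← mul_assoc]
  exact mul_le_mul_of_nonneg_right (one_sub_cos_le ξ z) (levy_nonneg _ _)

theorem integrable_levySymbol_mul (hd : 1 ≤ d) {α : ℝ} (hα : α ∈ Set.Ioo (0 : ℝ) 2)
    (φ : 𝓢(Eu d, ℂ)) :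
    Integrable (fun ξ => ((levySymbol α ξ : ℝ) : ℂ) * φ ξ) volume := by
  set W := ∫ z : Eu d, min 1 (‖z‖ ^ 2) * levy α z
  refine Integrable.mono' ((integrable_one_add_sq_mul φ (2 * Real.pi ^ 2)).const_mul W) ?_
    (Eventually.of_forall fun ξ => ?_)
  · exact ((Complex.measurable_ofReal.comp (stronglyMeasurable_levySymbol α).measurable).mul
      φ.continuous.measurable).aestronglyMeasurable
  · rw [norm_mul, Complex.norm_real, Real.norm_of_nonneg (levySymbol_nonneg _ _), ← mul_assoc]
    gcongr
    rw [mul_comm]; exact levySymbol_le hd hα ξ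

/-- The fractional Laplacian is the Fourier multiplier with symbol `-levySymbol α`. -/
theorem fracLaplacian_eq_fourierInv (hd : 1 ≤ d) {α : ℝ} (hα : α ∈ Set.Ioo (0 : ℝ) 2)
    (φ : 𝓢(Eu d, ℂ)) (x : Eu d) :
    fracLaplacian α φ x = 𝓕⁻ (fun ξ => -((levySymbol α ξ : ℝ) : ℂ) * 𝓕 φ ξ) x := by
  rw [fracLaplacian_eq, Real.fourierInv_eq']
  simp_rw [secondDiff_eq, ← integral_mul_const]
  rw [integral_integral_swap, ← integral_const_mul]
  · congr 1; ext ξ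
    have : ∀ z : Eu d, Complex.exp (((2 * Real.pi * inner ℝ ξ x : ℝ) : ℂ) * Complex.I) *
        (-2 * ((1 - Real.cos (2 * Real.pi * inner ℝ ξ z) : ℝ) : ℂ) * 𝓕 φ ξ) * ((levy α z : ℝ) : ℂ)
        = (-2 * Complex.exp (((2 * Real.pi * inner ℝ ξ x : ℝ) : ℂ) * Complex.I) * 𝓕 φ ξ) *
          (((1 - Real.cos (2 * Real.pi * inner ℝ ξ z)) * levy α z : ℝ) : ℂ) := by
      intro z; push_cast; ring
    simp_rw [this]
    rw [integral_const_mul, integral_complex_ofReal, smul_eq_mul, ← levySymbol]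
    ring
  · have hb : Integrable (fun y : Eu d × Eu d => (2 * (min 1 (‖y.1‖ ^ 2) * levy α y.1)) *
        ((2 + 2 * Real.pi ^ 2 * ‖y.2‖ ^ 2) * ‖𝓕 φ y.2‖)) (volume.prod volume) :=
      ((integrable_min_mul_levy hd hα).const_mul 2).mul_prod (integrable_one_add_sq_mul (𝓕 φ) _)
    refine hb.mono' ?_ (Eventually.of_forall fun y => ?_)
    · refine Measurable.aestronglyMeasurable ?_
      exact (Continuous.measurable (by
        have := (𝓕 φ).continuous
        fun_prop)).mul
        (Complex.measurable_ofReal.comp ((measurable_levy α).comp measurable_fst))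
    · simp only [Function.uncurry]
      rw [norm_mul, norm_mul, norm_mul, norm_mul, Complex.norm_exp_ofReal_mul_I, Complex.norm_real,
        Complex.norm_real, Real.norm_of_nonneg (levy_nonneg _ _),
        Real.norm_of_nonneg (one_sub_cos_nonneg _)]
      have := mul_le_mul_of_nonneg_right (one_sub_cos_le y.2 y.1)
        (mul_nonneg (levy_nonneg α y.1) (norm_nonneg (𝓕 φ y.2)))
      simp only [norm_neg, Complex.norm_ofNat, one_mul]
      nlinarith [this]

theorem contDiff_levySymbol_mul (hd : 1 ≤ d) {α : ℝ} (hα : 0 < α) {κ : Eu d → ℂ}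
    (hκ : ContDiff ℝ ((⊤ : ℕ∞) : WithTop ℕ∞) κ) (h0 : ∀ᶠ ξ in 𝓝 0, κ ξ = 0) :
    ContDiff ℝ ((⊤ : ℕ∞) : WithTop ℕ∞) fun ξ => -((levySymbol α ξ : ℝ) : ℂ) * κ ξ := by
  obtain ⟨c, hc⟩ := exists_levySymbol_eq hd hα
  rw [contDiff_iff_contDiffAt]
  intro ξ
  rcases eq_or_ne ξ 0 with rfl | hξ
  · refine ContDiffAt.congr_of_eventuallyEq (f := fun _ => 0) contDiffAt_const ?_
    filter_upwards [h0] with ξ hξ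
    simp [hξ]
  · simp_rw [hc]
    have h1 : ContDiffAt ℝ ((⊤ : ℕ∞) : WithTop ℕ∞) (fun ξ : Eu d => c * ‖ξ‖ ^ α) ξ :=
      contDiffAt_const.mul ((contDiffAt_norm ℝ hξ).rpow_const_of_ne (norm_ne_zero_iff.2 hξ))
    exact ((Complex.ofRealCLM.contDiff.contDiffAt.comp ξ h1).neg).mul hκ.contDiffAt

theorem fracLaplacian_eq_mult (hd : 1 ≤ d) {α : ℝ} (hα : α ∈ Set.Ioo (0 : ℝ) 2) {κ : Eu d → ℂ}
    (hκ : ContDiff ℝ ((⊤ : ℕ∞) : WithTop ℕ∞) κ) (hs : HasCompactSupport κ)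
    (h0 : ∀ᶠ ξ in 𝓝 0, κ ξ = 0) {φ : 𝓢(Eu d, ℂ)} (hφ : ∀ ξ, 𝓕 φ ξ ≠ 0 → κ ξ = 1) (x : Eu d) :
    fracLaplacian α φ x = mult (fun ξ => -((levySymbol α ξ : ℝ) : ℂ) * κ ξ) φ x := by
  set a : Eu d → ℂ := fun ξ => -((levySymbol α ξ : ℝ) : ℂ) * κ ξ
  have ha : a.HasTemperateGrowth :=
    HasCompactSupport.hasTemperateGrowth hs.mul_left (contDiff_levySymbol_mul hd hα.1 hκ h0)
  have h1 : mult a φ x = 𝓕⁻ (𝓕 (mult a φ)) x := by rw [FourierTransform.fourierInv_fourier_eq]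
  rw [fracLaplacian_eq_fourierInv hd hα, h1, SchwartzMap.fourierInv_coe]
  refine congrArg (fun g : Eu d → ℂ => (𝓕⁻ g : Eu d → ℂ) x) (funext fun ξ => ?_)
  rw [fourier_mult ha]
  by_cases h : 𝓕 φ ξ = 0
  · simp [h]
  · simp [a, hφ ξ h]

end

section

variable {d : ℕ}

theorem IsLPCutoff.hasCompactSupport {χ : Eu d → ℝ} (hχ : IsLPCutoff χ) :
    HasCompactSupport fun ξ => ((χ ξ : ℝ) : ℂ) := by
  refine HasCompactSupport.intro (isCompact_closedBall 0 (3 / 2)) fun ξ hξ => ?_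
  rw [hχ.eq_zero ξ (by simpa using hξ)]; simp

theorem IsLPCutoff.contDiff {χ : Eu d → ℝ} (hχ : IsLPCutoff χ) :
    ContDiff ℝ ((⊤ : ℕ∞) : WithTop ℕ∞) fun ξ => ((χ ξ : ℝ) : ℂ) :=
  Complex.ofRealCLM.contDiff.comp hχ.smooth

/-- The dilated cutoff `χ (c ξ)` as a Schwartz function. -/
def IsLPCutoff.symbol {χ : Eu d → ℝ} (hχ : IsLPCutoff χ) (c : ℝ) (hc : c ≠ 0) : 𝓢(Eu d, ℂ) :=
  (hasCompactSupport_dilate hχ.hasCompactSupport hc).toSchwartzMap (contDiff_dilate hχ.contDiff c)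

theorem IsLPCutoff.symbol_apply {χ : Eu d → ℝ} (hχ : IsLPCutoff χ) (c : ℝ) (hc : c ≠ 0)
    (ξ : Eu d) : hχ.symbol c hc ξ = ((χ (c • ξ) : ℝ) : ℂ) := rfl

theorem fourierInv_dilate {f g : 𝓢(Eu d, ℂ)} {c : ℝ} (hc : 0 < c) (h : ∀ ξ, g ξ = f (c • ξ))
    (x : Eu d) : 𝓕⁻ g x = ((c ^ d)⁻¹ : ℝ) * 𝓕⁻ f (c⁻¹ • x) := by
  rw [SchwartzMap.fourierInv_coe, SchwartzMap.fourierInv_coe, Real.fourierInv_eq',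
    Real.fourierInv_eq']
  have := Measure.integral_comp_smul volume (fun v : Eu d => Complex.exp (((2 * Real.pi *
    inner ℝ v (c⁻¹ • x) : ℝ) : ℂ) * Complex.I) • f v) c
  rw [finrank_euclideanSpace_fin, abs_of_nonneg (by positivity), Complex.real_smul] at this
  rw [← this]
  congr 1; ext v
  rw [h, real_inner_smul_left, real_inner_smul_right, mul_inv_cancel_left₀ hc.ne']

theorem fourierInv_neg_of_even {σ : 𝓢(Eu d, ℂ)} (h : ∀ ξ, σ (-ξ) = σ ξ) (x : Eu d) :
    𝓕⁻ σ (-x) = 𝓕⁻ σ x := by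
  rw [SchwartzMap.fourierInv_coe, Real.fourierInv_eq', Real.fourierInv_eq',
    ← integral_neg_eq_self]
  simp [h]

theorem fourierInv_eq_re {σ : 𝓢(Eu d, ℂ)} (h : ∀ ξ, σ (-ξ) = σ ξ)
    (hr : ∀ ξ, (starRingEnd ℂ) (σ ξ) = σ ξ) (x : Eu d) :
    𝓕⁻ σ x = (((𝓕⁻ σ x).re : ℝ) : ℂ) := by
  refine (Complex.conj_eq_iff_re.1 ?_).symm
  conv_rhs => rw [← fourierInv_neg_of_even h x]
  rw [SchwartzMap.fourierInv_coe, Real.fourierInv_eq', Real.fourierInv_eq', ← integral_conj]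
  congr 1; ext ξ
  rw [smul_eq_mul, map_mul, hr, ← Complex.exp_conj, map_mul, Complex.conj_ofReal, Complex.conj_I,
    inner_neg_right]
  simp

/-- Bounds on the `L^p` norm by a multiple of the function plus a convolution. -/
theorem lpn_le_of_enorm_le_add (p : ℝ≥0∞) [hp : Fact (1 ≤ p)] (φ ψ : 𝓢(Eu d, ℂ)) {k : Eu d → ℝ≥0∞}
    (hk : Measurable k) {a C : ℝ} (ha : 0 ≤ a) (hC : 0 ≤ C) (hkC : ∫⁻ z, k z ≤ ENNReal.ofReal C)
    (h : ∀ x, ‖ψ x‖ₑ ≤ ENNReal.ofReal a * ‖φ x‖ₑ + ∫⁻ z, ‖φ (x - z)‖ₑ * k z) :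
    lpn p ψ ≤ (a + C) * lpn p φ := by
  have hfin : IsFiniteMeasure ((volume : Measure (Eu d)).withDensity k) :=
    isFiniteMeasure_withDensity (hkC.trans_lt ENNReal.ofReal_lt_top).ne
  set ν := (volume : Measure (Eu d)).withDensity k
  have := eLpNorm_lintegral_sub_le (volume : Measure (Eu d)) ν
    hp.out (f := fun x => ‖φ x‖ₑ) φ.continuous.enorm.measurable
  have hl := lpn_nonneg p φ
  rw [← ENNReal.ofReal_le_ofReal_iff (by positivity), ENNReal.ofReal_mul (by positivity),
    ENNReal.ofReal_add ha hC, ofReal_lpn, ofReal_lpn, add_mul]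
  have hm : Measurable fun x => ∫⁻ z, ‖φ (x - z)‖ₑ ∂ν := by
    refine Measurable.lintegral_prod_right' (f := fun y : Eu d × Eu d => ‖φ (y.1 - y.2)‖ₑ) ?_
    exact φ.continuous.enorm.measurable.comp (by fun_prop)
  calc eLpNorm ψ p volume
      ≤ eLpNorm ((fun x => ENNReal.ofReal a * ‖φ x‖ₑ) + fun x => ∫⁻ z, ‖φ (x - z)‖ₑ ∂ν)
          p volume := by
        refine eLpNorm_mono_enorm fun x => ?_
        rw [enorm_eq_self, Pi.add_apply, lintegral_withDensity_eq_lintegral_mul _ hk]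
        · simpa [mul_comm] using h x
        · exact (φ.continuous.enorm.measurable).comp (by fun_prop)
    _ ≤ _ := eLpNorm_add_le (φ.continuous.enorm.measurable.const_mul _).aestronglyMeasurable
        hm.aestronglyMeasurable hp.out
    _ ≤ _ := by
      gcongr
      · have e : eLpNorm (fun x => ENNReal.ofReal a * ‖φ x‖ₑ) p volume =
            eLpNorm (fun x => (a : ℂ) • φ x) p volume := by
          refine eLpNorm_congr_enorm_ae (Eventually.of_forall fun x => ?_)
          rw [enorm_eq_self, enorm_smul, ← ofReal_norm (a : ℂ), Complex.norm_real,
            Real.norm_of_nonneg ha]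
        rw [e]
        refine (eLpNorm_const_smul_le (c := (a : ℂ)) (f := φ)).trans (le_of_eq ?_)
        rw [← ofReal_norm (a : ℂ), Complex.norm_real, Real.norm_of_nonneg ha]
      · refine this.trans ?_
        rw [withDensity_apply _ MeasurableSet.univ, Measure.restrict_univ, eLpNorm_enorm]
        gcongr

theorem secondDiff_eq_of_mult_eq {κ φ : 𝓢(Eu d, ℂ)} (h : mult (κ : Eu d → ℂ) φ = φ) (z x : Eu d) :
    secondDiff φ z x = ∫ y, secondDiff (𝓕⁻ κ : 𝓢(Eu d, ℂ)) z (x - y) * φ y := by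
  obtain ⟨M, -, hM⟩ : ∃ M, 0 < M ∧ ∀ x, ‖𝓕⁻ κ x‖ ≤ M := by
    obtain ⟨M, hM, h⟩ := (𝓕⁻ κ).decay 0 0
    exact ⟨M, hM, fun x => by simpa using h x⟩
  have hi : ∀ w : Eu d, Integrable (fun y => 𝓕⁻ κ (w - y) * φ y) volume := fun w => by
    refine φ.integrable.bdd_mul (c := M) ?_ (Eventually.of_forall fun y => hM _)
    exact ((𝓕⁻ κ).continuous.comp (by fun_prop)).aestronglyMeasurable
  have e : ∀ w, φ w = ∫ y, 𝓕⁻ κ (w - y) * φ y := fun w => by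
    conv_lhs => rw [← h]
    rw [mult_apply_eq_integral']
  rw [secondDiff, e (x + z), e (x - z), e x, two_nsmul, ← integral_add (hi _) (hi _),
    ← integral_add (hi _) (hi _), ← integral_sub]
  rotate_left
  · exact (hi _).add (hi _)
  · exact (hi _).add (hi _)
  congr 1; ext y
  simp only [secondDiff, two_nsmul]
  rw [show x + z - y = x - y + z by abel, show x - z - y = x - y - z by abel]
  ring

set_option maxHeartbeats 800000 in
theorem exists_smallJump_kernel (hd : 1 ≤ d) {α : ℝ} (hα : α ∈ Set.Ioo (0 : ℝ) 2) (κ : 𝓢(Eu d, ℂ))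
    {η : ℝ} (hη : 0 < η) :
    ∃ δ, 0 < δ ∧ ∃ k : Eu d → ℝ≥0∞, Measurable k ∧ ∫⁻ y, k y ≤ ENNReal.ofReal η ∧
      ∀ φ : 𝓢(Eu d, ℂ), mult (κ : Eu d → ℂ) φ = φ → ∀ x,
        ∫⁻ z in Metric.closedBall 0 δ, ‖secondDiff φ z x‖ₑ * ENNReal.ofReal (levy α z) ≤
          ∫⁻ y, ‖φ (x - y)‖ₑ * k y := by
  obtain ⟨C, hC0, -, hC1⟩ := exists_secondDiff_bounds (𝓕⁻ κ)
  have hW := (integrable_min_mul_levy hd hα).const_mul C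
  have hfin : ∫⁻ z : Eu d, ENNReal.ofReal (C * (min 1 (‖z‖ ^ 2) * levy α z)) ≠ ⊤ := by
    rw [← ofReal_integral_eq_lintegral_ofReal hW (Eventually.of_forall fun z => mul_nonneg hC0
      (mul_nonneg (by positivity) (levy_nonneg _ _)))]
    exact ENNReal.ofReal_ne_top
  obtain ⟨m, hm, hms⟩ := exists_pos_setLIntegral_lt_of_measure_lt hfin
    (ε := ENNReal.ofReal η) (by simpa using hη)
  obtain ⟨δ, hδ, hδm⟩ : ∃ δ : ℝ, 0 < δ ∧ volume (Metric.closedBall (0 : Eu d) δ) < m := by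
    have ht : Tendsto (fun δ : ℝ => ENNReal.ofReal (δ ^ d) * volume (Metric.ball (0 : Eu d) 1))
        (𝓝[>] 0) (𝓝 0) := by
      have h1 : Tendsto (fun δ : ℝ => ENNReal.ofReal (δ ^ d)) (𝓝[>] 0) (𝓝 0) := by
        have : Continuous fun δ : ℝ => ENNReal.ofReal (δ ^ d) := ENNReal.continuous_ofReal.comp (continuous_pow d)
        have := (this.tendsto 0).mono_left (nhdsWithin_le_nhds (s := Set.Ioi 0))
        simpa [show d ≠ 0 by omega] using this
      have := ENNReal.Tendsto.mul_const (b := volume (Metric.ball (0 : Eu d) 1)) h1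
        (Or.inr measure_ball_lt_top.ne)
      simpa using this
    obtain ⟨δ, h1, h2⟩ := ((ht.eventually (gt_mem_nhds hm)).and self_mem_nhdsWithin).exists
    refine ⟨δ, h2, ?_⟩
    rw [Measure.addHaar_closedBall _ _ (le_of_lt h2), finrank_euclideanSpace_fin]
    exact h1
  have hmeas : Measurable fun y : Eu d × Eu d =>
      ‖secondDiff (𝓕⁻ κ : 𝓢(Eu d, ℂ)) y.2 y.1‖ₑ * ENNReal.ofReal (levy α y.2) :=
    (continuous_secondDiff (𝓕⁻ κ)).measurable.enorm.mul
      ((measurable_levy α).comp measurable_snd).ennreal_ofReal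
  refine ⟨δ, hδ, fun y => ∫⁻ z in Metric.closedBall 0 δ,
    ‖secondDiff (𝓕⁻ κ : 𝓢(Eu d, ℂ)) z y‖ₑ * ENNReal.ofReal (levy α z), hmeas.lintegral_prod_right', ?_, ?_⟩
  · rw [lintegral_lintegral_swap hmeas.aemeasurable]
    refine le_trans ?_ (hms _ hδm).le
    refine lintegral_mono fun z => ?_
    dsimp only
    rw [lintegral_mul_const' _ _ ENNReal.ofReal_ne_top, ← mul_assoc,
      ENNReal.ofReal_mul (by positivity)]
    gcongr
    exact hC1 z
  · intro φ hφ x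
    have h1 : ∀ z, ‖secondDiff φ z x‖ₑ ≤ ∫⁻ y, ‖secondDiff (𝓕⁻ κ : 𝓢(Eu d, ℂ)) z y‖ₑ * ‖φ (x - y)‖ₑ := by
      intro z
      rw [secondDiff_eq_of_mult_eq hφ]
      refine (enorm_integral_le_lintegral_enorm _).trans (le_of_eq ?_)
      rw [← lintegral_sub_left_eq_self _ x]
      simp
    have hm1 : Measurable fun y : Eu d × Eu d => ‖secondDiff (𝓕⁻ κ : 𝓢(Eu d, ℂ)) y.1 y.2‖ₑ *
        ‖φ (x - y.2)‖ₑ * ENNReal.ofReal (levy α y.1) := by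
      have h1 : Measurable fun y : Eu d × Eu d => ‖secondDiff (𝓕⁻ κ : 𝓢(Eu d, ℂ)) y.1 y.2‖ₑ :=
        ((continuous_secondDiff (𝓕⁻ κ)).comp continuous_swap).measurable.enorm
      have h2 : Measurable fun y : Eu d × Eu d => ‖φ (x - y.2)‖ₑ :=
        φ.continuous.enorm.measurable.comp (by fun_prop)
      have h3 : Measurable fun y : Eu d × Eu d => ENNReal.ofReal (levy α y.1) :=
        ((measurable_levy α).comp measurable_fst).ennreal_ofReal
      exact (h1.mul h2).mul h3
    calc _ ≤ ∫⁻ z in Metric.closedBall 0 δ, ∫⁻ y, ‖secondDiff (𝓕⁻ κ : 𝓢(Eu d, ℂ)) z y‖ₑ * ‖φ (x - y)‖ₑ *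
          ENNReal.ofReal (levy α z) := by
          refine lintegral_mono fun z => ?_
          dsimp only
          rw [lintegral_mul_const' _ _ ENNReal.ofReal_ne_top]
          gcongr
          exact h1 z
      _ = ∫⁻ y, ∫⁻ z in Metric.closedBall 0 δ, ‖secondDiff (𝓕⁻ κ : 𝓢(Eu d, ℂ)) z y‖ₑ * ‖φ (x - y)‖ₑ *
          ENNReal.ofReal (levy α z) := lintegral_lintegral_swap hm1.aemeasurable
      _ = _ := by
          congr 1; ext y
          rw [← lintegral_const_mul' _ _ enorm_ne_top]
          congr 1; ext z; ring

end

section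

variable {d : ℕ}

theorem integral_fourierInv (σ : 𝓢(Eu d, ℂ)) : ∫ z, 𝓕⁻ σ z = σ 0 := by
  have h : 𝓕 (𝓕⁻ σ) 0 = σ 0 := by rw [FourierTransform.fourier_fourierInv_eq]
  rw [SchwartzMap.fourier_coe, Real.fourier_eq'] at h
  simpa using h

theorem exists_norm_le_levy {α : ℝ} (hα : α ∈ Set.Ioo (0 : ℝ) 2) (φ : 𝓢(Eu d, ℂ)) :
    ∃ C, 0 < C ∧ ∀ z ≠ 0, ‖φ z‖ ≤ C * levy α z := by
  obtain ⟨C0, h0, hC0⟩ := φ.decay 0 0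
  obtain ⟨C2, h2, hC2⟩ := φ.decay (d + 2) 0
  refine ⟨C0 + C2, by positivity, fun z hz => ?_⟩
  have hz0 : 0 < ‖z‖ := norm_pos_iff.2 hz
  have h3 : -(d : ℝ) - α = -((d : ℝ) + α) := by ring
  rw [levy, h3, Real.rpow_neg hz0.le, ← div_eq_mul_inv, le_div_iff₀ (by positivity)]
  have h4 := hC0 z
  have h5 := hC2 z
  rw [norm_iteratedFDeriv_zero] at h4 h5
  rw [pow_zero, one_mul] at h4
  rcases le_total ‖z‖ 1 with h | h
  · have : ‖z‖ ^ ((d : ℝ) + α) ≤ 1 :=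
      Real.rpow_le_one hz0.le h (by have := hα.1; positivity)
    nlinarith [norm_nonneg (φ z)]
  · have : ‖z‖ ^ ((d : ℝ) + α) ≤ ‖z‖ ^ (d + 2) := by
      rw [← Real.rpow_natCast]
      exact Real.rpow_le_rpow_of_exponent_le h (by push_cast; linarith [hα.2])
    nlinarith [norm_nonneg (φ z)]

/-- An even density below the Lévy density whose second difference operator acts as the identity
on functions of high frequency. -/
theorem exists_compensator {χ : Eu d → ℝ} (hχ : IsLPCutoff χ) {α : ℝ}
    (hα : α ∈ Set.Ioo (0 : ℝ) 2) :
    ∃ l : ℝ, 0 < l ∧ ∀ r : ℝ, 0 < r → ∃ g : Eu d → ℝ, Continuous g ∧ Integrable g volume ∧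
      (∀ z, g (-z) = g z) ∧ (∀ z ≠ 0, l * r ^ α * |g z| ≤ levy α z) ∧
      ∀ φ : 𝓢(Eu d, ℂ), (∀ ξ, 𝓕 φ ξ ≠ 0 → r ≤ ‖ξ‖) → ∀ x,
        Integrable (fun z => secondDiff φ z x * ((g z : ℝ) : ℂ)) volume ∧
        ∫ z, secondDiff φ z x * ((g z : ℝ) : ℂ) = -2 * φ x := by
  set σ := hχ.symbol 1 one_ne_zero with hσ
  obtain ⟨C, hC0, hC⟩ := exists_norm_le_levy hα (𝓕⁻ σ)
  refine ⟨(C * 2 ^ α)⁻¹, by positivity, fun r hr => ?_⟩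
  have hc : 0 < 2 / r := by positivity
  set b := hχ.symbol (2 / r) hc.ne' with hb
  have heven : ∀ ξ, b (-ξ) = b ξ := fun ξ => by
    simp only [hb, IsLPCutoff.symbol_apply]
    rw [hχ.radial _ ((2 / r) • ξ) (by simp)]
  have hre : ∀ z, 𝓕⁻ b z = (((𝓕⁻ b z).re : ℝ) : ℂ) :=
    fourierInv_eq_re heven fun ξ => by simp only [hb, IsLPCutoff.symbol_apply, Complex.conj_ofReal]
  have hcont : Continuous fun z => (𝓕⁻ b z).re := Complex.continuous_re.comp (𝓕⁻ b).continuous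
  refine ⟨fun z => (𝓕⁻ b z).re, hcont, (𝓕⁻ b).integrable.re, fun z => ?_, fun z hz => ?_,
    fun φ hφ x => ?_⟩
  · simp only [fourierInv_neg_of_even heven]
  · have h1 : |(𝓕⁻ b z).re| = ‖𝓕⁻ b z‖ := by
      conv_rhs => rw [hre z]
      rw [Complex.norm_real, Real.norm_eq_abs]
    have h2 := fourierInv_dilate (f := σ) (g := b) hc (fun ξ => by
      simp [hb, hσ, IsLPCutoff.symbol_apply]) z
    have hz' : (2 / r)⁻¹ • z ≠ 0 := smul_ne_zero (inv_ne_zero hc.ne') hz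
    rw [h1, h2, norm_mul, Complex.norm_real, Real.norm_of_nonneg (by positivity)]
    have h3 := hC _ hz'
    have hz0 : 0 < ‖z‖ := norm_pos_iff.2 hz
    have h4 : levy α ((2 / r)⁻¹ • z) = (2 / r) ^ ((d : ℝ) + α) * levy α z := by
      rw [levy, norm_smul, Real.norm_of_nonneg (by positivity), Real.mul_rpow (by positivity)
        hz0.le, levy]
      congr 1
      rw [Real.inv_rpow hc.le, ← Real.rpow_neg hc.le]; congr 1; ring
    rw [h4, Real.rpow_add hc, Real.rpow_natCast] at h3
    calc (C * 2 ^ α)⁻¹ * r ^ α * (((2 / r) ^ d)⁻¹ * ‖𝓕⁻ σ ((2 / r)⁻¹ • z)‖)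
        ≤ (C * 2 ^ α)⁻¹ * r ^ α * (((2 / r) ^ d)⁻¹ * (C * ((2 / r) ^ d * (2 / r) ^ α * levy α z))) := by
          gcongr
      _ = levy α z := by
          rw [Real.div_rpow (by norm_num) hr.le]
          field_simp
  · simp only [← hre]
    have hbs : ∀ ξ, r ≤ ‖ξ‖ → b ξ = 0 := fun ξ hξ => by
      rw [hb, IsLPCutoff.symbol_apply, hχ.eq_zero, Complex.ofReal_zero]
      rw [norm_smul, Real.norm_of_nonneg hc.le]
      calc (3 : ℝ) / 2 < 2 / r * r := by rw [div_mul_cancel₀ _ hr.ne']; norm_num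
        _ ≤ _ := by gcongr
    have hmul : mult (b : Eu d → ℂ) φ = 0 := by
      refine schwartz_ext_fourier fun ξ => ?_
      rw [fourier_mult b.hasTemperateGrowth, FourierTransform.fourier_zero]
      by_cases h : 𝓕 φ ξ = 0
      · simp [h]
      · simp [hbs ξ (hφ ξ h)]
    obtain ⟨M, hM⟩ : ∃ M, ∀ x, ‖φ x‖ ≤ M := ⟨_, φ.norm_le_seminorm ℂ⟩
    have hi : ∀ f : Eu d → Eu d, Continuous f → Integrable (fun z => φ (f z) * 𝓕⁻ b z) volume :=
      fun f hf => (𝓕⁻ b).integrable.bdd_mul (c := M) (φ.continuous.comp hf).aestronglyMeasurable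
        (Eventually.of_forall fun y => hM _)
    have i1 := hi (fun z => x - z) (by fun_prop)
    have i2 := hi (fun z => x + z) (by fun_prop)
    have i3 := hi (fun _ => x) (by fun_prop)
    have e1 : ∫ z, φ (x - z) * 𝓕⁻ b z = 0 := by
      have := mult_apply_eq_integral b φ x
      rw [hmul] at this
      rw [_root_.zero_apply] at this
      simpa [mul_comm] using this.symm
    have e2 : ∫ z, φ (x + z) * 𝓕⁻ b z = 0 := by
      rw [← integral_neg_eq_self, ← e1]
      simp only [fourierInv_neg_of_even heven, sub_eq_add_neg]
    have e3 : ∫ z, φ x * 𝓕⁻ b z = φ x := by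
      rw [integral_const_mul, integral_fourierInv, hb, IsLPCutoff.symbol_apply, smul_zero,
        hχ.eq_one 0 (by simp)]; simp
    have e : ∀ z, secondDiff φ z x * 𝓕⁻ b z =
        (φ (x + z) * 𝓕⁻ b z + φ (x - z) * 𝓕⁻ b z) - 2 * (φ x * 𝓕⁻ b z) := fun z => by
      simp [secondDiff]; ring
    simp only [e]
    have i4 : Integrable (fun z => φ (x + z) * 𝓕⁻ b z + φ (x - z) * 𝓕⁻ b z) volume := i2.add i1
    refine ⟨i4.sub (i3.const_mul 2), ?_⟩
    rw [integral_sub i4 (i3.const_mul 2), integral_add i2 i1, e1, e2, integral_const_mul,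
      e3]
    ring

theorem enorm_ofReal_complex {a : ℝ} (ha : 0 ≤ a) : ‖(a : ℂ)‖ₑ = ENNReal.ofReal a := by
  rw [← ofReal_norm, Complex.norm_real, Real.norm_of_nonneg ha]

theorem integrableOn_levy (hd : 1 ≤ d) {α : ℝ} (hα : α ∈ Set.Ioo (0 : ℝ) 2) {δ : ℝ} (hδ : 0 < δ) :
    IntegrableOn (levy α : Eu d → ℝ) (Metric.closedBall 0 δ)ᶜ volume := by
  have h0 : 0 < min 1 (δ ^ 2) := by positivity
  refine Integrable.mono' (((integrable_min_mul_levy hd hα).const_mul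
    (min 1 (δ ^ 2))⁻¹).integrableOn) (measurable_levy α).aestronglyMeasurable ?_
  filter_upwards [ae_restrict_mem Metric.isClosed_closedBall.measurableSet.compl] with z hz
  have hz' : δ < ‖z‖ := by simpa using hz
  rw [Real.norm_of_nonneg (levy_nonneg _ _), ← mul_assoc]
  refine le_mul_of_one_le_left (levy_nonneg _ _) ?_
  rw [inv_mul_eq_div, one_le_div h0]
  gcongr

set_option maxHeartbeats 800000 in
/-- The fractional Laplacian is dissipative on functions of high frequency. -/
theorem exists_dissipative (hd : 1 ≤ d) {χ : Eu d → ℝ} (hχ : IsLPCutoff χ) {α : ℝ}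
    (hα : α ∈ Set.Ioo (0 : ℝ) 2) :
    ∃ l : ℝ, 0 < l ∧ ∀ r : ℝ, 0 < r → ∀ κ : 𝓢(Eu d, ℂ), ∀ l' : ℝ, l' < l * r ^ α → ∃ ε₀ : ℝ, 0 < ε₀ ∧
      ∀ ε : ℝ, 0 ≤ ε → ε ≤ ε₀ → ∀ (p : ℝ≥0∞) [Fact (1 ≤ p)] (φ ψ : 𝓢(Eu d, ℂ)),
        (∀ ξ, 𝓕 φ ξ ≠ 0 → r ≤ ‖ξ‖) → mult (κ : Eu d → ℂ) φ = φ →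
        (∀ x, ψ x = φ x + (ε : ℂ) * fracLaplacian α φ x) →
        lpn p ψ ≤ (1 - l' * ε) * lpn p φ := by
  obtain ⟨l, hl, H⟩ := exists_compensator hχ hα
  refine ⟨l, hl, fun r hr κ l' hl' => ?_⟩
  obtain ⟨g, hgc, hgi, hge, hgl, hgφ⟩ := H r hr
  set L := l * r ^ α with hL
  have hL0 : 0 < L := by positivity
  obtain ⟨δ, hδ, k, hk, hkη, hkφ⟩ := exists_smallJump_kernel hd hα κ (η := L - l') (by linarith)
  set B := Metric.closedBall (0 : Eu d) δ
  have hBm : MeasurableSet B := Metric.isClosed_closedBall.measurableSet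
  set μ : Eu d → ℝ := fun z => levy α z - L * g z with hμ
  have hμm : Measurable μ := (measurable_levy α).sub (hgc.measurable.const_mul _)
  have hμ0 : ∀ z ≠ 0, 0 ≤ μ z := fun z hz => by
    have := hgl z hz
    have h2 : L * g z ≤ L * |g z| := by gcongr; exact le_abs_self _
    simp only [hμ]; linarith
  have hμ2 : ∀ z ≠ 0, |μ z| ≤ 2 * levy α z := fun z hz => by
    have := hgl z hz
    rw [abs_of_nonneg (hμ0 z hz)]
    have h2 : L * -g z ≤ L * |g z| := by gcongr; exact neg_le_abs _
    simp only [hμ]; linarith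
  have hμe : ∀ z, μ (-z) = μ z := fun z => by simp [hμ, levy, hge]
  have hBc : ∀ z ∈ Bᶜ, z ≠ 0 := by
    rintro z hz rfl
    exact hz (by simp [B, hδ.le])
  have hμi : IntegrableOn μ Bᶜ volume :=
    (integrableOn_levy hd hα hδ).sub (hgi.const_mul L).integrableOn
  set m := ∫ z in Bᶜ, μ z with hm
  have hm0 : 0 ≤ m := setIntegral_nonneg hBm.compl fun z hz => hμ0 z (hBc z hz)
  refine ⟨(L + m)⁻¹, by positivity, fun ε hε hε0 p _ φ ψ hφ hκφ hψ => ?_⟩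
  have hεm : ε * (L + m) ≤ 1 := by
    calc ε * (L + m) ≤ (L + m)⁻¹ * (L + m) := by gcongr
      _ = 1 := inv_mul_cancel₀ (by positivity)
  have hmlin : ∫⁻ z in Bᶜ, ENNReal.ofReal (μ z) = ENNReal.ofReal m := by
    rw [hm, ofReal_integral_eq_lintegral_ofReal hμi]
    filter_upwards [ae_restrict_mem hBm.compl] with z hz using hμ0 z (hBc z hz)
  have key := lpn_le_of_enorm_le_add p φ ψ (a := 1 - ε * (L + m)) (C := ε * (m + (L - l')))
    (k := fun z => ENNReal.ofReal ε * (Bᶜ.indicator (fun z => ENNReal.ofReal (μ z)) z + k z))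
    (((hμm.ennreal_ofReal.indicator hBm.compl).add hk).const_mul _) (by linarith)
    (mul_nonneg hε (by linarith)) ?_ ?_
  · refine key.trans (le_of_eq ?_); ring
  · rw [lintegral_const_mul' _ _ ENNReal.ofReal_ne_top, ENNReal.ofReal_mul hε,
      lintegral_add_right _ hk, lintegral_indicator hBm.compl, hmlin,
      ENNReal.ofReal_add hm0 (by linarith)]
    gcongr
  · intro x
    obtain ⟨gi, ge⟩ := hgφ φ hφ x
    have li := integrable_secondDiff_mul_levy hd hα φ x
    have hsd : ∀ z, secondDiff φ z x * ((μ z : ℝ) : ℂ) =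
        secondDiff φ z x * ((levy α z : ℝ) : ℂ) -
          (L : ℂ) * (secondDiff φ z x * ((g z : ℝ) : ℂ)) := fun z => by
      simp only [hμ]; push_cast; ring
    have mi : Integrable (fun z => secondDiff φ z x * ((μ z : ℝ) : ℂ)) volume := by
      simp only [hsd]; exact li.sub (gi.const_mul _)
    have me : ∫ z, secondDiff φ z x * ((μ z : ℝ) : ℂ) =
        (∫ z, secondDiff φ z x * ((levy α z : ℝ) : ℂ)) + 2 * L * φ x := by
      simp only [hsd]
      rw [integral_sub li (gi.const_mul _), integral_const_mul, ge]; ring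
    have hfar : ∀ f : Eu d → Eu d, Continuous f →
        IntegrableOn (fun z => φ (f z) * ((μ z : ℝ) : ℂ)) Bᶜ volume := fun f hf => by
      obtain ⟨M, hM⟩ : ∃ M, ∀ x, ‖φ x‖ ≤ M := ⟨_, φ.norm_le_seminorm ℂ⟩
      exact Integrable.bdd_mul (c := M) hμi.ofReal (φ.continuous.comp hf).aestronglyMeasurable
        (Eventually.of_forall fun y => hM _)
    have f1 := hfar (fun z => x - z) (by fun_prop)
    have f2 := hfar (fun z => x + z) (by fun_prop)
    have f3 := hfar (fun _ => x) (by fun_prop)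
    have efar : ∫ z in Bᶜ, secondDiff φ z x * ((μ z : ℝ) : ℂ) =
        (∫ z in Bᶜ, (φ (x + z) * ((μ z : ℝ) : ℂ) + φ (x - z) * ((μ z : ℝ) : ℂ))) -
          2 * (φ x * (m : ℂ)) := by
      have : ∫ z in Bᶜ, φ x * ((μ z : ℝ) : ℂ) = φ x * (m : ℂ) := by
        rw [integral_const_mul, integral_complex_ofReal]
      have f4 : IntegrableOn (fun z => φ (x + z) * ((μ z : ℝ) : ℂ) +
        φ (x - z) * ((μ z : ℝ) : ℂ)) Bᶜ volume := f2.add f1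
      rw [← this, ← integral_const_mul, ← integral_sub f4 (f3.const_mul 2)]
      congr 1; ext z
      simp [secondDiff]; ring
    have hsplit : ψ x = ((1 - ε * (L + m) : ℝ) : ℂ) * φ x +
        ((ε / 2 : ℝ) : ℂ) * (∫ z in Bᶜ, (φ (x + z) * ((μ z : ℝ) : ℂ) + φ (x - z) * ((μ z : ℝ) : ℂ))) +
        ((ε / 2 : ℝ) : ℂ) * ∫ z in B, secondDiff φ z x * ((μ z : ℝ) : ℂ) := by
      have h1 := integral_add_compl hBm mi
      rw [me, efar] at h1
      rw [hψ, fracLaplacian_eq]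
      push_cast
      linear_combination (-(ε : ℂ) / 2) * h1
    have b1 : ‖∫ z in Bᶜ, (φ (x + z) * ((μ z : ℝ) : ℂ) + φ (x - z) * ((μ z : ℝ) : ℂ))‖ₑ ≤
        2 * ∫⁻ z, ‖φ (x - z)‖ₑ * Bᶜ.indicator (fun z => ENNReal.ofReal (μ z)) z := by
      set F : Eu d → ℝ≥0∞ := fun z =>
        ‖φ (x - z)‖ₑ * Bᶜ.indicator (fun z => ENNReal.ofReal (μ z)) z with hF
      have hFm : Measurable F :=
        (φ.continuous.enorm.measurable.comp (by fun_prop)).mul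
          (hμm.ennreal_ofReal.indicator hBm.compl)
      have hsym : ∀ z, z ∈ Bᶜ ↔ -z ∈ Bᶜ := fun z => by simp [B]
      calc _ ≤ ∫⁻ z in Bᶜ, ‖φ (x + z) * ((μ z : ℝ) : ℂ) + φ (x - z) * ((μ z : ℝ) : ℂ)‖ₑ :=
            enorm_integral_le_lintegral_enorm _
        _ ≤ ∫⁻ z in Bᶜ, (F (-z) + F z) := by
            refine setLIntegral_mono' hBm.compl fun z hz => (enorm_add_le _ _).trans (le_of_eq ?_)
            simp only [hF, enorm_mul, Set.indicator_of_mem hz, Set.indicator_of_mem ((hsym z).1 hz),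
              hμe, enorm_ofReal_complex (hμ0 z (hBc z hz)), sub_neg_eq_add]
        _ ≤ ∫⁻ z, (F (-z) + F z) := setLIntegral_le_lintegral _ _
        _ = _ := by
            rw [lintegral_add_right _ hFm, lintegral_neg_eq_self, two_mul]
    have b2 : ‖∫ z in B, secondDiff φ z x * ((μ z : ℝ) : ℂ)‖ₑ ≤
        2 * ∫⁻ y, ‖φ (x - y)‖ₑ * k y := by
      calc _ ≤ ∫⁻ z in B, ‖secondDiff φ z x * ((μ z : ℝ) : ℂ)‖ₑ :=
            enorm_integral_le_lintegral_enorm _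
        _ ≤ ∫⁻ z in B, 2 * (‖secondDiff φ z x‖ₑ * ENNReal.ofReal (levy α z)) := by
            refine lintegral_mono fun z => ?_
            dsimp only
            rcases eq_or_ne z 0 with rfl | hz
            · simp [secondDiff, two_mul]
            · rw [enorm_mul, mul_left_comm]
              gcongr
              rw [← ofReal_norm, Complex.norm_real, Real.norm_eq_abs,
                show (2 : ℝ≥0∞) = ENNReal.ofReal 2 by simp, ← ENNReal.ofReal_mul (by norm_num)]
              exact ENNReal.ofReal_le_ofReal (hμ2 z hz)
        _ = 2 * ∫⁻ z in B, ‖secondDiff φ z x‖ₑ * ENNReal.ofReal (levy α z) :=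
            lintegral_const_mul' _ _ (by simp)
        _ ≤ _ := mul_le_mul' le_rfl (hkφ φ hκφ x)
    have hε2 : 0 ≤ ε / 2 := by linarith
    have e2 : ENNReal.ofReal (ε / 2) * 2 = ENNReal.ofReal ε := by
      rw [show (2 : ℝ≥0∞) = ENNReal.ofReal 2 by simp, ← ENNReal.ofReal_mul hε2]
      congr 1; ring
    rw [hsplit]
    refine (enorm_add_le _ _).trans ((add_le_add_left (enorm_add_le _ _) _).trans ?_)
    rw [enorm_mul, enorm_mul, enorm_mul, enorm_ofReal_complex hε2,
      enorm_ofReal_complex (by linarith : 0 ≤ 1 - ε * (L + m)), add_assoc]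
    gcongr
    calc _ ≤ ENNReal.ofReal (ε / 2) *
          (2 * ∫⁻ z, ‖φ (x - z)‖ₑ * Bᶜ.indicator (fun z => ENNReal.ofReal (μ z)) z) +
          ENNReal.ofReal (ε / 2) * (2 * ∫⁻ y, ‖φ (x - y)‖ₑ * k y) := by gcongr
      _ = ENNReal.ofReal ε * ((∫⁻ z, ‖φ (x - z)‖ₑ * Bᶜ.indicator (fun z => ENNReal.ofReal (μ z)) z) +
          ∫⁻ y, ‖φ (x - y)‖ₑ * k y) := by rw [← mul_assoc, ← mul_assoc, e2, mul_add]
      _ = _ := by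
          rw [← lintegral_add_right, ← lintegral_const_mul' _ _ ENNReal.ofReal_ne_top]
          · congr 1; ext z; ring
          · exact (φ.continuous.enorm.measurable.comp (by fun_prop)).mul hk

end

section

section SchNorm

variable {E : Type*} [NormedAddCommGroup E] [NormedSpace ℝ E]

/-- The norm of order `N` on the Schwartz space. -/
def schNorm (N : ℕ) (φ : 𝓢(E, ℂ)) : ℝ :=
  ∑ k ∈ Finset.range (N + 1), ∑ n ∈ Finset.range (N + 1), SchwartzMap.seminorm ℂ k n φ

theorem schNorm_nonneg (N : ℕ) (φ : 𝓢(E, ℂ)) : 0 ≤ schNorm N φ :=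
  Finset.sum_nonneg fun _ _ => Finset.sum_nonneg fun _ _ => apply_nonneg _ _

theorem seminorm_le_schNorm {N k n : ℕ} (hk : k ≤ N) (hn : n ≤ N) (φ : 𝓢(E, ℂ)) :
    SchwartzMap.seminorm ℂ k n φ ≤ schNorm N φ := by
  refine le_trans ?_ (Finset.single_le_sum (f := fun k => ∑ n ∈ Finset.range (N + 1),
    SchwartzMap.seminorm ℂ k n φ) (fun _ _ => Finset.sum_nonneg fun _ _ => apply_nonneg _ _)
    (Finset.mem_range.2 (Nat.lt_succ_of_le hk)))
  exact Finset.single_le_sum (f := fun n => SchwartzMap.seminorm ℂ k n φ)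
    (fun _ _ => apply_nonneg _ _) (Finset.mem_range.2 (Nat.lt_succ_of_le hn))

theorem schNorm_le {N : ℕ} {φ : 𝓢(E, ℂ)} {C : ℝ}
    (h : ∀ k ≤ N, ∀ n ≤ N, SchwartzMap.seminorm ℂ k n φ ≤ C) :
    schNorm N φ ≤ (N + 1) ^ 2 * C := by
  have h1 : schNorm N φ ≤ ∑ k ∈ Finset.range (N + 1), ∑ n ∈ Finset.range (N + 1), C :=
    Finset.sum_le_sum fun k hk => Finset.sum_le_sum fun n hn =>
      h k (Nat.lt_succ_iff.1 (Finset.mem_range.1 hk)) n (Nat.lt_succ_iff.1 (Finset.mem_range.1 hn))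
  refine h1.trans (le_of_eq ?_)
  simp; ring

theorem schNorm_add_le (N : ℕ) (φ ψ : 𝓢(E, ℂ)) :
    schNorm N (φ + ψ) ≤ schNorm N φ + schNorm N ψ := by
  simp only [schNorm, ← Finset.sum_add_distrib]
  exact Finset.sum_le_sum fun k _ => Finset.sum_le_sum fun n _ => map_add_le_add _ _ _

theorem schNorm_smul (N : ℕ) (c : ℂ) (φ : 𝓢(E, ℂ)) : schNorm N (c • φ) = ‖c‖ * schNorm N φ := by
  simp only [schNorm, map_smul_eq_mul, Finset.mul_sum]

theorem exists_seminorm_le_schNorm (q : Seminorm ℂ 𝓢(E, ℂ)) (hq : Continuous q) :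
    ∃ (N : ℕ) (C : ℝ), 0 ≤ C ∧ ∀ φ, q φ ≤ C * schNorm N φ := by
  obtain ⟨s, C, -, h⟩ := Seminorm.bound_of_continuous (schwartz_withSeminorms ℂ E ℂ) q hq
  refine ⟨s.sup fun m => max m.1 m.2, C * s.card, by positivity, fun φ => (h φ).trans ?_⟩
  set N := s.sup fun m => max m.1 m.2
  rw [mul_assoc]
  show (C : ℝ) * (s.sup (schwartzSeminormFamily ℂ E ℂ)) φ ≤ _
  gcongr
  refine Seminorm.finset_sup_apply_le (mul_nonneg (Nat.cast_nonneg _) (schNorm_nonneg _ _))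
    fun m hm => ?_
  have h2 : max m.1 m.2 ≤ N := Finset.le_sup (f := fun m : ℕ × ℕ => max m.1 m.2) hm
  have h3 : (1 : ℝ) ≤ s.card := by exact_mod_cast Finset.card_pos.2 ⟨m, hm⟩
  have h4 := seminorm_le_schNorm ((le_max_left _ _).trans h2) ((le_max_right _ _).trans h2) φ
  calc _ ≤ schNorm N φ := h4
    _ ≤ _ := le_mul_of_one_le_left (schNorm_nonneg _ _) h3

theorem exists_norm_le_schNorm {F : Type*} [SeminormedAddCommGroup F] [NormedSpace ℂ F]
    (L : 𝓢(E, ℂ) →ₗ[ℂ] F) (hL : Continuous L) :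
    ∃ (N : ℕ) (C : ℝ), 0 ≤ C ∧ ∀ φ, ‖L φ‖ ≤ C * schNorm N φ :=
  exists_seminorm_le_schNorm ((normSeminorm ℂ F).comp L) (continuous_norm.comp hL)

/-- The sum of a bounded sequence in the Schwartz space with absolutely summable coefficients. -/
theorem exists_schwartz_tsum {φ : ℕ → 𝓢(E, ℂ)} {B : ℕ → ℕ → ℝ}
    (hB : ∀ k n j, SchwartzMap.seminorm ℂ k n (φ j) ≤ B k n) {a : ℕ → ℂ}
    (ha : Summable fun j => ‖a j‖) :
    ∃ S : 𝓢(E, ℂ), (∀ x, S x = ∑' j, a j * φ j x) ∧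
      ∀ k n, SchwartzMap.seminorm ℂ k n S ≤ B k n * ∑' j, ‖a j‖ := by
  have hB0 : ∀ k n, 0 ≤ B k n := fun k n => (apply_nonneg _ _).trans (hB k n 0)
  have hbd : ∀ (k n j : ℕ) x,
      ‖x‖ ^ k * ‖iteratedFDeriv ℝ n (a j • φ j) x‖ ≤ B k n * ‖a j‖ := by
    intro k n j x
    refine (SchwartzMap.le_seminorm ℂ k n (a j • φ j) x).trans ?_
    rw [map_smul_eq_mul, mul_comm]
    exact mul_le_mul_of_nonneg_right (hB k n j) (norm_nonneg _)
  have hd0 : ∀ (n j : ℕ) x, ‖iteratedFDeriv ℝ n (a j • φ j) x‖ ≤ B 0 n * ‖a j‖ := fun n j x => by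
    simpa using hbd 0 n j x
  have hcd := contDiff_tsum (𝕜 := ℝ) (N := ⊤) (f := fun j => (a j • φ j : 𝓢(E, ℂ)))
    (v := fun n j => B 0 n * ‖a j‖) (fun j => (a j • φ j).smooth')
    (fun n _ => ha.mul_left _) (fun n j x _ => hd0 n j x)
  have hit : ∀ n x, iteratedFDeriv ℝ n (fun y => ∑' j, (a j • φ j) y) x =
      ∑' j, iteratedFDeriv ℝ n (a j • φ j) x := fun n x =>
    iteratedFDeriv_tsum_apply (𝕜 := ℝ) (N := ⊤) (f := fun j => (a j • φ j : 𝓢(E, ℂ)))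
      (v := fun n j => B 0 n * ‖a j‖) (fun j => (a j • φ j).smooth')
      (fun n _ => ha.mul_left _) (fun n j x _ => hd0 n j x) le_top x
  have hdec : ∀ k n x, ‖x‖ ^ k * ‖iteratedFDeriv ℝ n (fun y => ∑' j, (a j • φ j) y) x‖ ≤
      B k n * ∑' j, ‖a j‖ := by
    intro k n x
    rw [hit]
    have hs : Summable fun j => ‖iteratedFDeriv ℝ n (a j • φ j) x‖ :=
      Summable.of_nonneg_of_le (fun _ => norm_nonneg _) (fun j => hd0 n j x) (ha.mul_left _)
    calc _ ≤ ‖x‖ ^ k * ∑' j, ‖iteratedFDeriv ℝ n (a j • φ j) x‖ := by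
          gcongr; exact norm_tsum_le_tsum_norm hs
      _ = ∑' j, ‖x‖ ^ k * ‖iteratedFDeriv ℝ n (a j • φ j) x‖ := tsum_mul_left.symm
      _ ≤ ∑' j, B k n * ‖a j‖ :=
          (hs.mul_left _).tsum_le_tsum (fun j => hbd k n j x) (ha.mul_left _)
      _ = _ := tsum_mul_left
  refine ⟨⟨_, hcd, fun k n => ⟨_, hdec k n⟩⟩, fun x => rfl, fun k n => ?_⟩
  exact SchwartzMap.seminorm_le_bound ℂ k n _
    (mul_nonneg (hB0 k n) (tsum_nonneg fun _ => norm_nonneg _)) (hdec k n)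

/-- The uniform boundedness principle on bounded sequences of Schwartz functions. -/
theorem exists_bound_of_pointwise_bound {φ : ℕ → 𝓢(E, ℂ)} {B : ℕ → ℕ → ℝ}
    (hB : ∀ k n j, SchwartzMap.seminorm ℂ k n (φ j) ≤ B k n) {ι : Type*}
    (u : ι → 𝓢(E, ℂ) →ₗ[ℂ] ℂ) (hu : ∀ i, Continuous (u i)) (hb : ∀ ψ, ∃ C, ∀ i, ‖u i ψ‖ ≤ C) :
    ∃ C, ∀ i j, ‖u i (φ j)‖ ≤ C := by
  have hsum : ∀ a : lp (fun _ : ℕ => ℂ) 1, Summable fun j => ‖a j‖ := fun a => by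
    have := (lp.hasSum_norm (p := 1) (by simp) a).summable
    simpa using this
  have hnorm : ∀ a : lp (fun _ : ℕ => ℂ) 1, ∑' j, ‖a j‖ = ‖a‖ := fun a => by
    have := (lp.hasSum_norm (p := 1) (by simp) a).tsum_eq
    simpa using this
  choose S hS hSb using fun a : lp (fun _ : ℕ => ℂ) 1 => exists_schwartz_tsum hB (hsum a)
  have hsx : ∀ (a : lp (fun _ : ℕ => ℂ) 1) x, Summable fun j => a j * φ j x := fun a x => by
    refine Summable.of_norm_bounded (g := fun j => B 0 0 * ‖a j‖) ((hsum a).mul_left _) fun j => ?_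
    rw [norm_mul, mul_comm]
    exact mul_le_mul_of_nonneg_right ((SchwartzMap.norm_le_seminorm ℂ (φ j) x).trans (hB 0 0 j))
      (norm_nonneg _)
  set SL : lp (fun _ : ℕ => ℂ) 1 →ₗ[ℂ] 𝓢(E, ℂ) :=
    { toFun := S
      map_add' := fun a b => by
        ext x
        rw [_root_.add_apply, hS, hS, hS, ← (hsx a x).tsum_add (hsx b x)]
        simp [add_mul]
      map_smul' := fun c a => by
        ext x
        rw [_root_.smul_apply, hS, RingHom.id_apply, hS, smul_eq_mul, ← tsum_mul_left]
        simp [mul_assoc] } with hSL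
  have hT : ∀ i, ∃ K, ∀ a, ‖u i (SL a)‖ ≤ K * ‖a‖ := by
    intro i
    obtain ⟨N, C, hC, h⟩ := exists_norm_le_schNorm (u i) (hu i)
    refine ⟨C * ∑ k ∈ Finset.range (N + 1), ∑ n ∈ Finset.range (N + 1), B k n, fun a => ?_⟩
    refine (h _).trans ?_
    rw [mul_assoc]
    gcongr
    rw [Finset.sum_mul]
    refine Finset.sum_le_sum fun k _ => ?_
    rw [Finset.sum_mul]
    refine Finset.sum_le_sum fun n _ => ?_
    rw [← hnorm a]; exact hSb a k n
  choose K hK using hT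
  set T : ι → lp (fun _ : ℕ => ℂ) 1 →L[ℂ] ℂ := fun i =>
    LinearMap.mkContinuous ((u i).comp SL) (K i) (hK i)
  obtain ⟨C, hC⟩ := banach_steinhaus (g := T) fun a => by
    obtain ⟨C, hC⟩ := hb (SL a)
    exact ⟨C, fun i => hC i⟩
  refine ⟨C, fun i j => ?_⟩
  have h1 : SL (lp.single 1 j (1 : ℂ)) = φ j := by
    ext x
    show S _ x = _
    rw [hS, tsum_eq_single j]
    · simp
    · intro j' hj'
      simp [lp.single_apply, hj']
  have h2 := (T i).le_of_opNorm_le (hC i) (lp.single 1 j (1 : ℂ))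
  rw [lp.norm_single (by simp)] at h2
  rw [← h1]
  simpa [T] using h2

end SchNorm

end

section

variable {d : ℕ}

/-- A tempered distribution as a linear functional. -/
def distLin (v : 𝓢'(Eu d, ℂ)) : 𝓢(Eu d, ℂ) →ₗ[ℂ] ℂ :=
  { toFun := v, map_add' := map_add v, map_smul' := map_smul v }

theorem continuous_tempered (v : 𝓢'(Eu d, ℂ)) : Continuous fun φ => v φ := map_continuous v

theorem schNorm_smulLeftCLM_le {a : Eu d → ℂ} (ha : ContDiff ℝ ((⊤ : ℕ∞) : WithTop ℕ∞) a)
    (hs : HasCompactSupport a) (N : ℕ) :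
    ∃ C : ℝ, 0 ≤ C ∧ ∀ ψ, schNorm N (SchwartzMap.smulLeftCLM ℂ a ψ) ≤ C * schNorm N ψ := by
  obtain ⟨M, hM0, hM⟩ := exists_bound_iteratedFDeriv_of_hasCompactSupport ha hs N
  have htg : a.HasTemperateGrowth := hs.hasTemperateGrowth ha
  refine ⟨((N : ℝ) + 1) ^ 2 * (M * 2 ^ N), by positivity, fun ψ => ?_⟩
  rw [mul_assoc]
  refine schNorm_le fun k hk n hn => ?_
  refine (seminorm_smulLeftCLM_le htg (fun j hj => hM j (hj.trans hn)) k ψ).trans ?_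
  rw [mul_assoc]
  gcongr
  calc _ ≤ ∑ i ∈ Finset.range (n + 1), (n.choose i : ℝ) * schNorm N ψ := by
        gcongr with i hi
        exact seminorm_le_schNorm hk (by omega) ψ
    _ = (2 : ℝ) ^ n * schNorm N ψ := by
        rw [← Finset.sum_mul]
        congr 1
        exact_mod_cast Nat.sum_range_choose n
    _ ≤ _ := by
        gcongr
        · exact schNorm_nonneg _ _
        · norm_num

theorem fourier_mult_eq {a : Eu d → ℂ} (ha : a.HasTemperateGrowth) (ψ : 𝓢(Eu d, ℂ)) :
    𝓕 (mult a ψ) = SchwartzMap.smulLeftCLM ℂ a (𝓕 ψ) := by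
  ext ξ
  rw [fourier_mult ha, SchwartzMap.smulLeftCLM_apply_apply ha]; rfl

/-- One explicit Euler step for the equation with generator `mult a`. -/
def eulerStep (a : Eu d → ℂ) (h : ℝ) (ψ : 𝓢(Eu d, ℂ)) : 𝓢(Eu d, ℂ) := ψ + (h : ℂ) • mult a ψ

/-- The Euler scheme is uniformly bounded on pointwise bounded families of distributions. -/
theorem exists_bound_euler {a : Eu d → ℂ} (ha : ContDiff ℝ ((⊤ : ℕ∞) : WithTop ℕ∞) a)
    (hs : HasCompactSupport a) {ι : Type*} (v : ι → 𝓢'(Eu d, ℂ))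
    (hv : ∀ ψ, ∃ C, ∀ i, ‖v i ψ‖ ≤ C) (φ : 𝓢(Eu d, ℂ)) {t : ℝ} (ht : 0 ≤ t) :
    ∃ C, ∀ i (n k : ℕ), k ≤ n →
      ‖v i (mult a (mult a ((eulerStep a (t / n))^[k] φ)))‖ ≤ C := by
  have htg : a.HasTemperateGrowth := hs.hasTemperateGrowth ha
  choose C hC0 hC using schNorm_smulLeftCLM_le ha hs
  have h1 : ∀ N ψ, schNorm N (𝓕 (mult a ψ)) ≤ C N * schNorm N (𝓕 ψ) := fun N ψ => by
    rw [fourier_mult_eq htg]; exact hC N _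
  have h2 : ∀ N (n k : ℕ), schNorm N (𝓕 ((eulerStep a (t / n))^[k] φ)) ≤
      (1 + t / n * C N) ^ k * schNorm N (𝓕 φ) := by
    intro N n k
    induction k with
    | zero => simp
    | succ k ih =>
      rw [Function.iterate_succ_apply']
      set ψ := (eulerStep a (t / n))^[k] φ
      have h3 : 𝓕 (eulerStep a (t / n) ψ) = 𝓕 ψ + ((t / n : ℝ) : ℂ) • 𝓕 (mult a ψ) := by
        rw [eulerStep, FourierTransform.fourier_add, FourierTransform.fourier_smul]
      rw [h3]
      refine (schNorm_add_le _ _ _).trans ?_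
      rw [schNorm_smul, Complex.norm_real, Real.norm_of_nonneg (by positivity)]
      calc _ ≤ schNorm N (𝓕 ψ) + t / n * (C N * schNorm N (𝓕 ψ)) := by gcongr; exact h1 N ψ
        _ = (1 + t / n * C N) * schNorm N (𝓕 ψ) := by ring
        _ ≤ (1 + t / n * C N) * ((1 + t / n * C N) ^ k * schNorm N (𝓕 φ)) := by
          have := hC0 N
          gcongr
        _ = _ := by ring
  have h3 : ∀ N (n k : ℕ), k ≤ n → schNorm N (𝓕 ((eulerStep a (t / n))^[k] φ)) ≤
      Real.exp (t * C N) * schNorm N (𝓕 φ) := by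
    intro N n k hk
    refine (h2 N n k).trans (mul_le_mul_of_nonneg_right ?_ (schNorm_nonneg _ _))
    have hx : 0 ≤ t / n * C N := mul_nonneg (by positivity) (hC0 N)
    calc (1 + t / n * C N) ^ k ≤ (1 + t / n * C N) ^ n :=
          pow_le_pow_right₀ (by linarith) hk
      _ ≤ Real.exp (t / n * C N) ^ n := by
          gcongr; rw [add_comm]; exact Real.add_one_le_exp _
      _ = Real.exp (n * (t / n * C N)) := by rw [← Real.exp_nat_mul]
      _ ≤ _ := by
          refine Real.exp_le_exp.2 ?_
          rcases Nat.eq_zero_or_pos n with rfl | hn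
          · simp; exact mul_nonneg ht (hC0 N)
          · have : (n : ℝ) ≠ 0 := by positivity
            apply le_of_eq; field_simp
  set Φ : ℕ → 𝓢(Eu d, ℂ) := fun j =>
    𝓕 (mult a (mult a ((eulerStep a (t / (Nat.unpair j).1))^[min (Nat.unpair j).2 (Nat.unpair j).1] φ)))
    with hΦ
  set B : ℕ → ℝ := fun N => C N * (C N * (Real.exp (t * C N) * schNorm N (𝓕 φ)))
  have h4 : ∀ k n j, SchwartzMap.seminorm ℂ k n (Φ j) ≤ B (max k n) := by
    intro k n j
    refine (seminorm_le_schNorm (le_max_left k n) (le_max_right k n) _).trans ?_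
    refine (h1 _ _).trans (mul_le_mul_of_nonneg_left ((h1 _ _).trans
      (mul_le_mul_of_nonneg_left (h3 _ _ _ (min_le_right _ _)) (hC0 _))) (hC0 _))
  obtain ⟨D, hD⟩ := exists_bound_of_pointwise_bound (B := fun k n => B (max k n)) h4
    (fun i => (distLin (v i)).comp
      (FourierTransform.fourierInvCLM ℂ 𝓢(Eu d, ℂ) : 𝓢(Eu d, ℂ) →L[ℂ] 𝓢(Eu d, ℂ)).toLinearMap)
    (fun i => (continuous_tempered (v i)).comp (FourierTransform.fourierInvCLM ℂ 𝓢(Eu d, ℂ)).continuous)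
    (fun ψ => by
      obtain ⟨D, hD⟩ := hv (𝓕⁻ ψ)
      exact ⟨D, fun i => hD i⟩)
  refine ⟨D, fun i n k hk => ?_⟩
  have h5 := hD i (Nat.pair n k)
  have h6 : ∀ ψ : 𝓢(Eu d, ℂ), (distLin (v i)).comp
      (FourierTransform.fourierInvCLM ℂ 𝓢(Eu d, ℂ) : 𝓢(Eu d, ℂ) →L[ℂ] 𝓢(Eu d, ℂ)).toLinearMap (𝓕 ψ)
      = v i ψ := fun ψ => by
    show v i (𝓕⁻ (𝓕 ψ)) = _
    rw [FourierTransform.fourierInv_fourier_eq]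
  rw [hΦ] at h5
  simp only [h6, Nat.unpair_pair, min_eq_left hk] at h5
  exact h5

end

section

variable {d : ℕ}

/-- One step of the Euler scheme in Duhamel's formula. -/
theorem norm_le_euler_step {a : Eu d → ℂ} {Y : Submodule ℂ 𝓢(Eu d, ℂ)}
    (hYa : ∀ ψ ∈ Y, mult a ψ ∈ Y) {T : ℝ} {v f : ℝ → 𝓢'(Eu d, ℂ)} {p : ℝ≥0∞} {K : ℝ}
    (hK : ∀ ψ ∈ Y, lpn p (mult a ψ) ≤ K * lpn p ψ) {β : ℝ → ℝ}
    (hβi : IntervalIntegrable β volume 0 T)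
    (hβ : ∀ ψ ∈ Y, ∀ᵐ s, s ∈ Set.Ioc 0 T → ‖f s ψ‖ ≤ β s * lpn p ψ)
    (hvi : ∀ ψ ∈ Y, IntervalIntegrable (fun s => v s (mult a ψ)) volume 0 T)
    (hweak : ∀ ψ ∈ Y, ∀ x ∈ Set.Icc 0 T, ∀ y ∈ Set.Icc 0 T, v y ψ = v x ψ +
      (∫ s in x..y, v s (mult a ψ)) + ∫ s in x..y, f s ψ)
    {x y : ℝ} (hx : 0 ≤ x) (hxy : x ≤ y) (hy : y ≤ T) {ψ : 𝓢(Eu d, ℂ)} (hψ : ψ ∈ Y) {C : ℝ}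
    (hβ0 : ∀ s, 0 ≤ β s)
    (hC : ∀ s ∈ Set.Icc 0 T, ‖v s (mult a (mult a ψ))‖ ≤ C) :
    ‖v y ψ‖ ≤ ‖v x (eulerStep a (y - x) ψ)‖ + (∫ s in x..y, β s) * lpn p ψ + (y - x) ^ 2 * C +
      (y - x) * (K * lpn p ψ) * ∫ s in x..y, β s := by
  have hsub : ∀ x' y', 0 ≤ x' → x' ≤ y' → y' ≤ T → Set.uIcc x' y' ⊆ Set.uIcc 0 T := by
    intro x' y' h0 h1 h2
    rw [Set.uIcc_of_le h1, Set.uIcc_of_le (h0.trans (h1.trans h2))]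
    exact Set.Icc_subset_Icc h0 h2
  have hfb : ∀ ψ ∈ Y, ∀ x' y', 0 ≤ x' → x' ≤ y' → y' ≤ T →
      ‖∫ s in x'..y', f s ψ‖ ≤ (∫ s in x'..y', β s) * lpn p ψ := by
    intro ψ hψ x' y' h0 h1 h2
    rw [← intervalIntegral.integral_mul_const]
    refine intervalIntegral.norm_integral_le_of_norm_le h1 ?_
      ((hβi.mono_set (hsub _ _ h0 h1 h2)).mul_const _)
    filter_upwards [hβ ψ hψ] with s hs hs'
    exact hs ⟨h0.trans_lt hs'.1, hs'.2.trans h2⟩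
  have hA := hYa ψ hψ
  have hβn : 0 ≤ ∫ s in x..y, β s := intervalIntegral.integral_nonneg hxy fun s _ => hβ0 s
  have hbound : ∀ s ∈ Set.Icc x y, ‖v s (mult a ψ) - v x (mult a ψ)‖ ≤
      (y - x) * C + (∫ s in x..y, β s) * (K * lpn p ψ) := by
    intro s hs
    have h1 := hweak _ hA x ⟨hx, hxy.trans hy⟩ s ⟨hx.trans hs.1, hs.2.trans hy⟩
    have h2 : ‖∫ r in x..s, v r (mult a (mult a ψ))‖ ≤ C * |s - x| := by
      refine intervalIntegral.norm_integral_le_of_norm_le_const fun r hr => ?_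
      rw [Set.uIoc_of_le hs.1] at hr
      exact hC r ⟨hx.trans hr.1.le, hr.2.trans (hs.2.trans hy)⟩
    have h3 := hfb _ hA x s hx hs.1 (hs.2.trans hy)
    have hC0 : 0 ≤ C := (norm_nonneg _).trans (hC x ⟨hx, hxy.trans hy⟩)
    have h4 : ∫ r in x..s, β r ≤ ∫ r in x..y, β r := by
      refine intervalIntegral.integral_mono_interval le_rfl hs.1 hs.2
        (Eventually.of_forall fun s => hβ0 s) (hβi.mono_set (hsub _ _ hx hxy hy))
    have e : v s (mult a ψ) - v x (mult a ψ) =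
        (∫ r in x..s, v r (mult a (mult a ψ))) + ∫ r in x..s, f r (mult a ψ) := by
      rw [h1]; ring
    rw [e]
    refine (norm_add_le _ _).trans (add_le_add ?_ ?_)
    · refine h2.trans ?_
      rw [abs_of_nonneg (by linarith [hs.1]), mul_comm]
      exact mul_le_mul_of_nonneg_right (by linarith [hs.2]) hC0
    · exact h3.trans (mul_le_mul h4 (hK ψ hψ) (lpn_nonneg _ _) hβn)
  have h5 := hweak ψ hψ x ⟨hx, hxy.trans hy⟩ y ⟨hx.trans hxy, hy⟩
  have h6 : ∫ s in x..y, (v s (mult a ψ) - v x (mult a ψ)) =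
      (∫ s in x..y, v s (mult a ψ)) - ((y - x : ℝ) : ℂ) * v x (mult a ψ) := by
    rw [intervalIntegral.integral_sub ((hvi ψ hψ).mono_set (hsub _ _ hx hxy hy))
      intervalIntegrable_const, intervalIntegral.integral_const, Complex.real_smul]
  have h7 : v x (eulerStep a (y - x) ψ) = v x ψ + ((y - x : ℝ) : ℂ) * v x (mult a ψ) := by
    rw [eulerStep, map_add, map_smul, smul_eq_mul]
  have h8 : v y ψ = v x (eulerStep a (y - x) ψ) +
      (∫ s in x..y, (v s (mult a ψ) - v x (mult a ψ))) + ∫ s in x..y, f s ψ := by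
    rw [h5, h6, h7]; ring
  have h9 : ‖∫ s in x..y, (v s (mult a ψ) - v x (mult a ψ))‖ ≤
      ((y - x) * C + (∫ s in x..y, β s) * (K * lpn p ψ)) * |y - x| := by
    refine intervalIntegral.norm_integral_le_of_norm_le_const fun s hs => ?_
    rw [Set.uIoc_of_le hxy] at hs
    exact hbound s ⟨hs.1.le, hs.2⟩
  rw [abs_of_nonneg (by linarith)] at h9
  rw [h8]
  have h10 := hfb ψ hψ x y hx hxy hy
  refine (norm_add_le _ _).trans ?_
  refine (add_le_add (norm_add_le _ _) le_rfl).trans ?_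
  nlinarith [h9, h10]

set_option maxHeartbeats 400000 in
/-- Duhamel's formula as an estimate: decay of the homogeneous equation gives decay of the solution
in the dual norm. -/
theorem norm_le_duhamel {a : Eu d → ℂ} (ha : ContDiff ℝ ((⊤ : ℕ∞) : WithTop ℕ∞) a)
    (hs : HasCompactSupport a) {Y : Submodule ℂ 𝓢(Eu d, ℂ)}
    (hYa : ∀ ψ ∈ Y, mult a ψ ∈ Y) {T : ℝ} {v f : ℝ → 𝓢'(Eu d, ℂ)} {p : ℝ≥0∞}
    {K : ℝ} (hK : ∀ ψ ∈ Y, lpn p (mult a ψ) ≤ K * lpn p ψ) (hK0 : 0 ≤ K) {l ε₀ : ℝ} (hl : 0 ≤ l)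
    (hε₀ : 0 < ε₀)
    (hdiss : ∀ ε, 0 ≤ ε → ε ≤ ε₀ → ∀ ψ ∈ Y, lpn p (eulerStep a ε ψ) ≤ (1 - l * ε) * lpn p ψ)
    {β : ℝ → ℝ} (hβ0 : ∀ s, 0 ≤ β s) (hβi : IntervalIntegrable β volume 0 T)
    (hβ : ∀ ψ ∈ Y, ∀ᵐ s, s ∈ Set.Ioc 0 T → ‖f s ψ‖ ≤ β s * lpn p ψ)
    (hv : ∀ ψ, ∃ C, ∀ s ∈ Set.Icc 0 T, ‖v s ψ‖ ≤ C)
    (hvi : ∀ ψ ∈ Y, IntervalIntegrable (fun s => v s (mult a ψ)) volume 0 T)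
    (hweak : ∀ ψ ∈ Y, ∀ x ∈ Set.Icc 0 T, ∀ y ∈ Set.Icc 0 T, v y ψ = v x ψ +
      (∫ s in x..y, v s (mult a ψ)) + ∫ s in x..y, f s ψ)
    {m : ℝ} (hm0 : 0 ≤ m) (hm : ∀ ψ ∈ Y, ‖v 0 ψ‖ ≤ m * lpn p ψ)
    {t : ℝ} (ht : t ∈ Set.Icc 0 T) {φ : 𝓢(Eu d, ℂ)} (hφ : φ ∈ Y) :
    ‖v t φ‖ ≤ (Real.exp (-l * t) * m + ∫ s in 0..t, Real.exp (-l * (t - s)) * β s) * lpn p φ := by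
  have hL := lpn_nonneg p φ
  have ht0 := ht.1
  obtain ⟨C, hC⟩ := exists_bound_euler ha hs (fun s : Set.Icc 0 T => v s)
    (fun ψ => by obtain ⟨C, h⟩ := hv ψ; exact ⟨C, fun i => h i i.2⟩) φ ht0
  have hsub : ∀ x' y', 0 ≤ x' → x' ≤ y' → y' ≤ T → Set.uIcc x' y' ⊆ Set.uIcc 0 T := by
    intro x' y' h0 h1 h2
    rw [Set.uIcc_of_le h1, Set.uIcc_of_le (h0.trans (h1.trans h2))]
    exact Set.Icc_subset_Icc h0 h2
  have hei : ∀ x' y', 0 ≤ x' → x' ≤ y' → y' ≤ T →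
      IntervalIntegrable (fun s => Real.exp (-l * (t - s)) * β s) volume x' y' := fun x' y' h0 h1 h2 =>
    (hβi.mono_set (hsub _ _ h0 h1 h2)).continuousOn_mul (by fun_prop)
  have hbi : ∀ x' y', 0 ≤ x' → x' ≤ y' → y' ≤ T → IntervalIntegrable β volume x' y' :=
    fun x' y' h0 h1 h2 => hβi.mono_set (hsub _ _ h0 h1 h2)
  set J := ∫ s in 0..t, Real.exp (-l * (t - s)) * β s with hJ
  set I := ∫ s in 0..t, β s with hI
  have hscheme : ∀ n : ℕ, 0 < n → t / n ≤ ε₀ → l * (t / n) ≤ 1 → ‖v t φ‖ ≤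
      Real.exp (-l * t) * m * lpn p φ + Real.exp (l * (t / n)) * J * lpn p φ +
        t / n * (t * C + K * lpn p φ * I) := by
    intro n hn hnε hnl
    have hn0 : (0 : ℝ) < n := by exact_mod_cast hn
    set h := t / n with hh
    have hh0 : 0 ≤ h := by positivity
    have hnh : n * h = t := by rw [hh]; field_simp
    set ψ : ℕ → 𝓢(Eu d, ℂ) := fun k => (eulerStep a h)^[k] φ with hψ
    have hψY : ∀ k, ψ k ∈ Y := by
      intro k
      induction k with
      | zero => exact hφ
      | succ k ih =>
        simp only [hψ, Function.iterate_succ_apply'] at ih ⊢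
        exact Y.add_mem ih (Y.smul_mem _ (hYa _ ih))
    have hψl : ∀ k, lpn p (ψ k) ≤ (1 - l * h) ^ k * lpn p φ := by
      intro k
      induction k with
      | zero => simp [hψ]
      | succ k ih =>
        have h1 := hdiss h hh0 hnε (ψ k) (hψY k)
        have e : ψ (k + 1) = eulerStep a h (ψ k) := by
          simp only [hψ, Function.iterate_succ_apply']
        rw [e, pow_succ', mul_assoc]
        exact h1.trans (mul_le_mul_of_nonneg_left ih (by linarith))
    have hq0 : 0 ≤ 1 - l * h := by linarith
    have hq1 : 1 - l * h ≤ 1 := by have := mul_nonneg hl hh0; linarith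
    have hqe : ∀ k : ℕ, (1 - l * h) ^ k ≤ Real.exp (-l * (k * h)) := by
      intro k
      calc (1 - l * h) ^ k ≤ Real.exp (-l * h) ^ k := by
            gcongr
            have := Real.add_one_le_exp (-l * h); linarith
        _ = _ := by rw [← Real.exp_nat_mul]; congr 1; ring
    have hind : ∀ k : ℕ, k ≤ n → ‖v t φ‖ ≤ ‖v (t - k * h) (ψ k)‖ +
        Real.exp (l * h) * (∫ s in (t - k * h)..t, Real.exp (-l * (t - s)) * β s) * lpn p φ +
        k * (h ^ 2 * C) + h * (K * lpn p φ) * ∫ s in (t - k * h)..t, β s := by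
      intro k
      induction k with
      | zero => intro _; simp [hψ]
      | succ k ih =>
        intro hk
        have h1 := ih (by omega)
        set y := t - k * h with hy
        set x := t - (k + 1 : ℕ) * h with hx
        have hyx : y - x = h := by rw [hx, hy]; push_cast; ring
        have hxy : x ≤ y := by linarith
        have hx0 : 0 ≤ x := by
          rw [hx, sub_nonneg, ← hnh]
          gcongr
        have hyt : y ≤ t := by
          rw [hy]; have : 0 ≤ (k : ℝ) * h := by positivity
          linarith
        have h2 := norm_le_euler_step hYa hK hβi hβ hvi hweak hx0 hxy (hyt.trans ht.2) (hψY k)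
          hβ0 (C := C) (fun s hs => hC ⟨s, hs⟩ n k (by omega))
        rw [hyx] at h2
        have e : eulerStep a h (ψ k) = ψ (k + 1) := by
          simp only [hψ, Function.iterate_succ_apply']
        rw [e] at h2
        have hlk : lpn p (ψ k) ≤ lpn p φ := by
          refine (hψl k).trans (mul_le_of_le_one_left hL (pow_le_one₀ hq0 hq1))
        have hIn : 0 ≤ ∫ s in x..y, β s := intervalIntegral.integral_nonneg hxy fun s _ => hβ0 s
        have h3 : (∫ s in x..y, β s) * lpn p (ψ k) ≤
            Real.exp (l * h) * (∫ s in x..y, Real.exp (-l * (t - s)) * β s) * lpn p φ := by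
          have h4 : (∫ s in x..y, Real.exp (-l * (k * h)) * β s) ≤
              ∫ s in x..y, Real.exp (l * h) * (Real.exp (-l * (t - s)) * β s) := by
            refine intervalIntegral.integral_mono_on hxy
              ((hbi x y hx0 hxy (hyt.trans ht.2)).const_mul _)
              ((hei x y hx0 hxy (hyt.trans ht.2)).const_mul _) fun s hs => ?_
            rw [← mul_assoc (Real.exp (l * h)), ← Real.exp_add]
            refine mul_le_mul_of_nonneg_right (Real.exp_le_exp.2 ?_) (hβ0 s)
            have h5 : t - s ≤ (k + 1) * h := by
              have := hs.1; rw [hx] at this; push_cast at this; linarith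
            have := mul_le_mul_of_nonneg_left h5 hl
            linarith
          rw [intervalIntegral.integral_const_mul, intervalIntegral.integral_const_mul] at h4
          calc _ ≤ (∫ s in x..y, β s) * ((1 - l * h) ^ k * lpn p φ) := by gcongr; exact hψl k
            _ ≤ (∫ s in x..y, β s) * (Real.exp (-l * (k * h)) * lpn p φ) := by
                gcongr; exact hqe k
            _ = (Real.exp (-l * (k * h)) * ∫ s in x..y, β s) * lpn p φ := by ring
            _ ≤ _ := mul_le_mul_of_nonneg_right h4 hL
        have h6 : h * (K * lpn p (ψ k)) * (∫ s in x..y, β s) ≤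
            h * (K * lpn p φ) * ∫ s in x..y, β s := by gcongr
        rw [← intervalIntegral.integral_add_adjacent_intervals
            (hei x y hx0 hxy (hyt.trans ht.2)) (hei y t (hx0.trans hxy) hyt ht.2),
          ← intervalIntegral.integral_add_adjacent_intervals
            (hbi x y hx0 hxy (hyt.trans ht.2)) (hbi y t (hx0.trans hxy) hyt ht.2)]
        push_cast
        linarith
    have h1 := hind n le_rfl
    rw [hnh, sub_self] at h1
    have h2 : ‖v 0 (ψ n)‖ ≤ Real.exp (-l * t) * m * lpn p φ := by
      refine (hm _ (hψY n)).trans ?_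
      have h3 := hqe n
      rw [hnh] at h3
      calc _ ≤ m * ((1 - l * h) ^ n * lpn p φ) := by gcongr; exact hψl n
        _ ≤ m * (Real.exp (-l * t) * lpn p φ) := by gcongr
        _ = _ := by ring
    refine h1.trans ?_
    have e : n * (h ^ 2 * C) = h * (t * C) := by rw [← hnh]; ring
    rw [e]
    have : h * (t * C + K * lpn p φ * I) = h * (t * C) + h * (K * lpn p φ) * I := by ring
    rw [this]
    linarith
  have hlim : Tendsto (fun n : ℕ => t / n) atTop (𝓝 0) := tendsto_const_div_atTop_nhds_zero_nat t
  have hlim2 : Tendsto (fun n : ℕ => Real.exp (-l * t) * m * lpn p φ +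
      Real.exp (l * (t / n)) * J * lpn p φ + t / n * (t * C + K * lpn p φ * I)) atTop
      (𝓝 (Real.exp (-l * t) * m * lpn p φ + Real.exp (l * 0) * J * lpn p φ +
        0 * (t * C + K * lpn p φ * I))) := by
    refine Tendsto.add (Tendsto.const_add _ ?_) (hlim.mul_const _)
    exact ((((Real.continuous_exp.tendsto _).comp (hlim.const_mul l))).mul_const J).mul_const _
  have e : (Real.exp (-l * t) * m + J) * lpn p φ = Real.exp (-l * t) * m * lpn p φ +
      Real.exp (l * 0) * J * lpn p φ + 0 * (t * C + K * lpn p φ * I) := by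
    rw [mul_zero, Real.exp_zero]; ring
  rw [e]
  refine ge_of_tendsto hlim2 ?_
  have h1 : ∀ᶠ n : ℕ in atTop, t / n ≤ ε₀ := (hlim.eventually (gt_mem_nhds hε₀)).mono fun n hn => hn.le
  have h2 : ∀ᶠ n : ℕ in atTop, l * (t / n) ≤ 1 := by
    have : Tendsto (fun n : ℕ => l * (t / n)) atTop (𝓝 (l * 0)) := hlim.const_mul l
    rw [mul_zero] at this
    exact (this.eventually (gt_mem_nhds one_pos)).mono fun n hn => hn.le
  filter_upwards [h1, h2, eventually_gt_atTop 0] with n h1 h2 h3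
  exact hscheme n h3 h1 h2

end

section

variable {d : ℕ}

theorem fourier_smulLeft_fourierInv {g : Eu d → ℂ} (hg : g.HasTemperateGrowth)
    (he : ∀ ξ, g (-ξ) = g ξ) (φ : 𝓢(Eu d, ℂ)) :
    𝓕 (SchwartzMap.smulLeftCLM ℂ g (𝓕⁻ φ)) = mult g φ := by
  ext x
  have h1 : mult g φ = 𝓕⁻ (SchwartzMap.smulLeftCLM ℂ g (𝓕 φ)) := by
    rw [← fourier_mult_eq hg, FourierTransform.fourierInv_fourier_eq]
  rw [h1, SchwartzMap.fourier_coe, SchwartzMap.fourierInv_coe, Real.fourier_eq',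
    Real.fourierInv_eq', ← integral_neg_eq_self]
  congr 1; ext ξ
  have h2 : 𝓕⁻ φ (-ξ) = 𝓕 φ ξ := by
    rw [SchwartzMap.fourierInv_coe, SchwartzMap.fourier_coe, Real.fourierInv_eq_fourier_neg, neg_neg]
  rw [SchwartzMap.smulLeftCLM_apply_apply hg, SchwartzMap.smulLeftCLM_apply_apply hg, h2, he]
  simp

/-- The symbols of the dyadic blocks, for the Fourier transform of Mathlib. -/
def bsym (χ : Eu d → ℝ) (n : ℕ) (ξ : Eu d) : ℂ :=
  ((blockSymbol χ n ((2 * Real.pi) • ξ) : ℝ) : ℂ)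

theorem bsym_zero (χ : Eu d → ℝ) (ξ : Eu d) : bsym χ 0 ξ = ((χ ((2 * Real.pi) • ξ) : ℝ) : ℂ) := rfl

theorem bsym_succ (χ : Eu d → ℝ) (j : ℕ) (ξ : Eu d) : bsym χ (j + 1) ξ =
    ((χ ((2 * Real.pi / 2 ^ j) • ξ) : ℝ) : ℂ) - ((χ ((4 * Real.pi / 2 ^ j) • ξ) : ℝ) : ℂ) := by
  simp only [bsym, blockSymbol, smul_smul, Complex.ofReal_sub]
  congr 4 <;> ring_nf

theorem two_pi_div_ne (j : ℕ) : (2 * Real.pi / 2 ^ j : ℝ) ≠ 0 := by positivity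

theorem four_pi_div_ne (j : ℕ) : (4 * Real.pi / 2 ^ j : ℝ) ≠ 0 := by positivity

theorem IsLPCutoff.contDiff_bsym {χ : Eu d → ℝ} (hχ : IsLPCutoff χ) (n : ℕ) :
    ContDiff ℝ ((⊤ : ℕ∞) : WithTop ℕ∞) (bsym χ n) := by
  cases n with
  | zero => exact contDiff_dilate hχ.contDiff _
  | succ j =>
    have : bsym χ (j + 1) = _ := funext (bsym_succ χ j)
    rw [this]
    exact (contDiff_dilate hχ.contDiff _).sub (contDiff_dilate hχ.contDiff _)

theorem IsLPCutoff.hasCompactSupport_bsym {χ : Eu d → ℝ} (hχ : IsLPCutoff χ) (n : ℕ) :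
    HasCompactSupport (bsym χ n) := by
  cases n with
  | zero => exact hasCompactSupport_dilate hχ.hasCompactSupport (by positivity)
  | succ j =>
    have : bsym χ (j + 1) = _ := funext (bsym_succ χ j)
    rw [this]
    exact (hasCompactSupport_dilate hχ.hasCompactSupport (two_pi_div_ne j)).sub
      (hasCompactSupport_dilate hχ.hasCompactSupport (four_pi_div_ne j))

theorem IsLPCutoff.hasTemperateGrowth_bsym {χ : Eu d → ℝ} (hχ : IsLPCutoff χ) (n : ℕ) :
    (bsym χ n).HasTemperateGrowth :=
  (hχ.hasCompactSupport_bsym n).hasTemperateGrowth (hχ.contDiff_bsym n)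

theorem IsLPCutoff.bsym_neg {χ : Eu d → ℝ} (hχ : IsLPCutoff χ) (n : ℕ) (ξ : Eu d) :
    bsym χ n (-ξ) = bsym χ n ξ := by
  have h : ∀ c : ℝ, χ (c • -ξ) = χ (c • ξ) := fun c => hχ.radial _ _ (by simp)
  cases n with
  | zero => rw [bsym_zero, bsym_zero, h]
  | succ j => rw [bsym_succ, bsym_succ, h, h]

theorem IsLPCutoff.block_apply {χ : Eu d → ℝ} (hχ : IsLPCutoff χ) (n : ℕ) (v : 𝓢'(Eu d, ℂ))
    (φ : 𝓢(Eu d, ℂ)) : block χ n v φ = v (mult (bsym χ n) φ) := by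
  rw [← fourier_smulLeft_fourierInv (hχ.hasTemperateGrowth_bsym n) (hχ.bsym_neg n)]
  rfl

/-- Schwartz functions with frequencies in the annulus `r ≤ |ξ| ≤ R`. -/
def band (r R : ℝ) : Submodule ℂ 𝓢(Eu d, ℂ) where
  carrier := {φ | ∀ ξ, 𝓕 φ ξ ≠ 0 → r ≤ ‖ξ‖ ∧ ‖ξ‖ ≤ R}
  zero_mem' := by
    intro ξ hξ
    exact absurd (by simp) hξ
  add_mem' := by
    intro φ ψ hφ hψ ξ hξ
    rw [FourierTransform.fourier_add, _root_.add_apply] at hξ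
    by_cases h : 𝓕 φ ξ = 0
    · exact hψ ξ fun h' => hξ (by rw [h, h', add_zero])
    · exact hφ ξ h
  smul_mem' := by
    intro c φ hφ ξ hξ
    rw [FourierTransform.fourier_smul, _root_.smul_apply] at hξ
    exact hφ ξ fun h => hξ (by rw [h, smul_zero])

theorem mult_mem_band {a : Eu d → ℂ} (ha : a.HasTemperateGrowth) {r R : ℝ} {φ : 𝓢(Eu d, ℂ)}
    (hφ : φ ∈ band r R) : mult a φ ∈ band r R := fun ξ hξ => by
  rw [fourier_mult ha] at hξ
  exact hφ ξ (right_ne_zero_of_mul hξ)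

/-- A smooth cutoff that equals `1` on an annulus and vanishes near the origin. -/
theorem IsLPCutoff.exists_annulus {χ : Eu d → ℝ} (hχ : IsLPCutoff χ) {r R : ℝ} (hr : 0 < r)
    (hR : r ≤ R) : ∃ κ : Eu d → ℂ, ContDiff ℝ ((⊤ : ℕ∞) : WithTop ℕ∞) κ ∧ HasCompactSupport κ ∧
      (∀ᶠ ξ in 𝓝 0, κ ξ = 0) ∧ ∀ ξ, r ≤ ‖ξ‖ → ‖ξ‖ ≤ R → κ ξ = 1 := by
  have hR0 : 0 < R := hr.trans_le hR
  refine ⟨fun ξ => ((χ (R⁻¹ • ξ) : ℝ) : ℂ) - ((χ ((2 / r) • ξ) : ℝ) : ℂ),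
    (contDiff_dilate hχ.contDiff _).sub (contDiff_dilate hχ.contDiff _),
    (hasCompactSupport_dilate hχ.hasCompactSupport (by positivity)).sub
      (hasCompactSupport_dilate hχ.hasCompactSupport (by positivity)), ?_, fun ξ h1 h2 => ?_⟩
  · filter_upwards [Metric.ball_mem_nhds (0 : Eu d) (half_pos hr)] with ξ hξ
    have hξ' : ‖ξ‖ < r / 2 := by simpa using hξ
    rw [hχ.eq_one, hχ.eq_one, sub_self]
    · rw [norm_smul, Real.norm_of_nonneg (by positivity)]
      calc 2 / r * ‖ξ‖ ≤ 2 / r * (r / 2) := by gcongr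
        _ = 1 := by field_simp
    · rw [norm_smul, Real.norm_of_nonneg (by positivity)]
      calc R⁻¹ * ‖ξ‖ ≤ R⁻¹ * R := by gcongr; linarith
        _ = 1 := by field_simp
  · show ((χ (R⁻¹ • ξ) : ℝ) : ℂ) - ((χ ((2 / r) • ξ) : ℝ) : ℂ) = 1
    rw [hχ.eq_one, hχ.eq_zero]
    · simp
    · rw [norm_smul, Real.norm_of_nonneg (by positivity)]
      calc (3 : ℝ) / 2 < 2 / r * r := by rw [div_mul_cancel₀ _ hr.ne']; norm_num
        _ ≤ _ := by gcongr
    · rw [norm_smul, Real.norm_of_nonneg (by positivity)]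
      calc R⁻¹ * ‖ξ‖ ≤ R⁻¹ * R := by gcongr
        _ = 1 := by field_simp

section Weak

variable {α T : ℝ} {u₀ : 𝓢'(Eu d, ℂ)} {u f : ℝ → 𝓢'(Eu d, ℂ)}

theorem IsWeakSolution.apply_zero (hw : IsWeakSolution α T u₀ u f) (hT : 0 ≤ T) (φ : 𝓢(Eu d, ℂ)) :
    u 0 φ = u₀ φ := by
  obtain ⟨-, w, -, -, h⟩ := hw φ
  simpa using h 0 ⟨le_rfl, hT⟩

theorem IsWeakSolution.exists_bound (hw : IsWeakSolution α T u₀ u f)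
    (φ : 𝓢(Eu d, ℂ)) : ∃ C, ∀ t ∈ Set.Icc 0 T, ‖u t φ‖ ≤ C := by
  obtain ⟨hf, w, -, hwi, h⟩ := hw φ
  refine ⟨‖u₀ φ‖ + (∫ s in 0..T, ‖w s‖) + ∫ s in 0..T, ‖f s φ‖, fun t ht => ?_⟩
  have hT : 0 ≤ T := ht.1.trans ht.2
  have hb : ∀ g : ℝ → ℂ, IntervalIntegrable g volume 0 T →
      ‖∫ s in 0..t, g s‖ ≤ ∫ s in 0..T, ‖g s‖ := fun g hg =>
    (intervalIntegral.norm_integral_le_integral_norm ht.1).trans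
      (intervalIntegral.integral_mono_interval le_rfl ht.1 ht.2
        (Eventually.of_forall fun s => norm_nonneg _) hg.norm)
  rw [h t ht]
  exact (norm_add_le _ _).trans (add_le_add ((norm_add_le _ _).trans
    (add_le_add le_rfl (hb _ hwi))) (hb _ hf))

theorem IsWeakSolution.eq_add (hw : IsWeakSolution α T u₀ u f) (hT : 0 ≤ T) {φ ψ : 𝓢(Eu d, ℂ)}
    (hψ : ∀ x, fracLaplacian α φ x = ψ x) :
    IntervalIntegrable (fun s => u s ψ) volume 0 T ∧
    ∀ x ∈ Set.Icc 0 T, ∀ y ∈ Set.Icc 0 T, u y φ = u x φ +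
      (∫ s in x..y, u s ψ) + ∫ s in x..y, f s φ := by
  obtain ⟨hf, w, hwp, hwi, h⟩ := hw φ
  have hψ' : fracLaplacian α φ = ψ := funext hψ
  have hwe : ∀ᵐ s ∂(volume.restrict (Set.Icc 0 T)), w s = u s ψ := by
    filter_upwards [hwp] with s hs
    rw [hψ'] at hs
    exact hs.eq_apply
  have hcong : ∀ t ∈ Set.Icc 0 T, (∫ s in 0..t, w s) = ∫ s in 0..t, u s ψ := fun t ht => by
    refine intervalIntegral.integral_congr_ae ?_
    rw [ae_restrict_iff' measurableSet_Icc] at hwe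
    filter_upwards [hwe] with s hs hs'
    rw [Set.uIoc_of_le ht.1] at hs'
    exact hs ⟨hs'.1.le, hs'.2.trans ht.2⟩
  have hui : IntervalIntegrable (fun s => u s ψ) volume 0 T := by
    refine hwi.congr_ae ?_
    rw [Set.uIoc_of_le hT]
    exact ae_restrict_of_ae_restrict_of_subset Set.Ioc_subset_Icc_self hwe
  refine ⟨hui, fun x hx y hy => ?_⟩
  have hsub : ∀ g : ℝ → ℂ, IntervalIntegrable g volume 0 T → ∀ t ∈ Set.Icc 0 T,
      IntervalIntegrable g volume 0 t := fun g hg t ht => hg.mono_set (by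
    rw [Set.uIcc_of_le ht.1, Set.uIcc_of_le (ht.1.trans ht.2)]
    exact Set.Icc_subset_Icc le_rfl ht.2)
  rw [h y hy, h x hx, hcong x hx, hcong y hy,
    ← intervalIntegral.integral_interval_sub_left (hsub _ hui y hy) (hsub _ hui x hx),
    ← intervalIntegral.integral_interval_sub_left (hsub _ hf y hy) (hsub _ hf x hx)]
  ring

end Weak

/-- The blocks of a weak solution decay on functions of high frequency. -/
theorem exists_block_decay (hd : 1 ≤ d) {χ : Eu d → ℝ} (hχ : IsLPCutoff χ) {α : ℝ}
    (hα : α ∈ Set.Ioo (0 : ℝ) 2) : ∃ l₀ : ℝ, 0 < l₀ ∧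
    ∀ {T : ℝ} {u₀ : 𝓢'(Eu d, ℂ)} {u f : ℝ → 𝓢'(Eu d, ℂ)}, 0 ≤ T → IsWeakSolution α T u₀ u f →
    ∀ (n : ℕ) {r R l : ℝ}, 0 < r → r ≤ R → 0 ≤ l → l < l₀ * r ^ α → ∀ {p : ℝ≥0∞} [Fact (1 ≤ p)]
      {β : ℝ → ℝ}, (∀ s, 0 ≤ β s) → IntervalIntegrable β volume 0 T →
      (∀ ψ ∈ band r R, ∀ᵐ s, s ∈ Set.Ioc 0 T → ‖block χ n (f s) ψ‖ ≤ β s * lpn p ψ) →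
      ∀ {m : ℝ}, 0 ≤ m → (∀ ψ ∈ band r R, ‖block χ n u₀ ψ‖ ≤ m * lpn p ψ) →
      ∀ {t : ℝ}, t ∈ Set.Icc 0 T → ∀ {φ : 𝓢(Eu d, ℂ)}, φ ∈ band r R →
        ‖block χ n (u t) φ‖ ≤
          (Real.exp (-l * t) * m + ∫ s in 0..t, Real.exp (-l * (t - s)) * β s) * lpn p φ := by
  obtain ⟨l₀, hl₀, H⟩ := exists_dissipative hd hχ hα
  refine ⟨l₀, hl₀, ?_⟩
  intro T u₀ u f hT hw n r R l hr hrR hl hll p _ β hβ0 hβi hβ m hm0 hm t ht φ hφ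
  obtain ⟨κ, hκ, hκs, hκ0, hκ1⟩ := hχ.exists_annulus hr hrR
  set κS : 𝓢(Eu d, ℂ) := hκs.toSchwartzMap hκ
  obtain ⟨ε₀, hε₀, hdiss⟩ := H r hr κS l hll
  set a : Eu d → ℂ := fun ξ => -((levySymbol α ξ : ℝ) : ℂ) * κ ξ with ha
  have hac : ContDiff ℝ ((⊤ : ℕ∞) : WithTop ℕ∞) a := contDiff_levySymbol_mul hd hα.1 hκ hκ0
  have has : HasCompactSupport a := hκs.mul_left
  have hag : a.HasTemperateGrowth := has.hasTemperateGrowth hac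
  have hbg := hχ.hasTemperateGrowth_bsym n
  have hfl : ∀ ψ ∈ band r R, ∀ x, fracLaplacian α ψ x = mult a ψ x := fun ψ hψ x =>
    fracLaplacian_eq_mult hd hα hκ hκs hκ0 (fun ξ hξ => hκ1 ξ (hψ ξ hξ).1 (hψ ξ hξ).2) x
  have hweak : ∀ ψ ∈ band r R, IntervalIntegrable (fun s => block χ n (u s) (mult a ψ)) volume 0 T ∧
      ∀ x ∈ Set.Icc 0 T, ∀ y ∈ Set.Icc 0 T, block χ n (u y) ψ = block χ n (u x) ψ +
      (∫ s in x..y, block χ n (u s) (mult a ψ)) + ∫ s in x..y, block χ n (f s) ψ := by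
    intro ψ hψ
    simp only [hχ.block_apply, mult_comm hbg hag]
    exact hw.eq_add hT (hfl _ (mult_mem_band hbg hψ))
  refine norm_le_duhamel (v := fun s => block χ n (u s)) (f := fun s => block χ n (f s)) hac has
    (Y := band r R) (fun ψ hψ => mult_mem_band hag hψ)
    (K := kernelNorm (has.toSchwartzMap hac)) (fun ψ _ => lpn_mult_le p (has.toSchwartzMap hac) ψ)
    (kernelNorm_nonneg _) hl hε₀ ?_ hβ0 hβi hβ ?_ (fun ψ hψ => (hweak ψ hψ).1)
    (fun ψ hψ => (hweak ψ hψ).2) hm0 ?_ ht hφ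
  · intro ε hε hε' ψ hψ
    refine hdiss ε hε hε' p ψ _ (fun ξ hξ => (hψ ξ hξ).1) ?_ fun x => ?_
    · refine schwartz_ext_fourier fun ξ => ?_
      rw [fourier_mult κS.hasTemperateGrowth]
      by_cases h : 𝓕 ψ ξ = 0
      · rw [h, mul_zero]
      · show κ ξ * _ = _
        rw [hκ1 ξ (hψ ξ h).1 (hψ ξ h).2, one_mul]
    · rw [hfl ψ hψ]; rfl
  · intro ψ
    simp only [hχ.block_apply]
    exact hw.exists_bound _
  · intro ψ hψ
    rw [hχ.block_apply, hw.apply_zero hT, ← hχ.block_apply]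
    exact hm ψ hψ

end

section

variable {d : ℕ}

theorem kernelNorm_dilate {f g : 𝓢(Eu d, ℂ)} {c : ℝ} (hc : 0 < c) (h : ∀ ξ, g ξ = f (c • ξ)) :
    kernelNorm g = kernelNorm f := by
  simp only [kernelNorm, fourierInv_dilate hc h, norm_mul, Complex.norm_real]
  rw [integral_const_mul, Measure.integral_comp_smul volume (fun x => ‖𝓕⁻ f x‖) c⁻¹,
    finrank_euclideanSpace_fin, Real.norm_of_nonneg (by positivity),
    abs_of_nonneg (by positivity), smul_eq_mul, ← mul_assoc]
  simp [hc.ne']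

/-- A fattened dyadic symbol, equal to `1` on the support of the block `j + 1`. -/
def IsLPCutoff.fat {χ : Eu d → ℝ} (hχ : IsLPCutoff χ) (j : ℕ) : 𝓢(Eu d, ℂ) :=
  hχ.symbol (Real.pi / 2 ^ j) (by positivity) - hχ.symbol (8 * Real.pi / 2 ^ j) (by positivity)

theorem IsLPCutoff.fat_apply {χ : Eu d → ℝ} (hχ : IsLPCutoff χ) (j : ℕ) (ξ : Eu d) :
    hχ.fat j ξ = ((χ ((Real.pi / 2 ^ j) • ξ) : ℝ) : ℂ) -
      ((χ ((8 * Real.pi / 2 ^ j) • ξ) : ℝ) : ℂ) := rfl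

theorem IsLPCutoff.kernelNorm_fat {χ : Eu d → ℝ} (hχ : IsLPCutoff χ) (j : ℕ) :
    kernelNorm (hχ.fat j) = kernelNorm (hχ.fat 0) := by
  refine kernelNorm_dilate (c := (2 ^ j)⁻¹) (by positivity) fun ξ => ?_
  rw [hχ.fat_apply, hχ.fat_apply, smul_smul, smul_smul]
  congr 4 <;> simp [div_eq_mul_inv]

theorem IsLPCutoff.bsym_mul_fat {χ : Eu d → ℝ} (hχ : IsLPCutoff χ) (j : ℕ) (ξ : Eu d) :
    bsym χ (j + 1) ξ * hχ.fat j ξ = bsym χ (j + 1) ξ := by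
  have hj : (0 : ℝ) < 2 ^ j := by positivity
  have hn : ∀ c : ℝ, 0 ≤ c → ‖c • ξ‖ = c * ‖ξ‖ := fun c hc => by
    rw [norm_smul, Real.norm_of_nonneg hc]
  have hp := Real.pi_pos
  have e1 := hn (2 * Real.pi / 2 ^ j) (by positivity)
  have e2 := hn (4 * Real.pi / 2 ^ j) (by positivity)
  have e3 := hn (Real.pi / 2 ^ j) (by positivity)
  have e4 := hn (8 * Real.pi / 2 ^ j) (by positivity)
  set y := Real.pi / 2 ^ j * ‖ξ‖ with hy
  have f1 : 2 * Real.pi / 2 ^ j * ‖ξ‖ = 2 * y := by rw [hy]; ring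
  have f2 : 4 * Real.pi / 2 ^ j * ‖ξ‖ = 4 * y := by rw [hy]; ring
  have f4 : 8 * Real.pi / 2 ^ j * ‖ξ‖ = 8 * y := by rw [hy]; ring
  rw [f1] at e1; rw [f2] at e2; rw [f4] at e4
  rw [bsym_succ, hχ.fat_apply]
  rcases lt_or_ge 1 y with h | h
  · rw [hχ.eq_zero ((2 * Real.pi / 2 ^ j) • ξ) (by rw [e1]; linarith),
      hχ.eq_zero ((4 * Real.pi / 2 ^ j) • ξ) (by rw [e2]; linarith)]
    simp
  · rw [hχ.eq_one ((Real.pi / 2 ^ j) • ξ) (by rw [e3]; linarith)]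
    rcases le_or_gt y (1 / 4) with h' | h'
    · rw [hχ.eq_one ((2 * Real.pi / 2 ^ j) • ξ) (by rw [e1]; linarith),
        hχ.eq_one ((4 * Real.pi / 2 ^ j) • ξ) (by rw [e2]; linarith)]
      simp
    · rw [hχ.eq_zero ((8 * Real.pi / 2 ^ j) • ξ) (by rw [e4]; linarith)]
      simp

theorem IsLPCutoff.mult_fat_mem_band {χ : Eu d → ℝ} (hχ : IsLPCutoff χ) (j : ℕ) (φ : 𝓢(Eu d, ℂ)) :
    mult (hχ.fat j : Eu d → ℂ) φ ∈ band (2 ^ j / (8 * Real.pi)) (2 * 2 ^ j / Real.pi) := by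
  intro ξ hξ
  rw [fourier_mult (hχ.fat j).hasTemperateGrowth] at hξ
  have h := left_ne_zero_of_mul hξ
  have hj : (0 : ℝ) < 2 ^ j := by positivity
  have hp := Real.pi_pos
  have hn : ∀ c : ℝ, 0 ≤ c → ‖c • ξ‖ = c * ‖ξ‖ := fun c hc => by
    rw [norm_smul, Real.norm_of_nonneg hc]
  have e3 := hn (Real.pi / 2 ^ j) (by positivity)
  have e4 := hn (8 * Real.pi / 2 ^ j) (by positivity)
  rw [hχ.fat_apply] at h
  constructor
  · by_contra hlt
    push Not at hlt
    have h1 : 8 * Real.pi / 2 ^ j * ‖ξ‖ ≤ 1 := by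
      calc _ ≤ 8 * Real.pi / 2 ^ j * (2 ^ j / (8 * Real.pi)) := by gcongr
        _ = 1 := by field_simp
    have h2 : Real.pi / 2 ^ j * ‖ξ‖ ≤ 8 * Real.pi / 2 ^ j * ‖ξ‖ := by
      gcongr; linarith
    rw [hχ.eq_one _ (by rw [e3]; linarith), hχ.eq_one _ (by rw [e4]; linarith), sub_self] at h
    exact h rfl
  · by_contra hlt
    push Not at hlt
    have h1 : 2 < Real.pi / 2 ^ j * ‖ξ‖ := by
      calc (2 : ℝ) = Real.pi / 2 ^ j * (2 * 2 ^ j / Real.pi) := by field_simp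
        _ < _ := by gcongr
    have h2 : Real.pi / 2 ^ j * ‖ξ‖ ≤ 8 * Real.pi / 2 ^ j * ‖ξ‖ := by
      gcongr; linarith
    rw [hχ.eq_zero _ (by rw [e3]; linarith), hχ.eq_zero _ (by rw [e4]; linarith), sub_self] at h
    exact h rfl

/-- Decay of the high frequency blocks of a weak solution. -/
theorem exists_highBlock_bound (hd : 1 ≤ d) {χ : Eu d → ℝ} (hχ : IsLPCutoff χ) {α : ℝ}
    (hα : α ∈ Set.Ioo (0 : ℝ) 2) : ∃ C l₁ : ℝ, 0 < C ∧ 0 < l₁ ∧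
    ∀ {T : ℝ} {u₀ : 𝓢'(Eu d, ℂ)} {u f : ℝ → 𝓢'(Eu d, ℂ)}, 0 ≤ T → IsWeakSolution α T u₀ u f →
    ∀ (j : ℕ) {p p' : ℝ≥0∞} [Fact (1 ≤ p)] [Fact (1 ≤ p')] [p.HolderConjugate p']
      {β : ℝ → ℝ}, (∀ s, 0 ≤ β s) → IntervalIntegrable β volume 0 T →
      (∀ ψ, ∀ᵐ s, s ∈ Set.Ioc 0 T → ‖block χ (j + 1) (f s) ψ‖ ≤ β s * lpn p' ψ) →
      ∀ {m : ℝ}, 0 ≤ m → (∀ ψ, ‖block χ (j + 1) u₀ ψ‖ ≤ m * lpn p' ψ) →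
      ∀ {t : ℝ}, t ∈ Set.Icc 0 T → distLpNorm p (block χ (j + 1) (u t)) ≤ ENNReal.ofReal
        (C * (Real.exp (-(l₁ * (2 ^ j) ^ α) * t) * m +
          ∫ s in 0..t, Real.exp (-(l₁ * (2 ^ j) ^ α) * (t - s)) * β s)) := by
  obtain ⟨l₀, hl₀, H⟩ := exists_block_decay hd hχ hα
  have hp := Real.pi_pos
  refine ⟨kernelNorm (hχ.fat 0) + 1, l₀ * (1 / (8 * Real.pi)) ^ α / 2,
    by have := kernelNorm_nonneg (hχ.fat 0); linarith, by positivity, ?_⟩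
  intro T u₀ u f hT hw j p p' _ _ _ β hβ0 hβi hβ m hm0 hm t ht
  set l := l₀ * (1 / (8 * Real.pi)) ^ α / 2 * (2 ^ j) ^ α with hl
  have hj : (0 : ℝ) < 2 ^ j := by positivity
  have hl' : l < l₀ * (2 ^ j / (8 * Real.pi)) ^ α := by
    have e : (2 ^ j / (8 * Real.pi) : ℝ) = 1 / (8 * Real.pi) * 2 ^ j := by ring
    rw [e, Real.mul_rpow (by positivity) hj.le, hl]
    have : 0 < l₀ * ((1 / (8 * Real.pi)) ^ α * (2 ^ j : ℝ) ^ α) := by positivity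
    linarith
  have h := fun φ => H hT hw (j + 1) (r := 2 ^ j / (8 * Real.pi)) (R := 2 * 2 ^ j / Real.pi) (l := l)
    (by positivity) (by
      rw [div_le_div_iff₀ (by positivity) hp]; nlinarith) (by positivity) hl' (p := p') hβ0 hβi
    (fun ψ _ => hβ ψ) hm0 (fun ψ _ => hm ψ) ht (hχ.mult_fat_mem_band j φ)
  set D := Real.exp (-l * t) * m + ∫ s in 0..t, Real.exp (-l * (t - s)) * β s with hD
  have hD0 : 0 ≤ D := add_nonneg (by positivity) (intervalIntegral.integral_nonneg ht.1 fun s _ =>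
    mul_nonneg (Real.exp_nonneg _) (hβ0 s))
  have hrep : ∀ φ, block χ (j + 1) (u t) (mult (hχ.fat j : Eu d → ℂ) φ) =
      block χ (j + 1) (u t) φ := fun φ => by
    rw [hχ.block_apply, hχ.block_apply]
    congr 1
    refine schwartz_ext_fourier fun ξ => ?_
    rw [fourier_mult (hχ.hasTemperateGrowth_bsym _), fourier_mult (hχ.hasTemperateGrowth_bsym _),
      fourier_mult (hχ.fat j).hasTemperateGrowth, ← mul_assoc, hχ.bsym_mul_fat]
  have hk := kernelNorm_nonneg (hχ.fat 0)
  refine distLpNorm_le_of_forall (p' := p') (mul_nonneg (by linarith) hD0) (fun φ => ?_)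
    (hχ.fat j) hrep
  rw [← hrep]
  calc _ ≤ D * lpn p' (mult (hχ.fat j : Eu d → ℂ) φ) := h φ
    _ ≤ D * (kernelNorm (hχ.fat 0) * lpn p' φ) := by
        rw [← hχ.kernelNorm_fat j]; gcongr; exact lpn_mult_le _ _ _
    _ ≤ D * ((kernelNorm (hχ.fat 0) + 1) * lpn p' φ) := by
        have := lpn_nonneg p' φ
        gcongr; linarith
    _ = _ := by ring

end

section

variable {d : ℕ}

/-- A Schwartz function whose derivatives up to order `N` vanish at the origin is small there. -/
theorem norm_iteratedFDeriv_le_of_jet {Θ : 𝓢(Eu d, ℂ)} {N : ℕ}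
    (h : ∀ i ≤ N, iteratedFDeriv ℝ i Θ 0 = 0) :
    ∀ j i : ℕ, i + j = N + 1 → ∀ ξ, ‖iteratedFDeriv ℝ i Θ ξ‖ ≤
      SchwartzMap.seminorm ℂ 0 (N + 1) Θ * ‖ξ‖ ^ j := by
  intro j
  induction j with
  | zero =>
    intro i hi ξ
    have := SchwartzMap.le_seminorm ℂ 0 i Θ ξ
    rw [add_zero] at hi
    simpa [hi] using this
  | succ j ih =>
    intro i hi ξ
    have h1 := (convex_closedBall (0 : Eu d) ‖ξ‖).norm_image_sub_le_of_norm_fderiv_le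
      (f := iteratedFDeriv ℝ i Θ) (C := SchwartzMap.seminorm ℂ 0 (N + 1) Θ * ‖ξ‖ ^ j)
      (x := 0) (y := ξ) (𝕜 := ℝ)
      (fun x _ => (Θ.smooth'.differentiable_iteratedFDeriv (m := i)
        (by exact_mod_cast ENat.natCast_lt_top i)) x)
      (fun x hx => by
        rw [norm_fderiv_iteratedFDeriv]
        refine (ih (i + 1) (by omega) x).trans ?_
        have : ‖x‖ ≤ ‖ξ‖ := by simpa using hx
        gcongr)
      (by simp) (by simp)
    rw [h i (by omega), sub_zero, sub_zero] at h1
    rw [pow_succ, ← mul_assoc]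
    exact h1

theorem tendsto_schNorm_of_jet {b : Eu d → ℂ} (hb : ContDiff ℝ ((⊤ : ℕ∞) : WithTop ℕ∞) b)
    (hs : ∀ ξ, 1 < ‖ξ‖ → b ξ = 0) {Θ : 𝓢(Eu d, ℂ)} {N : ℕ}
    (h : ∀ i ≤ N, iteratedFDeriv ℝ i Θ 0 = 0) :
    Tendsto (fun n : ℕ => schNorm N (SchwartzMap.smulLeftCLM ℂ (fun ξ => b ((2 ^ n : ℝ) • ξ)) Θ))
      atTop (𝓝 0) := by
  have hbs : HasCompactSupport b :=
    HasCompactSupport.intro (isCompact_closedBall 0 1) fun ξ hξ => hs ξ (by simpa using hξ)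
  have hts : tsupport b ⊆ Metric.closedBall 0 1 := closure_minimal (fun ξ hξ => by
    by_contra h'
    exact hξ (hs ξ (by simpa using h'))) Metric.isClosed_closedBall
  obtain ⟨M, hM0, hM⟩ := exists_bound_iteratedFDeriv_of_hasCompactSupport hb hbs N
  set C := SchwartzMap.seminorm ℂ 0 (N + 1) Θ
  have hC0 : 0 ≤ C := apply_nonneg _ _
  have hkey : ∀ n : ℕ, schNorm N (SchwartzMap.smulLeftCLM ℂ (fun ξ => b ((2 ^ n : ℝ) • ξ)) Θ) ≤
      (N + 1) ^ 2 * (2 ^ N * (M * C)) * (1 / 2) ^ n := by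
    intro n
    have hn : (0 : ℝ) < 2 ^ n := by positivity
    have htg : (fun ξ => b ((2 ^ n : ℝ) • ξ)).HasTemperateGrowth :=
      (hasCompactSupport_dilate hbs hn.ne').hasTemperateGrowth (contDiff_dilate hb _)
    rw [mul_assoc]
    refine schNorm_le fun k hk m hm => ?_
    refine SchwartzMap.seminorm_le_bound ℂ k m _ (by positivity) fun ξ => ?_
    have hD : ∀ i, iteratedFDeriv ℝ i (fun ξ => b ((2 ^ n : ℝ) • ξ)) ξ =
        ((2 : ℝ) ^ n) ^ i • iteratedFDeriv ℝ i b ((2 ^ n : ℝ) • ξ) := fun i => by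
      exact congrFun (iteratedFDeriv_comp_const_smul (𝕜 := ℝ) (i := i) ((2 : ℝ) ^ n)
        (hb.of_le (by exact_mod_cast le_top))) ξ
    have hle := norm_iteratedFDeriv_smulLeftCLM_le htg Θ m ξ
    rcases lt_or_ge 1 (2 ^ n * ‖ξ‖) with hξ | hξ
    · have hz : ∀ i, iteratedFDeriv ℝ i b ((2 ^ n : ℝ) • ξ) = 0 := fun i => by
        by_contra h'
        have := hts (support_iteratedFDeriv_subset i h')
        rw [mem_closedBall_zero_iff, norm_smul, Real.norm_of_nonneg hn.le] at this
        linarith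
      have h0 : ‖iteratedFDeriv ℝ m (SchwartzMap.smulLeftCLM ℂ (fun ξ => b ((2 ^ n : ℝ) • ξ)) Θ) ξ‖
          ≤ 0 := by
        refine hle.trans (le_of_eq (Finset.sum_eq_zero fun i _ => ?_))
        rw [hD, hz, smul_zero, norm_zero, mul_zero, zero_mul]
      rw [le_antisymm h0 (norm_nonneg _), mul_zero]
      positivity
    · have hx : ‖ξ‖ ≤ (1 / 2) ^ n := by
        rw [one_div, inv_pow, ← one_div, le_div_iff₀ hn, mul_comm]; exact hξ
      have hx1 : ‖ξ‖ ≤ 1 := hx.trans (pow_le_one₀ (by norm_num) (by norm_num))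
      have hterm : ∀ i ∈ Finset.range (m + 1), (m.choose i : ℝ) *
          ‖iteratedFDeriv ℝ i (fun ξ => b ((2 ^ n : ℝ) • ξ)) ξ‖ * ‖iteratedFDeriv ℝ (m - i) Θ ξ‖ ≤
          (m.choose i : ℝ) * (M * C * (1 / 2) ^ n) := by
        intro i hi
        have hi' : i ≤ m := Nat.lt_succ_iff.1 (Finset.mem_range.1 hi)
        have h1 := norm_iteratedFDeriv_le_of_jet h (N + 1 - (m - i)) (m - i) (by omega) ξ
        rw [hD, norm_smul, norm_pow, norm_pow, Real.norm_ofNat, mul_assoc]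
        refine mul_le_mul_of_nonneg_left ?_ (Nat.cast_nonneg _)
        calc ((2 : ℝ) ^ n) ^ i * ‖iteratedFDeriv ℝ i b ((2 ^ n : ℝ) • ξ)‖ *
              ‖iteratedFDeriv ℝ (m - i) Θ ξ‖
            ≤ ((2 : ℝ) ^ n) ^ i * M * (C * ‖ξ‖ ^ (N + 1 - (m - i))) := by
              gcongr
              exact hM i (hi'.trans hm) _
          _ ≤ ((2 : ℝ) ^ n) ^ i * M * (C * ‖ξ‖ ^ (i + 1)) := by
              gcongr ?_ * (C * ?_)
              exact pow_le_pow_of_le_one (norm_nonneg _) hx1 (by omega)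
          _ = M * C * ((2 ^ n * ‖ξ‖) ^ i * ‖ξ‖) := by ring
          _ ≤ M * C * (1 * (1 / 2) ^ n) := by
              gcongr
              exact pow_le_one₀ (by positivity) hξ
          _ = _ := by ring
      calc _ ≤ 1 * ∑ i ∈ Finset.range (m + 1), (m.choose i : ℝ) * (M * C * (1 / 2) ^ n) := by
            gcongr
            · exact pow_le_one₀ (norm_nonneg _) hx1
            · exact hle.trans (Finset.sum_le_sum hterm)
        _ = 2 ^ m * (M * C * (1 / 2) ^ n) := by
            rw [← Finset.sum_mul, one_mul]
            congr 1
            exact_mod_cast Nat.sum_range_choose m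
        _ ≤ 2 ^ N * (M * C * (1 / 2) ^ n) := by
            gcongr
            norm_num
        _ = _ := by ring
  have hlim : Tendsto (fun n : ℕ => ((N : ℝ) + 1) ^ 2 * (2 ^ N * (M * C)) * (1 / 2 : ℝ) ^ n) atTop
      (𝓝 0) := by
    have := (tendsto_pow_atTop_nhds_zero_of_lt_one (r := (1 / 2 : ℝ)) (by norm_num)
      (by norm_num)).const_mul (((N : ℝ) + 1) ^ 2 * (2 ^ N * (M * C)))
    simpa using this
  exact squeeze_zero (fun n => schNorm_nonneg _ _) hkey hlim

/-- The low frequency symbol at scale `2⁻ⁿ`. -/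
def IsLPCutoff.low {χ : Eu d → ℝ} (hχ : IsLPCutoff χ) (n : ℕ) : 𝓢(Eu d, ℂ) :=
  hχ.symbol (2 * Real.pi * 2 ^ n) (by positivity)

theorem IsLPCutoff.low_apply {χ : Eu d → ℝ} (hχ : IsLPCutoff χ) (n : ℕ) (ξ : Eu d) :
    hχ.low n ξ = ((χ ((2 * Real.pi * 2 ^ n) • ξ) : ℝ) : ℂ) := rfl

theorem IsLPCutoff.kernelNorm_low {χ : Eu d → ℝ} (hχ : IsLPCutoff χ) (n : ℕ) :
    kernelNorm (hχ.low n) = kernelNorm (hχ.low 0) :=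
  kernelNorm_dilate (c := 2 ^ n) (by positivity) fun ξ => by
    rw [hχ.low_apply, hχ.low_apply, smul_smul]; simp

theorem fourier_sub_apply (φ ψ : 𝓢(Eu d, ℂ)) (ξ : Eu d) : 𝓕 (φ - ψ) ξ = 𝓕 φ ξ - 𝓕 ψ ξ := by
  have h := map_sub (FourierTransform.fourierCLM ℂ 𝓢(Eu d, ℂ)) φ ψ
  simp only [FourierTransform.fourierCLM_apply] at h
  rw [h, _root_.sub_apply]

theorem norm_smul_of_nonneg' {c : ℝ} (hc : 0 ≤ c) (ξ : Eu d) : ‖c • ξ‖ = c * ‖ξ‖ := by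
  rw [norm_smul, Real.norm_of_nonneg hc]

/-- Splitting off the lowest frequencies from the low-frequency block. -/
theorem IsLPCutoff.norm_block_zero_le {χ : Eu d → ℝ} (hχ : IsLPCutoff χ) {v : 𝓢'(Eu d, ℂ)}
    {p : ℝ≥0∞} [Fact (1 ≤ p)] {M : ℝ} (hM0 : 0 ≤ M)
    (hM : ∀ r R : ℝ, 0 < r → r ≤ R → ∀ φ ∈ band r R, ‖block χ 0 v φ‖ ≤ M * lpn p φ)
    (ψ : 𝓢(Eu d, ℂ)) {n : ℕ} (hn : 1 ≤ n) :
    ‖block χ 0 v ψ‖ ≤ (kernelNorm (hχ.symbol Real.pi Real.pi_pos.ne') +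
      kernelNorm (hχ.low 0)) * M * lpn p ψ + ‖v (mult (hχ.low n : Eu d → ℂ) ψ)‖ := by
  set σ := hχ.symbol Real.pi Real.pi_pos.ne' with hσ
  have hpi := Real.pi_gt_three
  have hn2 : (2 : ℝ) ≤ 2 ^ n := by
    calc (2 : ℝ) = 2 ^ 1 := by norm_num
      _ ≤ _ := pow_le_pow_right₀ (by norm_num) hn
  set ψ' := mult ((σ - hχ.low n : 𝓢(Eu d, ℂ)) : Eu d → ℂ) ψ with hψ'
  have hval : ∀ ξ, (σ - hχ.low n) ξ = ((χ (Real.pi • ξ) : ℝ) : ℂ) -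
      ((χ ((2 * Real.pi * 2 ^ n) • ξ) : ℝ) : ℂ) := fun ξ => rfl
  have hband : ψ' ∈ band (1 / (2 * Real.pi * 2 ^ n)) 1 := by
    intro ξ hξ
    rw [hψ', fourier_mult (σ - hχ.low n).hasTemperateGrowth] at hξ
    have h1 := left_ne_zero_of_mul hξ
    rw [hval] at h1
    constructor
    · by_contra hlt
      push Not at hlt
      refine h1 ?_
      have hy : 2 * Real.pi * 2 ^ n * ‖ξ‖ ≤ 1 := by
        rw [lt_div_iff₀ (by positivity)] at hlt; linarith
      have hy2 : Real.pi * ‖ξ‖ ≤ 2 * Real.pi * 2 ^ n * ‖ξ‖ := by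
        gcongr; nlinarith
      rw [hχ.eq_one, hχ.eq_one, sub_self]
      · rw [norm_smul_of_nonneg' (by positivity)]; exact hy
      · rw [norm_smul_of_nonneg' (by positivity)]; linarith
    · by_contra hlt
      push Not at hlt
      refine h1 ?_
      have hy2 : Real.pi * ‖ξ‖ ≤ 2 * Real.pi * 2 ^ n * ‖ξ‖ := by
        gcongr; nlinarith
      rw [hχ.eq_zero, hχ.eq_zero, sub_self]
      · rw [norm_smul_of_nonneg' (by positivity)]; nlinarith
      · rw [norm_smul_of_nonneg' (by positivity)]; nlinarith
  have hsum : mult (bsym χ 0) ψ = mult (bsym χ 0) ψ' + mult (hχ.low n : Eu d → ℂ) ψ := by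
    refine schwartz_ext_fourier fun ξ => ?_
    rw [FourierTransform.fourier_add, _root_.add_apply,
      fourier_mult (hχ.hasTemperateGrowth_bsym 0), fourier_mult (hχ.hasTemperateGrowth_bsym 0),
      hψ', fourier_mult (σ - hχ.low n).hasTemperateGrowth,
      fourier_mult (hχ.low n).hasTemperateGrowth, hval, hχ.low_apply, bsym_zero]
    have hn1 : ∀ c : ℝ, 0 ≤ c → ‖c • ξ‖ = c * ‖ξ‖ := fun c hc => norm_smul_of_nonneg' hc ξ
    have e1 := hn1 (2 * Real.pi) (by positivity)
    have e2 := hn1 Real.pi (by positivity)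
    have e3 := hn1 (2 * Real.pi * 2 ^ n) (by positivity)
    have hle : 2 * (2 * Real.pi * ‖ξ‖) ≤ 2 * Real.pi * 2 ^ n * ‖ξ‖ := by
      have : 0 ≤ 2 * Real.pi * ‖ξ‖ := by positivity
      nlinarith
    rcases le_or_gt (2 * Real.pi * ‖ξ‖) 1 with h1 | h1
    · rw [hχ.eq_one ((2 * Real.pi) • ξ) (by linarith), hχ.eq_one (Real.pi • ξ) (by nlinarith)]
      push_cast; ring
    · rw [hχ.eq_zero ((2 * Real.pi * 2 ^ n) • ξ) (by linarith)]
      rcases le_or_gt (Real.pi * ‖ξ‖) 1 with h2 | h2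
      · rw [hχ.eq_one (Real.pi • ξ) (by linarith)]
        push_cast; ring
      · rw [hχ.eq_zero ((2 * Real.pi) • ξ) (by linarith)]
        push_cast; ring
  have hl : lpn p ψ' ≤ (kernelNorm σ + kernelNorm (hχ.low 0)) * lpn p ψ := by
    have e : ψ' = mult (σ : Eu d → ℂ) ψ - mult (hχ.low n : Eu d → ℂ) ψ := by
      refine schwartz_ext_fourier fun ξ => ?_
      rw [fourier_sub_apply, hψ',
        fourier_mult (σ - hχ.low n).hasTemperateGrowth, fourier_mult (hχ.low n).hasTemperateGrowth,
        fourier_mult σ.hasTemperateGrowth, _root_.sub_apply]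
      ring
    rw [e, add_mul]
    refine (lpn_sub_le p _ _).trans (add_le_add (lpn_mult_le p _ _) ?_)
    rw [← hχ.kernelNorm_low n]; exact lpn_mult_le p _ _
  rw [hχ.block_apply, hsum, map_add, ← hχ.block_apply]
  refine (norm_add_le _ _).trans (add_le_add ?_ le_rfl)
  refine (hM _ _ (by positivity) ?_ ψ' hband).trans ?_
  · rw [div_le_one (by positivity)]; nlinarith
  · calc _ ≤ M * ((kernelNorm σ + kernelNorm (hχ.low 0)) * lpn p ψ) := by gcongr
      _ = _ := by ring

/-- The extension of a bound for functions of positive frequency to functions whose Fourier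
transform vanishes to high order at the origin. -/
theorem norm_block_le_of_jet {χ : Eu d → ℝ} (hχ : IsLPCutoff χ) {v : 𝓢'(Eu d, ℂ)} {N : ℕ} {C : ℝ}
    (hv : ∀ Φ : 𝓢(Eu d, ℂ), ‖v (𝓕⁻ Φ)‖ ≤ C * schNorm N Φ) {p : ℝ≥0∞} [Fact (1 ≤ p)] {M : ℝ}
    (hM0 : 0 ≤ M)
    (hM : ∀ r R : ℝ, 0 < r → r ≤ R → ∀ φ ∈ band r R, ‖block χ 0 v φ‖ ≤ M * lpn p φ)
    {ψ : 𝓢(Eu d, ℂ)} (hψ : ∀ i ≤ N, iteratedFDeriv ℝ i (𝓕 ψ : 𝓢(Eu d, ℂ)) 0 = 0) :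
    ‖block χ 0 v ψ‖ ≤ (kernelNorm (hχ.symbol Real.pi (by positivity)) +
      kernelNorm (hχ.low 0)) * M * lpn p ψ := by
  set σ := hχ.symbol Real.pi Real.pi_pos.ne' with hσ
  have hpi := Real.pi_gt_three
  have hb : ContDiff ℝ ((⊤ : ℕ∞) : WithTop ℕ∞) (fun ξ => ((χ ((2 * Real.pi) • ξ) : ℝ) : ℂ)) :=
    contDiff_dilate hχ.contDiff _
  have hlim := tendsto_schNorm_of_jet hb (fun ξ hξ => by
    rw [hχ.eq_zero, Complex.ofReal_zero]
    rw [norm_smul_of_nonneg' (by positivity)]; nlinarith) hψ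
  have hlow : ∀ n, ‖v (mult (hχ.low n : Eu d → ℂ) ψ)‖ ≤ C * schNorm N
      (SchwartzMap.smulLeftCLM ℂ (fun ξ => ((χ ((2 * Real.pi) • ((2 ^ n : ℝ) • ξ)) : ℝ) : ℂ)) (𝓕 ψ)) := by
    intro n
    have e : (hχ.low n : Eu d → ℂ) = fun ξ => ((χ ((2 * Real.pi) • ((2 ^ n : ℝ) • ξ)) : ℝ) : ℂ) := by
      ext ξ; rw [hχ.low_apply, smul_smul]
    have h1 := hv (SchwartzMap.smulLeftCLM ℂ (hχ.low n : Eu d → ℂ) (𝓕 ψ))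
    rw [← fourier_mult_eq (hχ.low n).hasTemperateGrowth, FourierTransform.fourierInv_fourier_eq,
      fourier_mult_eq (hχ.low n).hasTemperateGrowth] at h1
    rwa [e] at h1 ⊢
  have hsplit : ∀ n : ℕ, 1 ≤ n → ‖block χ 0 v ψ‖ ≤ (kernelNorm σ + kernelNorm (hχ.low 0)) * M * lpn p ψ +
      C * schNorm N (SchwartzMap.smulLeftCLM ℂ
        (fun ξ => ((χ ((2 * Real.pi) • ((2 ^ n : ℝ) • ξ)) : ℝ) : ℂ)) (𝓕 ψ)) := fun n hn =>
    (hχ.norm_block_zero_le hM0 hM ψ hn).trans (add_le_add le_rfl (hlow n))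
  refine ge_of_tendsto (f := fun n : ℕ => (kernelNorm σ + kernelNorm (hχ.low 0)) * M * lpn p ψ +
      C * schNorm N (SchwartzMap.smulLeftCLM ℂ
        (fun ξ => ((χ ((2 * Real.pi) • ((2 ^ n : ℝ) • ξ)) : ℝ) : ℂ)) (𝓕 ψ))) (x := atTop) ?_ ?_
  · have := (hlim.const_mul C).const_add ((kernelNorm σ + kernelNorm (hχ.low 0)) * M * lpn p ψ)
    simpa using this
  · filter_upwards [eventually_ge_atTop 1] with n hn using hsplit n hn

end

section

variable {d : ℕ}

/-- The inverse Fourier transform of a compactly supported integrable function is smooth with bounded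
derivatives. -/
theorem hasTemperateGrowth_fourierInv {G : Eu d → ℂ} (hG : Integrable G) {ρ : ℝ}
    (hs : ∀ ξ, G ξ ≠ 0 → ‖ξ‖ ≤ ρ) : (𝓕⁻ G).HasTemperateGrowth := by
  rw [Real.fourierInv_eq_fourier_comp_neg]
  set f : Eu d → ℂ := fun ξ => G (-ξ)
  have hf : Integrable f := hG.comp_neg
  have hfs : ∀ ξ, f ξ ≠ 0 → ‖ξ‖ ≤ ρ := fun ξ h => by simpa using hs _ h
  have hint : ∀ n : ℕ, Integrable fun ξ => ‖ξ‖ ^ n * ‖f ξ‖ := fun n => by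
    refine (hf.norm.const_mul (|ρ| ^ n)).mono'
      (((continuous_norm.pow n).aestronglyMeasurable).mul hf.norm.aestronglyMeasurable)
      (Eventually.of_forall fun ξ => ?_)
    rw [Real.norm_of_nonneg (by positivity)]
    by_cases h : f ξ = 0
    · simp [h]
    · gcongr
      exact (hfs ξ h).trans (le_abs_self ρ)
  refine ⟨?_, fun n => ⟨0, ∫ ξ, ‖VectorFourier.fourierPowSMulRight (innerSL ℝ) f ξ n‖, fun x => ?_⟩⟩
  · exact Real.contDiff_fourier (N := ⊤) fun n _ => hint n
  · rw [Real.iteratedFDeriv_fourier (N := ⊤) (fun n _ => hint n) hf.aestronglyMeasurable le_top,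
      pow_zero, mul_one]
    exact VectorFourier.norm_fourierIntegral_le_integral_norm _ _ _ _ _

/-- The frequency support of a product is contained in the sum of the frequency supports. -/
theorem fourier_smulLeft_eq_zero {G : Eu d → ℂ} (hG : Integrable G) {ρ r : ℝ}
    (hs : ∀ ξ, G ξ ≠ 0 → ‖ξ‖ ≤ ρ) {A : 𝓢(Eu d, ℂ)} (hA : ∀ ξ, 𝓕 A ξ ≠ 0 → ‖ξ‖ ≤ r) {ξ : Eu d}
    (hξ : ρ + r < ‖ξ‖) : 𝓕 (SchwartzMap.smulLeftCLM ℂ (𝓕⁻ G) A) ξ = 0 := by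
  have hg := hasTemperateGrowth_fourierInv hG hs
  rw [SchwartzMap.fourier_coe, Real.fourier_eq]
  set h : Eu d → ℂ := fun x => (Real.fourierChar (-inner ℝ x ξ)) • A x with hh
  have hhi : Integrable h := by
    refine (A.integrable (μ := volume)).norm.mono' ?_ (Eventually.of_forall fun x => ?_)
    · refine Continuous.aestronglyMeasurable ?_
      have := A.continuous
      have h2 : Continuous fun x : Eu d => (Real.fourierChar (-inner ℝ x ξ)) :=
        Real.continuous_fourierChar.comp (by fun_prop)
      exact h2.smul this
    · simp [hh]
  have hfh : ∀ η, 𝓕 h η = 𝓕 A (η + ξ) := fun η => by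
    rw [SchwartzMap.fourier_coe, Real.fourier_eq, Real.fourier_eq]
    congr 1; ext x
    rw [hh]
    simp only
    rw [smul_smul, ← AddChar.map_add_eq_mul, inner_add_right, neg_add]
  have hflip := VectorFourier.integral_fourierIntegral_smul_eq_flip (μ := (volume : Measure (Eu d)))
    (ν := (volume : Measure (Eu d))) (L := innerₗ (Eu d)) (f := fun ξ => G (-ξ)) (g := h)
    Real.continuous_fourierChar continuous_inner hG.comp_neg hhi
  rw [flip_innerₗ] at hflip
  have e1 : ∀ x, Real.fourierChar (-inner ℝ x ξ) • (SchwartzMap.smulLeftCLM ℂ (𝓕⁻ G) A) x =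
      (𝓕 (fun ξ => G (-ξ)) x) • h x := fun x => by
    rw [SchwartzMap.smulLeftCLM_apply_apply hg, ← Real.fourierInv_eq_fourier_comp_neg, hh, smul_comm]
  simp_rw [e1]
  refine hflip.trans ?_
  rw [← integral_zero (Eu d) ℂ (μ := volume)]
  congr 1; ext η
  change G (-η) • 𝓕 h η = 0
  rw [hfh]
  by_contra hne
  have h1 := hs _ (left_ne_zero_of_smul hne)
  have h2 := hA _ (right_ne_zero_of_smul hne)
  have h3 := norm_add_le (η + ξ) (-η)
  rw [show η + ξ + -η = ξ by abel] at h3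
  linarith

theorem fourier_dilate {f g : 𝓢(Eu d, ℂ)} {c : ℝ} (hc : 0 < c) (h : ∀ x, g x = f (c • x))
    (ξ : Eu d) : 𝓕 g ξ = ((c ^ d)⁻¹ : ℝ) * 𝓕 f (c⁻¹ • ξ) := by
  have := fourierInv_dilate hc h (-ξ)
  rw [SchwartzMap.fourierInv_coe, SchwartzMap.fourierInv_coe, Real.fourierInv_eq_fourier_neg,
    Real.fourierInv_eq_fourier_neg, smul_neg, neg_neg, neg_neg] at this
  rw [SchwartzMap.fourier_coe, SchwartzMap.fourier_coe]
  exact this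

/-- The high frequencies of a slowly varying cutoff are negligible. -/
theorem tendsto_cutoff_highFrequency {χ : Eu d → ℝ} (hχ : IsLPCutoff χ) {c : ℝ} (hc : 0 < c)
    {S : ℝ → 𝓢(Eu d, ℂ)} (hS : ∀ R, 0 < R → ∀ x, S R x = S 1 (R⁻¹ • x)) :
    Tendsto (fun R => S R - mult (hχ.symbol c hc.ne' : Eu d → ℂ) (S R)) atTop (𝓝 0) := by
  set Θ := 𝓕 (S 1) with hΘ
  have hX : ContDiff ℝ ((⊤ : ℕ∞) : WithTop ℕ∞) (hχ.symbol c hc.ne' : Eu d → ℂ) :=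
    contDiff_dilate hχ.contDiff _
  have hXs : HasCompactSupport (hχ.symbol c hc.ne' : Eu d → ℂ) :=
    hasCompactSupport_dilate hχ.hasCompactSupport hc.ne'
  have hX1 : ∀ᶠ x in 𝓝 0, (hχ.symbol c hc.ne' : Eu d → ℂ) x = 1 := by
    filter_upwards [Metric.ball_mem_nhds (0 : Eu d) (inv_pos.2 hc)] with x hx
    rw [hχ.symbol_apply, hχ.eq_one, Complex.ofReal_one]
    rw [norm_smul_of_nonneg' hc.le]
    have : ‖x‖ < c⁻¹ := by simpa using hx
    calc c * ‖x‖ ≤ c * c⁻¹ := by gcongr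
      _ = 1 := mul_inv_cancel₀ hc.ne'
  set F : ℝ → 𝓢(Eu d, ℂ) := fun R => Θ - SchwartzMap.smulLeftCLM ℂ
    (fun x => hχ.symbol c hc.ne' (R⁻¹ • x)) Θ with hF
  have hFlim : Tendsto F atTop (𝓝 0) := by
    have := (tendsto_cutoff hX hXs hX1 Θ).const_sub Θ
    simpa using this
  have hF0 : ∀ R, 0 < R → ∀ y, ‖y‖ < R / c → F R y = 0 := by
    intro R hR y hy
    have htg : (fun x => hχ.symbol c hc.ne' (R⁻¹ • x)).HasTemperateGrowth :=
      (hasCompactSupport_dilate hXs (inv_ne_zero hR.ne')).hasTemperateGrowth (contDiff_dilate hX _)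
    rw [hF, _root_.sub_apply, SchwartzMap.smulLeftCLM_apply_apply htg, hχ.symbol_apply, hχ.eq_one]
    · simp
    · rw [norm_smul_of_nonneg' hc.le, norm_smul_of_nonneg' (by positivity)]
      rw [lt_div_iff₀ hc] at hy
      rw [mul_left_comm, inv_mul_le_one₀ hR]; linarith
  have hFS : ∀ R, 0 < R → ∀ ξ, 𝓕 (S R - mult (hχ.symbol c hc.ne' : Eu d → ℂ) (S R)) ξ =
      ((R ^ d : ℝ) : ℂ) * F R (R • ξ) := by
    intro R hR ξ
    have htg : (fun x => hχ.symbol c hc.ne' (R⁻¹ • x)).HasTemperateGrowth :=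
      (hasCompactSupport_dilate hXs (inv_ne_zero hR.ne')).hasTemperateGrowth (contDiff_dilate hX _)
    rw [fourier_sub_apply, fourier_mult (hχ.symbol c hc.ne').hasTemperateGrowth,
      fourier_dilate (inv_pos.2 hR) (hS R hR), hF, _root_.sub_apply,
      SchwartzMap.smulLeftCLM_apply_apply htg, inv_pow, inv_inv, inv_inv, smul_smul,
      inv_mul_cancel₀ hR.ne', one_smul, smul_eq_mul]
    ring
  have hlim : Tendsto (fun R => 𝓕 (S R - mult (hχ.symbol c hc.ne' : Eu d → ℂ) (S R))) atTop
      (𝓝 (0 : 𝓢(Eu d, ℂ))) := by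
    rw [(schwartz_withSeminorms ℂ (Eu d) ℂ).tendsto_nhds]
    rintro ⟨k, n⟩ ε hε
    have h1 := ((schwartz_withSeminorms ℂ (Eu d) ℂ).tendsto_nhds _ _).1 hFlim (k + (d + n), n)
      (ε / (2 * c ^ (d + n))) (by positivity)
    filter_upwards [h1, eventually_ge_atTop 1] with R hR1 hR
    have hR0 : 0 < R := by linarith
    rw [sub_zero] at hR1 ⊢
    set s := SchwartzMap.seminorm ℂ (k + (d + n)) n (F R)
    have hs0 : 0 ≤ s := apply_nonneg _ _
    have hR1' : s < ε / (2 * c ^ (d + n)) := hR1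
    refine lt_of_le_of_lt (b := c ^ (d + n) * s) ?_ ?_
    · refine SchwartzMap.seminorm_le_bound ℂ k n _ (by positivity) fun ξ => ?_
      have e : ((𝓕 (S R - mult (hχ.symbol c hc.ne' : Eu d → ℂ) (S R)) : 𝓢(Eu d, ℂ)) : Eu d → ℂ) =
          fun ξ => ((R ^ d : ℝ) : ℂ) • F R (R • ξ) := by
        ext ξ; rw [hFS R hR0]; rfl
      have hsm : ContDiff ℝ n (F R) := (F R).smooth n
      have eD : iteratedFDeriv ℝ n (𝓕 (S R - mult (hχ.symbol c hc.ne' : Eu d → ℂ) (S R)) : 𝓢(Eu d, ℂ)) ξ =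
          ((R ^ d : ℝ) : ℂ) • (R ^ n • iteratedFDeriv ℝ n (F R) (R • ξ)) := by
        rw [e, iteratedFDeriv_const_smul_apply', congrFun (iteratedFDeriv_comp_const_smul (𝕜 := ℝ)
          (i := n) R hsm) ξ]
        exact (hsm.comp (contDiff_const_smul R)).contDiffAt
      rw [eD, norm_smul, norm_smul, Complex.norm_real, Real.norm_of_nonneg (by positivity),
        Real.norm_of_nonneg (by positivity)]
      by_cases hy : ‖R • ξ‖ < R / c
      · have : iteratedFDeriv ℝ n (F R) (R • ξ) = 0 := by
          have h0 : (F R : Eu d → ℂ) =ᶠ[𝓝 (R • ξ)] fun _ => 0 := by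
            filter_upwards [(isOpen_lt continuous_norm continuous_const).mem_nhds hy] with y hy
            exact hF0 R hR0 y hy
          have := h0.iteratedFDeriv ℝ n |>.eq_of_nhds
          rw [this]; simp
        rw [this, norm_zero, mul_zero, mul_zero, mul_zero]; positivity
      · push Not at hy
        have h2 := SchwartzMap.le_seminorm ℂ (k + (d + n)) n (F R) (R • ξ)
        have h3 : ‖ξ‖ ≤ ‖R • ξ‖ := by
          rw [norm_smul_of_nonneg' hR0.le]; nlinarith [norm_nonneg ξ]
        have h4 : R ≤ c * ‖R • ξ‖ := by rw [div_le_iff₀ hc] at hy; linarith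
        calc ‖ξ‖ ^ k * (R ^ d * (R ^ n * ‖iteratedFDeriv ℝ n (F R) (R • ξ)‖))
            = ‖ξ‖ ^ k * R ^ (d + n) * ‖iteratedFDeriv ℝ n (F R) (R • ξ)‖ := by ring
          _ ≤ ‖R • ξ‖ ^ k * (c * ‖R • ξ‖) ^ (d + n) * ‖iteratedFDeriv ℝ n (F R) (R • ξ)‖ := by gcongr
          _ = c ^ (d + n) * (‖R • ξ‖ ^ (k + (d + n)) * ‖iteratedFDeriv ℝ n (F R) (R • ξ)‖) := by ring
          _ ≤ _ := by gcongr
    · calc c ^ (d + n) * s < c ^ (d + n) * (ε / (c ^ (d + n))) := by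
            refine mul_lt_mul_of_pos_left (hR1'.trans_le ?_) (by positivity)
            gcongr
            linarith [show 0 < c ^ (d + n) by positivity]
        _ = ε := by field_simp
  have := ((FourierTransform.fourierInvCLM ℂ 𝓢(Eu d, ℂ)).continuous.tendsto 0).comp hlim
  rw [map_zero] at this
  refine this.congr fun R => ?_
  simp [FourierTransform.fourierInvCLM_apply]

/-- Truncating a function of low frequency commutes asymptotically with the low-frequency block. -/
theorem tendsto_commutator {χ : Eu d → ℝ} (hχ : IsLPCutoff χ) {G : Eu d → ℂ} (hG : Integrable G)
    (hs : ∀ ξ, G ξ ≠ 0 → ‖ξ‖ ≤ 3 / (8 * Real.pi)) {θ : Eu d → ℂ}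
    (hθ : ContDiff ℝ ((⊤ : ℕ∞) : WithTop ℕ∞) θ) (hθs : HasCompactSupport θ)
    {η : ℝ → 𝓢(Eu d, ℂ)} (hη : ∀ R, 0 < R → ∀ x, η R x = θ (R⁻¹ • x) * 𝓕⁻ G x) :
    Tendsto (fun R => η R - mult (bsym χ 0) (η R)) atTop (𝓝 0) := by
  have hpi := Real.pi_pos
  set S : ℝ → 𝓢(Eu d, ℂ) := fun R => if h : R = 0 then 0 else
    (hasCompactSupport_dilate hθs (inv_ne_zero h)).toSchwartzMap (contDiff_dilate hθ R⁻¹) with hSdef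
  have hS : ∀ R, 0 < R → ∀ x, S R x = θ (R⁻¹ • x) := fun R hR x => by
    rw [hSdef]; simp only [hR.ne', dif_neg, not_false_iff]; rfl
  have hg := hasTemperateGrowth_fourierInv hG hs
  have hb0 := hχ.hasTemperateGrowth_bsym 0
  have hlim := tendsto_cutoff_highFrequency hχ (c := 16 * Real.pi) (by positivity) (S := S)
    fun R hR x => by rw [hS R hR, hS 1 one_pos]; simp
  set σ := hχ.symbol (16 * Real.pi) (by positivity) with hσ
  set L : 𝓢(Eu d, ℂ) →L[ℂ] 𝓢(Eu d, ℂ) :=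
    (ContinuousLinearMap.id ℂ _ - mult (bsym χ 0)).comp (SchwartzMap.smulLeftCLM ℂ (𝓕⁻ G))
  have hL := (L.continuous.tendsto 0).comp hlim
  rw [map_zero] at hL
  refine hL.congr' ?_
  filter_upwards [eventually_gt_atTop 0] with R hR
  have e1 : η R = SchwartzMap.smulLeftCLM ℂ (𝓕⁻ G) (S R) := by
    ext x
    rw [hη R hR, SchwartzMap.smulLeftCLM_apply_apply hg, hS R hR, smul_eq_mul, mul_comm]
  have e2 : L (mult (σ : Eu d → ℂ) (S R)) = 0 := by
    refine schwartz_ext_fourier fun ξ => ?_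
    change 𝓕 (SchwartzMap.smulLeftCLM ℂ (𝓕⁻ G) (mult (σ : Eu d → ℂ) (S R)) -
      mult (bsym χ 0) (SchwartzMap.smulLeftCLM ℂ (𝓕⁻ G) (mult (σ : Eu d → ℂ) (S R)))) ξ = _
    rw [fourier_sub_apply, fourier_mult hb0, FourierTransform.fourier_zero, _root_.zero_apply]
    rcases le_or_gt ‖ξ‖ (1 / (2 * Real.pi)) with h | h
    · rw [bsym_zero, hχ.eq_one]
      · simp
      · rw [norm_smul_of_nonneg' (by positivity)]
        rw [le_div_iff₀ (by positivity)] at h; linarith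
    · rw [fourier_smulLeft_eq_zero hG hs (r := 3 / (32 * Real.pi)), mul_zero, sub_zero]
      · intro ζ hζ
        rw [fourier_mult σ.hasTemperateGrowth] at hζ
        by_contra hlt
        push Not at hlt
        refine left_ne_zero_of_mul hζ ?_
        rw [hσ, hχ.symbol_apply, hχ.eq_zero, Complex.ofReal_zero]
        rw [norm_smul_of_nonneg' (by positivity)]
        rw [div_lt_iff₀ (by positivity)] at hlt; linarith
      · refine lt_trans ?_ h
        rw [div_add_div _ _ (by positivity) (by positivity), div_lt_div_iff₀ (by positivity) (by positivity)]
        nlinarith [pow_pos hpi 2, pow_pos hpi 3]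
  rw [Function.comp_apply, map_sub, e2, sub_zero, e1]
  rfl

end

section

variable {d : ℕ}

theorem fracLaplacian_smul (α : ℝ) (c : ℂ) (φ : 𝓢(Eu d, ℂ)) (x : Eu d) :
    fracLaplacian α (c • φ) x = c * fracLaplacian α φ x := by
  rw [fracLaplacian, fracLaplacian, mul_left_comm]
  refine congrArg (fun I : ℂ => (1 / 2 : ℂ) * I) ((integral_const_mul c _).symm.trans ?_).symm
  refine (integral_congr_ae (Eventually.of_forall fun z => ?_))
  simp only [_root_.smul_apply, smul_eq_mul]; ring

theorem fracLaplacian_sub (hd : 1 ≤ d) {α : ℝ} (hα : α ∈ Set.Ioo (0 : ℝ) 2) (φ ψ : 𝓢(Eu d, ℂ))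
    (x : Eu d) : fracLaplacian α (φ - ψ) x = fracLaplacian α φ x - fracLaplacian α ψ x := by
  rw [fracLaplacian_eq, fracLaplacian_eq, fracLaplacian_eq, ← mul_sub,
    ← integral_sub (integrable_secondDiff_mul_levy hd hα φ x)
      (integrable_secondDiff_mul_levy hd hα ψ x)]
  refine congrArg (fun I : ℂ => (1 / 2 : ℂ) * I) (integral_congr_ae (Eventually.of_forall fun z => ?_))
  simp only [secondDiff, _root_.sub_apply, smul_sub]; ring

theorem fracLaplacian_neg_arg (α : ℝ) (φ : 𝓢(Eu d, ℂ)) {c : ℂ} (h : ∀ x, φ (-x) = c * φ x)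
    (x : Eu d) : fracLaplacian α φ (-x) = c * fracLaplacian α φ x := by
  rw [fracLaplacian, fracLaplacian, mul_left_comm]
  refine congrArg (fun I : ℂ => (1 / 2 : ℂ) * I) ((integral_const_mul c _).symm.trans ?_).symm
  refine (integral_congr_ae (Eventually.of_forall fun z => ?_))
  simp only
  rw [show -x + z = -(x - z) by abel, show -x - z = -(x + z) by abel, h, h, h]; ring

theorem HasPairing.sub {v : 𝓢'(Eu d, ℂ)} {g h : Eu d → ℂ} {a b : ℂ} (hg : HasPairing v g a)
    (hh : HasPairing v h b) : HasPairing v (fun x => g x - h x) (a - b) := by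
  intro θ hθ hs h1
  obtain ⟨η, hη, hη'⟩ := hg θ hθ hs h1
  obtain ⟨ζ, hζ, hζ'⟩ := hh θ hθ hs h1
  refine ⟨fun R => η R - ζ R, fun R hR x => ?_, ?_⟩
  · rw [_root_.sub_apply, hη R hR, hζ R hR]; ring
  · simpa only [map_sub] using hη'.sub hζ'

theorem eLpNorm_comp_inv_smul_le {f : Eu d → ℂ} {p : ℝ≥0∞} (hp : 1 ≤ p) {c : ℝ} (hc : 1 ≤ c) :
    eLpNorm (fun x => f (c⁻¹ • x)) p volume ≤ ENNReal.ofReal (c ^ d) * eLpNorm f p volume := by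
  have hc0 : 0 < c := by linarith
  have hmap : Measure.map (fun x : Eu d => c⁻¹ • x) volume = ENNReal.ofReal (c ^ d) • volume := by
    rw [Measure.map_addHaar_smul _ (inv_ne_zero hc0.ne'), finrank_euclideanSpace_fin, inv_pow,
      inv_inv, abs_of_pos (by positivity)]
  have h1 : (1 : ℝ≥0∞) ≤ ENNReal.ofReal (c ^ d) := by
    rw [ENNReal.one_le_ofReal]; exact one_le_pow₀ hc
  have h := MeasurableEmbedding.eLpNorm_map_measure (μ := (volume : Measure (Eu d))) (p := p)
    (g := f) (Homeomorph.smulOfNeZero c⁻¹ (inv_ne_zero hc0.ne')).measurableEmbedding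
  change eLpNorm f p (Measure.map (fun x : Eu d => c⁻¹ • x) volume) = _ at h
  rw [hmap] at h
  refine h.ge.trans ((eLpNorm_smul_measure_le _ _ _ _).trans ?_)
  rw [smul_eq_mul]
  refine mul_le_mul' ?_ le_rfl
  refine (ENNReal.rpow_le_rpow_of_exponent_le h1 (z := (1 : ℝ)) ?_).trans (ENNReal.rpow_one _).le
  rw [one_div, ENNReal.toReal_inv]
  rcases eq_or_ne p ⊤ with rfl | hpt
  · simp
  · exact inv_le_one_of_one_le₀ ((@ENNReal.dichotomy p ⟨hp⟩).resolve_left hpt)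

/-- The function with Fourier transform `χ (2π 2ⁿ ξ) m ξ`. -/
def IsLPCutoff.mode {χ : Eu d → ℝ} (hχ : IsLPCutoff χ) {m : Eu d → ℂ}
    (hm : ContDiff ℝ ((⊤ : ℕ∞) : WithTop ℕ∞) m) (n : ℕ) : 𝓢(Eu d, ℂ) :=
  𝓕⁻ (HasCompactSupport.toSchwartzMap (f := fun ξ => hχ.low n ξ * m ξ)
    (hasCompactSupport_dilate hχ.hasCompactSupport (by positivity)).mul_right
    ((hχ.low n).smooth'.mul hm) : 𝓢(Eu d, ℂ))

section Mode

variable {χ : Eu d → ℝ} (hχ : IsLPCutoff χ) {m : Eu d → ℂ}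
  (hm : ContDiff ℝ ((⊤ : ℕ∞) : WithTop ℕ∞) m) {l : ℕ}

theorem IsLPCutoff.fourier_mode (n : ℕ) (ξ : Eu d) : 𝓕 (hχ.mode hm n) ξ = hχ.low n ξ * m ξ := by
  rw [IsLPCutoff.mode, FourierTransform.fourier_fourierInv_eq]; rfl

theorem IsLPCutoff.low_eq_zero {n : ℕ} {ξ : Eu d} (h : 3 / 2 < 2 * Real.pi * 2 ^ n * ‖ξ‖) :
    hχ.low n ξ = 0 := by
  rw [hχ.low_apply, hχ.eq_zero, Complex.ofReal_zero]
  rwa [norm_smul_of_nonneg' (by positivity)]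

theorem IsLPCutoff.low_eq_one {n : ℕ} {ξ : Eu d} (h : 2 * Real.pi * 2 ^ n * ‖ξ‖ ≤ 1) :
    hχ.low n ξ = 1 := by
  rw [hχ.low_apply, hχ.eq_one, Complex.ofReal_one]
  rwa [norm_smul_of_nonneg' (by positivity)]

theorem IsLPCutoff.norm_le_of_low_ne_zero {n : ℕ} (hn : 1 ≤ n) {ξ : Eu d} (h : hχ.low n ξ ≠ 0) :
    ‖ξ‖ ≤ 3 / (8 * Real.pi) := by
  by_contra hlt
  push Not at hlt
  refine h (hχ.low_eq_zero ?_)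
  have hpi := Real.pi_pos
  rw [div_lt_iff₀ (by positivity)] at hlt
  have hn2 : (2 : ℝ) ≤ 2 ^ n := le_self_pow₀ (by norm_num) (by omega)
  have : 0 ≤ Real.pi * ‖ξ‖ := by positivity
  nlinarith

/-- The blocks of lowest frequency reproduce functions of lower frequency. -/
theorem IsLPCutoff.bsym_zero_eq_one {χ : Eu d → ℝ} (hχ : IsLPCutoff χ) {ξ : Eu d} (h : ‖ξ‖ ≤ 3 / (8 * Real.pi)) : bsym χ 0 ξ = 1 := by
  have hpi := Real.pi_pos
  rw [bsym_zero, hχ.eq_one, Complex.ofReal_one]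
  rw [norm_smul_of_nonneg' (by positivity)]
  rw [le_div_iff₀ (by positivity)] at h
  linarith

theorem IsLPCutoff.mult_bsym_zero {χ : Eu d → ℝ} (hχ : IsLPCutoff χ) {φ : 𝓢(Eu d, ℂ)}
    (h : ∀ ξ, 𝓕 φ ξ ≠ 0 → ‖ξ‖ ≤ 3 / (8 * Real.pi)) :
    mult (bsym χ 0) φ = φ := by
  refine schwartz_ext_fourier fun ξ => ?_
  rw [fourier_mult (hχ.hasTemperateGrowth_bsym 0)]
  by_cases h0 : 𝓕 φ ξ = 0
  · rw [h0, mul_zero]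
  · rw [hχ.bsym_zero_eq_one (h ξ h0), one_mul]

theorem IsLPCutoff.norm_le_of_fourier_mode_ne_zero {n : ℕ} (hn : 1 ≤ n) {ξ : Eu d}
    (h : 𝓕 (hχ.mode hm n) ξ ≠ 0) : ‖ξ‖ ≤ 3 / (8 * Real.pi) := by
  rw [hχ.fourier_mode] at h
  exact hχ.norm_le_of_low_ne_zero hn (left_ne_zero_of_mul h)

theorem IsLPCutoff.mode_dilate
    (hl : ∀ (c : ℝ) ξ, m (c • ξ) = (c ^ l : ℝ) * m ξ) (n : ℕ) (x : Eu d) :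
    hχ.mode hm n x = (((2 ^ n) ^ l * (2 ^ n) ^ d : ℝ)⁻¹ : ℝ) * hχ.mode hm 0 ((2 ^ n : ℝ)⁻¹ • x) := by
  have h := fourierInv_dilate (c := 2 ^ n) (by positivity)
    (f := 𝓕 (hχ.mode hm 0)) (g := (((2 ^ n) ^ l : ℝ) : ℂ) • 𝓕 (hχ.mode hm n)) (fun ξ => by
      rw [_root_.smul_apply, hχ.fourier_mode, hχ.fourier_mode, hl, hχ.low_apply, hχ.low_apply,
        smul_smul, smul_eq_mul]
      simp only [pow_zero, mul_one]; ring) x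
  rw [FourierTransform.fourierInv_smul, FourierTransform.fourierInv_fourier_eq,
    FourierTransform.fourierInv_fourier_eq, _root_.smul_apply, smul_eq_mul] at h
  rw [mul_inv, Complex.ofReal_mul, mul_assoc, ← h, ← mul_assoc, ← Complex.ofReal_mul,
    inv_mul_cancel₀ (by positivity), Complex.ofReal_one, one_mul]

theorem IsLPCutoff.mode_neg
    (hl : ∀ (c : ℝ) ξ, m (c • ξ) = (c ^ l : ℝ) * m ξ) (n : ℕ) (x : Eu d) :
    hχ.mode hm n (-x) = (-1) ^ l * hχ.mode hm n x := by
  have hF : ∀ ξ, 𝓕 (hχ.mode hm n) (-ξ) = (-1) ^ l * 𝓕 (hχ.mode hm n) ξ := fun ξ => by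
    rw [hχ.fourier_mode, hχ.fourier_mode, ← neg_one_smul ℝ ξ, hl, hχ.low_apply, hχ.low_apply,
      neg_one_smul, smul_neg, hχ.radial _ ((2 * Real.pi * 2 ^ n) • ξ) (norm_neg _)]
    push_cast; ring
  have e : ∀ y, hχ.mode hm n y = 𝓕⁻ (𝓕 (hχ.mode hm n)) y := fun y => by
    rw [FourierTransform.fourierInv_fourier_eq]
  rw [e, e, SchwartzMap.fourierInv_coe, Real.fourierInv_eq', Real.fourierInv_eq',
    ← integral_neg_eq_self, ← integral_const_mul]
  congr 1; ext ξ
  rw [hF, inner_neg_neg]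
  simp only [smul_eq_mul]; ring

/-- The exact scaling of the fractional Laplacians of the modes. -/
theorem IsLPCutoff.fracLaplacian_mode_dilate
    (hl : ∀ (c : ℝ) ξ, m (c • ξ) = (c ^ l : ℝ) * m ξ) (α : ℝ) (n j : ℕ) (x : Eu d) :
    fracLaplacian α (hχ.mode hm (n + j)) x =
      (((2 ^ j) ^ l * (2 ^ j) ^ d * (2 ^ j) ^ α : ℝ)⁻¹ : ℝ) *
        fracLaplacian α (hχ.mode hm n) ((2 ^ j : ℝ)⁻¹ • x) := by
  have h := fracLaplacian_dilate α (c := (2 ^ j : ℝ)⁻¹) (by positivity)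
    (φ := hχ.mode hm n) (ψ := (((2 ^ j) ^ l * (2 ^ j) ^ d : ℝ) : ℂ) • hχ.mode hm (n + j)) (fun x => by
      rw [_root_.smul_apply, hχ.mode_dilate hm hl, hχ.mode_dilate hm hl n, smul_smul, smul_eq_mul,
        ← mul_assoc, ← Complex.ofReal_mul]
      congr 1
      · congr 1; rw [pow_add]; field_simp; ring
      · congr 2; rw [pow_add, mul_inv]) x
  rw [fracLaplacian_smul] at h
  have hne : (((2 ^ j) ^ l * (2 ^ j) ^ d : ℝ) : ℂ) ≠ 0 := by
    exact_mod_cast (by positivity : ((2 ^ j) ^ l * (2 ^ j) ^ d : ℝ) ≠ 0)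
  rw [← eq_inv_mul_iff_mul_eq₀ hne] at h
  rw [h, Real.inv_rpow (by positivity), ← mul_assoc]
  simp only [mul_inv, Complex.ofReal_mul, Complex.ofReal_inv]

theorem IsLPCutoff.eLpNorm_fracLaplacian_mode_le
    (hl : ∀ (c : ℝ) ξ, m (c • ξ) = (c ^ l : ℝ) * m ξ) {α : ℝ} {p : ℝ≥0∞} (hp : 1 ≤ p) (n : ℕ) :
    eLpNorm (fracLaplacian α (hχ.mode hm n)) p volume ≤
      ENNReal.ofReal (((2 : ℝ) ^ (-α)) ^ n) * eLpNorm (fracLaplacian α (hχ.mode hm 0)) p volume := by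
  have e : fracLaplacian α (hχ.mode hm n) = (((2 ^ n) ^ l * (2 ^ n) ^ d * (2 ^ n) ^ α : ℝ)⁻¹ : ℝ) •
      fun x => fracLaplacian α (hχ.mode hm 0) ((2 ^ n : ℝ)⁻¹ • x) := by
    ext x
    have := hχ.fracLaplacian_mode_dilate hm hl α 0 n x
    rw [zero_add] at this
    rw [this]; simp
  have h1 : (1 : ℝ) ≤ 2 ^ n := one_le_pow₀ (by norm_num)
  rw [e, eLpNorm_const_smul, Real.enorm_of_nonneg (by positivity)]
  refine (mul_le_mul' le_rfl (eLpNorm_comp_inv_smul_le hp h1)).trans ?_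
  rw [← mul_assoc, ← ENNReal.ofReal_mul (by positivity)]
  refine mul_le_mul' (ENNReal.ofReal_le_ofReal ?_) le_rfl
  have h2 : ((2 : ℝ) ^ (-α)) ^ n = ((2 ^ n : ℝ) ^ α)⁻¹ := by
    rw [← Real.rpow_natCast, ← Real.rpow_mul (by norm_num), ← Real.rpow_natCast,
      ← Real.rpow_mul (by norm_num), ← Real.rpow_neg (by norm_num)]
    congr 1; ring
  rw [h2]
  have h3 : (1 : ℝ) ≤ (2 ^ n) ^ l := one_le_pow₀ h1
  have h4 : (0 : ℝ) < (2 ^ n) ^ α := by positivity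
  have h5 : (0 : ℝ) < (2 ^ n) ^ d := by positivity
  calc ((2 ^ n) ^ l * (2 ^ n) ^ d * (2 ^ n) ^ α : ℝ)⁻¹ * (2 ^ n) ^ d
      = ((2 ^ n) ^ l)⁻¹ * ((2 ^ n) ^ α)⁻¹ := by field_simp
    _ ≤ 1 * ((2 ^ n) ^ α)⁻¹ := by
        gcongr
        exact inv_le_one_of_one_le₀ h3
    _ = _ := one_mul _

theorem IsLPCutoff.tendsto_eLpNorm_fracLaplacian_mode
    (hl : ∀ (c : ℝ) ξ, m (c • ξ) = (c ^ l : ℝ) * m ξ) (hd : 1 ≤ d) {α : ℝ}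
    (hα : α ∈ Set.Ioo (0 : ℝ) 2) {p : ℝ≥0∞} (hp : 1 ≤ p) :
    Tendsto (fun n => (eLpNorm (fracLaplacian α (hχ.mode hm n)) p volume).toReal) atTop (𝓝 0) := by
  have h2 : (2 : ℝ) ^ (-α) < 1 := Real.rpow_lt_one_of_one_lt_of_neg (by norm_num) (by linarith [hα.1])
  have h1 := (tendsto_pow_atTop_nhds_zero_of_lt_one (by positivity) h2).mul_const
    (eLpNorm (fracLaplacian α (hχ.mode hm 0)) p volume).toReal
  rw [zero_mul] at h1
  refine squeeze_zero (fun _ => ENNReal.toReal_nonneg) (fun n => ?_) h1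
  have h3 := ENNReal.toReal_mono (ENNReal.mul_ne_top ENNReal.ofReal_ne_top
    (memLp_fracLaplacian hd hα _ hp).2.ne) (hχ.eLpNorm_fracLaplacian_mode_le hm hl (α := α) hp n)
  rwa [ENNReal.toReal_mul, ENNReal.toReal_ofReal (by positivity)] at h3

/-- The difference of two modes has no low frequencies, so that its fractional Laplacian is a
Schwartz function. -/
theorem IsLPCutoff.norm_pairing_mode_sub_le (hd : 1 ≤ d) {α : ℝ} (hα : α ∈ Set.Ioo (0 : ℝ) 2)
    {v : 𝓢'(Eu d, ℂ)} {p : ℝ≥0∞} [hp : Fact (1 ≤ p)] {M : ℝ} (hM0 : 0 ≤ M)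
    (hM : ∀ r R : ℝ, 0 < r → r ≤ R → ∀ φ ∈ band r R, ‖block χ 0 v φ‖ ≤ M * lpn p φ) {n k : ℕ}
    (hn : 1 ≤ n) (hk : 1 ≤ k) {a b : ℂ} (ha : HasPairing v (fracLaplacian α (hχ.mode hm n)) a)
    (hb : HasPairing v (fracLaplacian α (hχ.mode hm k)) b) :
    ‖a - b‖ ≤ M * ((eLpNorm (fracLaplacian α (hχ.mode hm n)) p volume).toReal +
      (eLpNorm (fracLaplacian α (hχ.mode hm k)) p volume).toReal) := by
  set δ := hχ.mode hm n - hχ.mode hm k with hδ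
  have hpi := Real.pi_pos
  have h2 : ∀ i : ℕ, 1 ≤ i → (2 : ℝ) ≤ 2 ^ i := fun i hi => le_self_pow₀ (by norm_num) (by omega)
  set r : ℝ := 1 / (2 * Real.pi * 2 ^ (max n k)) with hr
  have hr0 : 0 < r := by positivity
  have hrR : r ≤ 3 / (8 * Real.pi) := by
    rw [hr, div_le_div_iff₀ (by positivity) (by positivity)]
    nlinarith [h2 (max n k) (by omega)]
  have hδF : ∀ ξ, 𝓕 δ ξ = (hχ.low n ξ - hχ.low k ξ) * m ξ := fun ξ => by
    rw [hδ, fourier_sub_apply, hχ.fourier_mode, hχ.fourier_mode]; ring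
  have hδb : δ ∈ band r (3 / (8 * Real.pi)) := by
    intro ξ hξ
    rw [hδF] at hξ
    have h1 := left_ne_zero_of_mul hξ
    constructor
    · by_contra hlt
      push Not at hlt
      rw [hr, lt_div_iff₀ (by positivity)] at hlt
      have hle : ∀ i ≤ max n k, 2 * Real.pi * 2 ^ i * ‖ξ‖ ≤ 1 := fun i hi => by
        refine le_trans ?_ hlt.le
        rw [mul_comm ‖ξ‖]
        gcongr
        norm_num
      rw [hχ.low_eq_one (hle n (le_max_left _ _)), hχ.low_eq_one (hle k (le_max_right _ _)),
        sub_self] at h1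
      exact h1 rfl
    · by_contra hlt
      push Not at hlt
      have : ∀ i, 1 ≤ i → hχ.low i ξ = 0 := fun i hi => by
        by_contra h
        exact absurd (hχ.norm_le_of_low_ne_zero hi h) (not_le.2 hlt)
      rw [this n hn, this k hk, sub_self] at h1
      exact h1 rfl
  obtain ⟨κ, hκ, hκs, hκ0, hκ1⟩ := hχ.exists_annulus hr0 hrR
  set ω := mult (fun ξ => -((levySymbol α ξ : ℝ) : ℂ) * κ ξ) δ with hω
  have hg : (fun ξ => -((levySymbol α ξ : ℝ) : ℂ) * κ ξ).HasTemperateGrowth :=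
    HasCompactSupport.hasTemperateGrowth hκs.mul_left (contDiff_levySymbol_mul hd hα.1 hκ hκ0)
  have hωb : ω ∈ band r (3 / (8 * Real.pi)) := mult_mem_band hg hδb
  have hωx : (fun x => fracLaplacian α (hχ.mode hm n) x - fracLaplacian α (hχ.mode hm k) x) = ω := by
    ext x
    rw [← fracLaplacian_sub hd hα, hω]
    exact fracLaplacian_eq_mult hd hα hκ hκs hκ0 (fun ξ hξ => hκ1 ξ (hδb ξ hξ).1 (hδb ξ hξ).2) x
  have hpair := ha.sub hb
  rw [hωx] at hpair
  rw [hpair.eq_apply]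
  have hbl : block χ 0 v ω = v ω := by
    rw [hχ.block_apply, hχ.mult_bsym_zero fun ξ hξ => (hωb ξ hξ).2]
  rw [← hbl]
  refine (hM r _ hr0 hrR ω hωb).trans (mul_le_mul_of_nonneg_left ?_ hM0)
  have hn' := memLp_fracLaplacian hd hα (hχ.mode hm n) hp.out
  have hk' := memLp_fracLaplacian hd hα (hχ.mode hm k) hp.out
  rw [← ENNReal.ofReal_le_ofReal_iff (by positivity), ofReal_lpn,
    ENNReal.ofReal_add ENNReal.toReal_nonneg ENNReal.toReal_nonneg,
    ENNReal.ofReal_toReal hn'.2.ne, ENNReal.ofReal_toReal hk'.2.ne, ← hωx]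
  exact eLpNorm_sub_le hn'.1 hk'.1 hp.out

/-- The pairing of the low-frequency block with the fractional Laplacian of a mode as a limit. -/
theorem IsLPCutoff.tendsto_block_zero (hd : 1 ≤ d) {α : ℝ} (hα : α ∈ Set.Ioo (0 : ℝ) 2)
    {v : 𝓢'(Eu d, ℂ)} {n : ℕ} (hn : 1 ≤ n) {a : ℂ} {η : ℝ → 𝓢(Eu d, ℂ)}
    (hη : ∀ R : ℝ, 0 < R → ∀ x, η R x = ((χ (R⁻¹ • x) : ℝ) : ℂ) * fracLaplacian α (hχ.mode hm n) x)
    (h : Tendsto (fun R => v (η R)) atTop (𝓝 a)) :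
    Tendsto (fun R => block χ 0 v (η R)) atTop (𝓝 a) := by
  have hG : Integrable (fun ξ => -((levySymbol α ξ : ℝ) : ℂ) * 𝓕 (hχ.mode hm n) ξ) := by
    refine (integrable_levySymbol_mul hd hα (𝓕 (hχ.mode hm n))).neg.congr
      (Eventually.of_forall fun ξ => ?_)
    simp
  have hcom := tendsto_commutator hχ hG
    (fun ξ hξ => hχ.norm_le_of_fourier_mode_ne_zero hm hn (right_ne_zero_of_mul hξ))
    hχ.contDiff hχ.hasCompactSupport (η := η) (fun R hR x => by
      rw [hη R hR, fracLaplacian_eq_fourierInv hd hα])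
  have h2 := ((map_continuous v).tendsto 0).comp hcom
  rw [map_zero] at h2
  have h3 := h.sub h2
  rw [sub_zero] at h3
  refine h3.congr fun R => ?_
  rw [Function.comp_apply, map_sub, sub_sub_cancel, hχ.block_apply]

end Mode

theorem iteratedFDeriv_sum_dilate (f : 𝓢(Eu d, ℂ)) (s : Finset ℕ) (b : ℕ → ℂ) (i : ℕ) :
    iteratedFDeriv ℝ i (fun ξ => ∑ j ∈ s, b j • f ((2 ^ j : ℝ) • ξ)) 0 =
      (∑ j ∈ s, b j * (((2 ^ j) ^ i : ℝ) : ℂ)) • iteratedFDeriv ℝ i f 0 := by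
  have hs : ∀ j : ℕ, ContDiff ℝ i fun ξ => f ((2 ^ j : ℝ) • ξ) := fun j =>
    (f.smooth i).comp (contDiff_const_smul _)
  have hs' : ∀ j ∈ s, ContDiff ℝ i fun ξ => b j • f ((2 ^ j : ℝ) • ξ) := fun j _ =>
    (hs j).const_smul (b j)
  rw [iteratedFDeriv_sum hs', Finset.sum_apply, Finset.sum_smul]
  refine Finset.sum_congr rfl fun j _ => ?_
  rw [iteratedFDeriv_const_smul_apply' (hs j).contDiffAt, congrFun (iteratedFDeriv_comp_const_smul
    (𝕜 := ℝ) (i := i) ((2 : ℝ) ^ j) (f.smooth i)) 0, smul_zero, mul_smul]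
  congr 1

theorem eq_zero_of_eq_neg {V : Type*} [AddCommGroup V] [Module ℝ V] {x : V} (h : x = -x) : x = 0 := by
  have h2 : (2 : ℝ) • x = 0 := by
    rw [two_smul]; nth_rewrite 1 [h]; exact neg_add_cancel x
  exact (smul_eq_zero.1 h2).resolve_left two_ne_zero

/-- The jet of a homogeneous-parity function vanishes in the other parity. -/
theorem iteratedFDeriv_eq_zero_of_parity {f : 𝓢(Eu d, ℂ)} {l i : ℕ}
    (hf : ∀ ξ, f (-ξ) = (-1) ^ l * f ξ) (hi : ¬ Even (i + l)) : iteratedFDeriv ℝ i f 0 = 0 := by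
  have h1 := congrFun (iteratedFDeriv_comp_const_smul (𝕜 := ℝ) (i := i) (-1) (f.smooth i)) 0
  have e : (fun ξ => f ((-1 : ℝ) • ξ)) = fun ξ => ((-1 : ℝ) ^ l) • f ξ := by
    ext ξ; rw [neg_one_smul, hf]; simp
  rw [e, iteratedFDeriv_const_smul_apply' (f.smooth i).contDiffAt, smul_zero] at h1
  rw [Nat.not_even_iff_odd] at hi
  rcases Nat.even_or_odd l with h | h
  · have hi' : Odd i := by
      by_contra h'
      rw [Nat.not_odd_iff_even] at h'
      exact (Nat.not_even_iff_odd.2 hi) (h'.add h)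
    rw [h.neg_one_pow, hi'.neg_one_pow, one_smul, neg_one_smul] at h1
    exact eq_zero_of_eq_neg h1
  · have hi' : Even i := by
      by_contra h'
      rw [Nat.not_even_iff_odd] at h'
      exact (Nat.not_even_iff_odd.2 hi) (h'.add_odd h)
    rw [h.neg_one_pow, hi'.neg_one_pow, one_smul, neg_one_smul] at h1
    exact eq_zero_of_eq_neg h1.symm

/-- A polynomial that vanishes at the scaling factors of all jets of the right parity. -/
theorem exists_polynomial_scaling {α : ℝ} (hα : α ∈ Set.Ioo (0 : ℝ) 2) (l N : ℕ) :
    ∃ P : Polynomial ℝ, P.eval 1 ≠ 0 ∧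
      ∀ i ≤ N, Even (i + l) → P.eval ((2 : ℝ) ^ ((i : ℝ) - l - α)) = 0 := by
  refine ⟨∏ i ∈ (Finset.range (N + 1)).filter (fun i => Even (i + l)),
    (Polynomial.X - Polynomial.C ((2 : ℝ) ^ ((i : ℝ) - l - α))), ?_, fun i hi he => ?_⟩
  · rw [Polynomial.eval_prod, Finset.prod_ne_zero_iff]
    intro i hi
    rw [Finset.mem_filter] at hi
    simp only [Polynomial.eval_sub, Polynomial.eval_X, Polynomial.eval_C]
    intro h0
    have h1 : (2 : ℝ) ^ ((i : ℝ) - l - α) = 2 ^ (0 : ℝ) := by rw [Real.rpow_zero]; linarith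
    have h2 : (i : ℝ) - l - α = 0 := by
      rcases lt_trichotomy ((i : ℝ) - l - α) 0 with h | h | h
      · exact absurd h1 (Real.rpow_lt_rpow_of_exponent_lt (by norm_num) h).ne
      · exact h
      · exact absurd h1 (Real.rpow_lt_rpow_of_exponent_lt (by norm_num) h).ne'
    have h3 : (l : ℝ) < i := by linarith [hα.1]
    have h4 : (i : ℝ) < l + 2 := by linarith [hα.2]
    have h3' : l < i := by exact_mod_cast h3
    have h4' : i < l + 2 := by exact_mod_cast h4
    obtain ⟨t, ht⟩ := hi.2
    omega
  · rw [Polynomial.eval_prod]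
    exact Finset.prod_eq_zero (Finset.mem_filter.2 ⟨Finset.mem_range.2 (by omega), he⟩) (by simp)

/-- The key estimate for the pairing with fractional Laplacians of modes: the exact scaling of the
modes and a linear recursion annihilating the jets at the origin force the pairings to decay. -/
theorem IsLPCutoff.norm_pairing_mode_le {χ : Eu d → ℝ} (hχ : IsLPCutoff χ) {m : Eu d → ℂ}
    (hm : ContDiff ℝ ((⊤ : ℕ∞) : WithTop ℕ∞) m) {l : ℕ}
    (hl : ∀ (c : ℝ) ξ, m (c • ξ) = (c ^ l : ℝ) * m ξ) (hd : 1 ≤ d) {α : ℝ}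
    (hα : α ∈ Set.Ioo (0 : ℝ) 2) {v : 𝓢'(Eu d, ℂ)} {N : ℕ} {C : ℝ}
    (hv : ∀ Φ : 𝓢(Eu d, ℂ), ‖v (𝓕⁻ Φ)‖ ≤ C * schNorm N Φ) {p : ℝ≥0∞} [hp : Fact (1 ≤ p)] {M : ℝ}
    (hM0 : 0 ≤ M)
    (hM : ∀ r R : ℝ, 0 < r → r ≤ R → ∀ φ ∈ band r R, ‖block χ 0 v φ‖ ≤ M * lpn p φ) {a : ℕ → ℂ}
    (ha : ∀ n, 1 ≤ n → HasPairing v (fracLaplacian α (hχ.mode hm n)) (a n)) {n : ℕ} (hn : 1 ≤ n) :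
    ‖a n‖ ≤ M * (eLpNorm (fracLaplacian α (hχ.mode hm n)) p volume).toReal := by
  set W : ℕ → Eu d → ℂ := fun n => fracLaplacian α (hχ.mode hm n) with hW
  set ℓ : ℕ → ℝ := fun n => (eLpNorm (W n) p volume).toReal with hℓ
  have hWp : ∀ n, MemLp (W n) p volume := fun n => memLp_fracLaplacian hd hα _ hp.out
  have hℓ0 : Tendsto ℓ atTop (𝓝 0) := hχ.tendsto_eLpNorm_fracLaplacian_mode hm hl hd hα hp.out
  have hsub : ∀ i j, 1 ≤ i → 1 ≤ j → ‖a i - a j‖ ≤ M * (ℓ i + ℓ j) := fun i j hi hj =>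
    hχ.norm_pairing_mode_sub_le hm hd hα hM0 hM hi hj (ha i hi) (ha j hj)
  obtain ⟨L, hL⟩ : ∃ L, Tendsto a atTop (𝓝 L) := by
    refine cauchySeq_tendsto_of_complete (Metric.cauchySeq_iff'.2 fun ε hε => ?_)
    have h1 : Tendsto (fun n => M * (2 * ℓ n)) atTop (𝓝 0) := by
      simpa using (hℓ0.const_mul 2).const_mul M
    have hdec : ∀ᶠ n in atTop, ℓ n < ε / (2 * (M + 1)) := hℓ0.eventually (gt_mem_nhds (by positivity))
    obtain ⟨n₀, hn₀⟩ := eventually_atTop.1 hdec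
    refine ⟨max n₀ 1, fun k hk => ?_⟩
    rw [dist_eq_norm]
    refine (hsub k _ ((le_max_right _ _).trans hk) (le_max_right _ _)).trans_lt ?_
    have e1 := hn₀ k ((le_max_left _ _).trans hk)
    have e2 := hn₀ _ (le_max_left n₀ 1)
    calc M * (ℓ k + ℓ (max n₀ 1)) ≤ M * (ε / (2 * (M + 1)) + ε / (2 * (M + 1))) := by gcongr
      _ = ε * (M / (M + 1)) := by field_simp; ring
      _ < ε * 1 := by
          gcongr
          rw [div_lt_one (by positivity)]; linarith
      _ = ε := mul_one ε
  have hχ1 : ∀ᶠ x in 𝓝 (0 : Eu d), ((χ x : ℝ) : ℂ) = 1 := by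
    filter_upwards [Metric.ball_mem_nhds (0 : Eu d) one_pos] with x hx
    rw [hχ.eq_one x (by simpa using (Metric.mem_ball.1 hx).le), Complex.ofReal_one]
  have hη : ∀ n, 1 ≤ n → ∃ η : ℝ → 𝓢(Eu d, ℂ), (∀ R : ℝ, 0 < R → ∀ x, η R x =
      ((χ (R⁻¹ • x) : ℝ) : ℂ) * W n x) ∧ Tendsto (fun R => v (η R)) atTop (𝓝 (a n)) :=
    fun n hn => ha n hn _ hχ.contDiff hχ.hasCompactSupport hχ1
  choose! η hη hηlim using hη
  have hbl : ∀ n, 1 ≤ n → Tendsto (fun R => block χ 0 v (η n R)) atTop (𝓝 (a n)) := fun n hn =>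
    hχ.tendsto_block_zero hm hd hα hn (hη n hn) (hηlim n hn)
  obtain ⟨P, hP1, hP⟩ := exists_polynomial_scaling hα l N
  set K := P.natDegree + 1 with hK
  have hlpn : ∀ n, 1 ≤ n → ∀ R : ℝ, 0 < R → lpn p (η n R) ≤ ℓ n := by
    intro n hn R hR
    rw [← ENNReal.ofReal_le_ofReal_iff ENNReal.toReal_nonneg, ofReal_lpn,
      ENNReal.ofReal_toReal (hWp n).2.ne]
    refine eLpNorm_mono fun x => ?_
    rw [hη n hn R hR, norm_mul, Complex.norm_real, Real.norm_of_nonneg (hχ.mem_Icc _).1]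
    exact mul_le_of_le_one_left (norm_nonneg _) (hχ.mem_Icc _).2
  set C₁ := kernelNorm (hχ.symbol Real.pi Real.pi_pos.ne') + kernelNorm (hχ.low 0) with hC₁
  have hC₁0 : 0 ≤ C₁ := add_nonneg (kernelNorm_nonneg _) (kernelNorm_nonneg _)
  have hrec : ∀ n, 1 ≤ n → ‖∑ j ∈ Finset.range K, (P.coeff j : ℂ) * a (n + j)‖ ≤
      C₁ * M * ∑ j ∈ Finset.range K, |P.coeff j| * ℓ (n + j) := by
    intro n hn
    set ζ : ℝ → 𝓢(Eu d, ℂ) := fun R => ∑ j ∈ Finset.range K, (P.coeff j : ℂ) • η (n + j) (2 ^ j * R)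
      with hζ
    have hfour : ∀ j, ∀ R : ℝ, 0 < R → ∀ ξ, 𝓕 (η (n + j) (2 ^ j * R)) ξ =
        (((2 ^ j) ^ l * (2 ^ j) ^ α : ℝ)⁻¹ : ℝ) * 𝓕 (η n R) ((2 ^ j : ℝ) • ξ) := by
      intro j R hR ξ
      have h2j : (0 : ℝ) < 2 ^ j := by positivity
      have h := fourier_dilate (c := (2 ^ j : ℝ)⁻¹) (by positivity) (f := η n R)
        (g := (((2 ^ j) ^ l * (2 ^ j) ^ d * (2 ^ j) ^ α : ℝ) : ℂ) • η (n + j) (2 ^ j * R)) (fun x => by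
          rw [_root_.smul_apply, hη (n + j) (by omega) _ (by positivity), hη n hn R hR, hW]
          simp only
          rw [hχ.fracLaplacian_mode_dilate hm hl, smul_eq_mul, mul_left_comm, mul_inv, mul_comm (2 ^ j : ℝ)⁻¹,
            mul_smul]
          refine congrArg _ ?_
          rw [← mul_assoc, ← Complex.ofReal_mul, mul_inv_cancel₀ (by positivity), Complex.ofReal_one,
            one_mul]) ξ
      rw [FourierTransform.fourier_smul, _root_.smul_apply, smul_eq_mul, inv_pow, inv_inv, inv_inv] at h
      have hne : (((2 ^ j) ^ l * (2 ^ j) ^ d * (2 ^ j) ^ α : ℝ) : ℂ) ≠ 0 := by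
        exact_mod_cast (by positivity : ((2 ^ j) ^ l * (2 ^ j) ^ d * (2 ^ j) ^ α : ℝ) ≠ 0)
      rw [← eq_inv_mul_iff_mul_eq₀ hne, ← mul_assoc, ← Complex.ofReal_inv, ← Complex.ofReal_mul] at h
      rw [h]
      congr 2
      field_simp
    have hpar : ∀ R : ℝ, 0 < R → ∀ ξ, 𝓕 (η n R) (-ξ) = (-1) ^ l * 𝓕 (η n R) ξ := by
      intro R hR ξ
      have hx : ∀ x, η n R (-x) = (-1) ^ l * η n R x := fun x => by
        rw [hη n hn R hR, hη n hn R hR, hW]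
        simp only
        rw [fracLaplacian_neg_arg α _ (hχ.mode_neg hm hl n), smul_neg,
          hχ.radial (-(R⁻¹ • x)) (R⁻¹ • x) (norm_neg _)]
        ring
      rw [SchwartzMap.fourier_coe, Real.fourier_eq', Real.fourier_eq', ← integral_neg_eq_self,
        ← integral_const_mul]
      congr 1; ext x
      rw [hx, inner_neg_neg]
      simp only [smul_eq_mul]; ring
    have hjet : ∀ R : ℝ, 0 < R → ∀ i ≤ N, iteratedFDeriv ℝ i (𝓕 (ζ R) : 𝓢(Eu d, ℂ)) 0 = 0 := by
      intro R hR i hi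
      have e : ((𝓕 (ζ R) : 𝓢(Eu d, ℂ)) : Eu d → ℂ) = fun ξ => ∑ j ∈ Finset.range K,
          ((P.coeff j : ℂ) * (((2 ^ j) ^ l * (2 ^ j) ^ α : ℝ)⁻¹ : ℝ)) • 𝓕 (η n R) ((2 ^ j : ℝ) • ξ) := by
        ext ξ
        have h := map_sum (FourierTransform.fourierCLM ℂ 𝓢(Eu d, ℂ))
          (fun j => (P.coeff j : ℂ) • η (n + j) (2 ^ j * R)) (Finset.range K)
        simp only [FourierTransform.fourierCLM_apply] at h
        rw [hζ]
        simp only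
        rw [h, _root_.sum_apply]
        refine Finset.sum_congr rfl fun j _ => ?_
        rw [FourierTransform.fourier_smul, _root_.smul_apply, hfour j R hR, smul_eq_mul, smul_eq_mul]
        ring
      rw [e, iteratedFDeriv_sum_dilate]
      by_cases hev : Even (i + l)
      · have hz : ∑ j ∈ Finset.range K, ((P.coeff j : ℂ) * (((2 ^ j) ^ l * (2 ^ j) ^ α : ℝ)⁻¹ : ℝ)) *
            (((2 ^ j) ^ i : ℝ) : ℂ) = ((P.eval ((2 : ℝ) ^ ((i : ℝ) - l - α)) : ℝ) : ℂ) := by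
          rw [Polynomial.eval_eq_sum_range, Complex.ofReal_sum]
          refine Finset.sum_congr rfl fun j _ => ?_
          rw [mul_assoc, ← Complex.ofReal_mul, ← Complex.ofReal_mul]
          congr 2
          rw [Real.rpow_sub (by norm_num), Real.rpow_sub (by norm_num), Real.rpow_natCast,
            Real.rpow_natCast, div_pow, div_pow, ← Real.rpow_natCast ((2 : ℝ) ^ α) j,
            ← Real.rpow_mul (by norm_num), mul_comm α, Real.rpow_mul (by norm_num), Real.rpow_natCast,
            ← pow_mul, ← pow_mul, ← pow_mul, ← pow_mul, mul_comm i, mul_comm l]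
          field_simp
        rw [hz, hP i hi hev, Complex.ofReal_zero, zero_smul]
      · rw [iteratedFDeriv_eq_zero_of_parity (hpar R hR) hev, smul_zero]
    have hlim : Tendsto (fun R => block χ 0 v (ζ R)) atTop
        (𝓝 (∑ j ∈ Finset.range K, (P.coeff j : ℂ) * a (n + j))) := by
      have e : ∀ R, block χ 0 v (ζ R) =
          ∑ j ∈ Finset.range K, (P.coeff j : ℂ) * block χ 0 v (η (n + j) (2 ^ j * R)) := fun R => by
        rw [hζ]; simp only [map_sum, map_smul, smul_eq_mul]
      simp_rw [e]
      refine tendsto_finsetSum _ fun j _ => Tendsto.const_mul _ ?_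
      exact (hbl (n + j) (by omega)).comp (tendsto_id.const_mul_atTop (by positivity))
    refine le_of_tendsto hlim.norm ?_
    filter_upwards [eventually_gt_atTop 0] with R hR
    refine (norm_block_le_of_jet hχ hv hM0 hM (hjet R hR)).trans ?_
    refine mul_le_mul_of_nonneg_left ?_ (by positivity)
    refine (lpn_sum_le p _ _).trans (Finset.sum_le_sum fun j _ => ?_)
    rw [lpn_smul, Complex.norm_real, Real.norm_eq_abs]
    exact mul_le_mul_of_nonneg_left (hlpn (n + j) (by omega) _ (by positivity)) (abs_nonneg _)
  have hL0 : L = 0 := by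
    have h1 : Tendsto (fun n => ‖∑ j ∈ Finset.range K, (P.coeff j : ℂ) * a (n + j)‖) atTop
        (𝓝 ‖∑ j ∈ Finset.range K, (P.coeff j : ℂ) * L‖) :=
      (tendsto_finsetSum _ fun j _ => Tendsto.const_mul _
        (hL.comp (tendsto_add_atTop_nat j))).norm
    have h2 : Tendsto (fun n => C₁ * M * ∑ j ∈ Finset.range K, |P.coeff j| * ℓ (n + j)) atTop
        (𝓝 (C₁ * M * ∑ j ∈ Finset.range K, |P.coeff j| * 0)) :=
      (tendsto_finsetSum _ fun j _ => Tendsto.const_mul _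
        (hℓ0.comp (tendsto_add_atTop_nat j))).const_mul _
    have h3 := le_of_tendsto_of_tendsto h1 h2 (by
      filter_upwards [eventually_ge_atTop 1] with n hn using hrec n hn)
    simp only [mul_zero, Finset.sum_const_zero] at h3
    rw [← Finset.sum_mul] at h3
    have h4 := norm_le_zero_iff.1 h3
    refine (mul_eq_zero.1 h4).resolve_left fun h5 => hP1 ?_
    rw [Polynomial.eval_eq_sum_range]
    simp only [one_pow, mul_one]
    exact_mod_cast h5
  rw [hL0] at hL
  have h1 : Tendsto (fun k => ‖a n - a k‖) atTop (𝓝 ‖a n - 0‖) := (hL.const_sub (a n)).norm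
  have h2 : Tendsto (fun k => M * (ℓ n + ℓ k)) atTop (𝓝 (M * (ℓ n + 0))) :=
    (hℓ0.const_add _).const_mul _
  rw [sub_zero] at h1
  rw [add_zero] at h2
  exact le_of_tendsto_of_tendsto h1 h2 (by
    filter_upwards [eventually_ge_atTop 1] with k hk using hsub n k hn hk)

end

section

variable {d : ℕ}

/-- The derivatives of a Fourier transform are symmetric. -/
theorem iteratedFDeriv_fourier_perm (φ : 𝓢(Eu d, ℂ)) (n : ℕ) (σ : Equiv.Perm (Fin n)) (ξ : Eu d)
    (v : Fin n → Eu d) : iteratedFDeriv ℝ n (𝓕 φ : 𝓢(Eu d, ℂ)) ξ (fun i => v (σ i)) =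
      iteratedFDeriv ℝ n (𝓕 φ : 𝓢(Eu d, ℂ)) ξ v := by
  have hint : ∀ n : ℕ, Integrable fun x : Eu d => ‖x‖ ^ n * ‖φ x‖ := fun n => φ.integrable_pow_mul volume n
  rw [SchwartzMap.fourier_coe, Real.iteratedFDeriv_fourier (N := ⊤) (fun n _ => hint n)
    φ.continuous.aestronglyMeasurable le_top, Real.fourier_eq]
  have h1 : Integrable fun x : Eu d => Real.fourierChar (-inner ℝ x ξ) •
      VectorFourier.fourierPowSMulRight (innerSL ℝ) φ x n :=
    (VectorFourier.fourierIntegral_convergent_iff (L := innerₗ (Eu d)) Real.continuous_fourierChar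
      continuous_inner ξ).2 (VectorFourier.integrable_fourierPowSMulRight (innerSL ℝ) (hint n)
        φ.continuous.aestronglyMeasurable)
  rw [ContinuousMultilinearMap.integral_apply h1, ContinuousMultilinearMap.integral_apply h1]
  congr 1; ext x
  rw [Circle.smul_def, _root_.smul_apply, _root_.smul_apply,
    VectorFourier.fourierPowSMulRight_apply, VectorFourier.fourierPowSMulRight_apply,
    Equiv.prod_comp σ (fun i => innerSL ℝ x (v i))]

/-- The homogeneous Taylor polynomial of degree `l` at the origin. -/
def taylorTerm (Ψ : 𝓢(Eu d, ℂ)) (l : ℕ) (ξ : Eu d) : ℂ :=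
  ((l.factorial : ℝ)⁻¹) • iteratedFDeriv ℝ l Ψ 0 fun _ => ξ

theorem contDiff_taylorTerm (Ψ : 𝓢(Eu d, ℂ)) (l : ℕ) :
    ContDiff ℝ ((⊤ : ℕ∞) : WithTop ℕ∞) (taylorTerm Ψ l) :=
  ((iteratedFDeriv ℝ l Ψ 0).contDiff.comp (contDiff_pi.2 fun _ => contDiff_id)).const_smul _

theorem taylorTerm_smul (Ψ : 𝓢(Eu d, ℂ)) (l : ℕ) (c : ℝ) (ξ : Eu d) :
    taylorTerm Ψ l (c • ξ) = (c ^ l : ℝ) * taylorTerm Ψ l ξ := by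
  have h := (iteratedFDeriv ℝ l Ψ 0).map_smul_univ (fun _ => c) (fun _ => ξ)
  rw [Finset.prod_const, Finset.card_univ, Fintype.card_fin] at h
  rw [taylorTerm, taylorTerm, h, smul_comm, Complex.real_smul]

theorem iteratedFDeriv_taylorTerm_of_ne (Ψ : 𝓢(Eu d, ℂ)) {l i : ℕ} (h : i ≠ l) :
    iteratedFDeriv ℝ i (taylorTerm Ψ l) 0 = 0 := by
  have hc : ContDiff ℝ i (taylorTerm Ψ l) := (contDiff_taylorTerm Ψ l).of_le (by exact_mod_cast le_top)
  have h1 := congrFun (iteratedFDeriv_comp_const_smul (𝕜 := ℝ) (i := i) 2 hc) 0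
  have e : (fun ξ => taylorTerm Ψ l ((2 : ℝ) • ξ)) = fun ξ => ((2 : ℝ) ^ l) • taylorTerm Ψ l ξ := by
    ext ξ; rw [taylorTerm_smul, Complex.real_smul]
  rw [e, iteratedFDeriv_const_smul_apply' hc.contDiffAt, smul_zero] at h1
  have h2 : ((2 : ℝ) ^ l - 2 ^ i) • iteratedFDeriv ℝ i (taylorTerm Ψ l) 0 = 0 := by
    rw [sub_smul, h1, sub_self]
  refine (smul_eq_zero.1 h2).resolve_left (sub_ne_zero.2 fun h3 => h ?_)
  exact (Nat.pow_right_injective le_rfl (by exact_mod_cast h3 : 2 ^ l = 2 ^ i)).symm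

theorem iteratedFDeriv_taylorTerm_self (φ : 𝓢(Eu d, ℂ)) (l : ℕ) :
    iteratedFDeriv ℝ l (taylorTerm (𝓕 φ) l) 0 = iteratedFDeriv ℝ l (𝓕 φ : 𝓢(Eu d, ℂ)) 0 := by
  have hc : ContDiff ℝ l fun ξ : Eu d => iteratedFDeriv ℝ l (𝓕 φ : 𝓢(Eu d, ℂ)) 0 fun _ => ξ :=
    (iteratedFDeriv ℝ l (𝓕 φ : 𝓢(Eu d, ℂ)) 0).contDiff.comp (contDiff_pi.2 fun _ => contDiff_id)
  change iteratedFDeriv ℝ l (fun ξ => ((l.factorial : ℝ)⁻¹) •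
    iteratedFDeriv ℝ l (𝓕 φ : 𝓢(Eu d, ℂ)) 0 fun _ => ξ) 0 = _
  rw [iteratedFDeriv_const_smul_apply' hc.contDiffAt]
  ext v
  rw [_root_.smul_apply, ContinuousMultilinearMap.iteratedFDeriv_comp_diagonal,
    Finset.sum_congr rfl fun σ _ => iteratedFDeriv_fourier_perm φ l σ 0 v, Finset.sum_const,
    Finset.card_univ, Fintype.card_perm, Fintype.card_fin, ← Nat.cast_smul_eq_nsmul ℝ, smul_smul,
    inv_mul_cancel₀ (by positivity), one_smul]

section Low

variable {χ : Eu d → ℝ} (hχ : IsLPCutoff χ)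

/-- The low-frequency part of the Taylor polynomial of a Fourier transform. -/
def IsLPCutoff.taylorPart (φ : 𝓢(Eu d, ℂ)) (N n : ℕ) : 𝓢(Eu d, ℂ) :=
  ∑ l ∈ Finset.range (N + 1), hχ.mode (contDiff_taylorTerm (𝓕 φ) l) n

theorem IsLPCutoff.fourier_taylorPart (φ : 𝓢(Eu d, ℂ)) (N n : ℕ) (ξ : Eu d) :
    𝓕 (hχ.taylorPart φ N n) ξ =
      hχ.low n ξ * ∑ l ∈ Finset.range (N + 1), taylorTerm (𝓕 φ) l ξ := by
  have h := map_sum (FourierTransform.fourierCLM ℂ 𝓢(Eu d, ℂ))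
    (fun l => hχ.mode (contDiff_taylorTerm (𝓕 φ) l) n) (Finset.range (N + 1))
  simp only [FourierTransform.fourierCLM_apply] at h
  rw [IsLPCutoff.taylorPart, h, _root_.sum_apply, Finset.mul_sum]
  exact Finset.sum_congr rfl fun l _ => hχ.fourier_mode _ _ _

theorem IsLPCutoff.iteratedFDeriv_sub_taylorPart (φ : 𝓢(Eu d, ℂ)) {N i : ℕ} (hi : i ≤ N) :
    iteratedFDeriv ℝ i (𝓕 φ - 𝓕 (hχ.taylorPart φ N 0) : 𝓢(Eu d, ℂ)) 0 = 0 := by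
  have hpi := Real.pi_pos
  have e1 : (𝓕 (hχ.taylorPart φ N 0) : 𝓢(Eu d, ℂ)) =ᶠ[𝓝 0]
      fun ξ => ∑ l ∈ Finset.range (N + 1), taylorTerm (𝓕 φ) l ξ := by
    filter_upwards [Metric.ball_mem_nhds (0 : Eu d) (ε := 1 / (2 * Real.pi)) (by positivity)] with ξ hξ
    rw [hχ.fourier_taylorPart, hχ.low_eq_one, one_mul]
    have : ‖ξ‖ < 1 / (2 * Real.pi) := mem_ball_zero_iff.1 hξ
    rw [lt_div_iff₀ (by positivity)] at this
    rw [pow_zero]; linarith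
  have e2 := (e1.iteratedFDeriv ℝ i).eq_of_nhds
  have h3 : ∀ l ∈ Finset.range (N + 1), ContDiff ℝ i (taylorTerm (𝓕 φ) l) := fun l _ =>
    (contDiff_taylorTerm _ l).of_le (by exact_mod_cast le_top)
  rw [iteratedFDeriv_sum h3, Finset.sum_apply, Finset.sum_eq_single_of_mem i (by simp; omega)
    fun l _ hl => iteratedFDeriv_taylorTerm_of_ne _ hl.symm, iteratedFDeriv_taylorTerm_self] at e2
  have e3 : ((𝓕 φ - 𝓕 (hχ.taylorPart φ N 0) : 𝓢(Eu d, ℂ)) : Eu d → ℂ) =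
      (𝓕 φ : 𝓢(Eu d, ℂ)) - (𝓕 (hχ.taylorPart φ N 0) : 𝓢(Eu d, ℂ)) := rfl
  rw [e3, iteratedFDeriv_sub_apply ((𝓕 φ : 𝓢(Eu d, ℂ)).smooth i).contDiffAt
    ((𝓕 (hχ.taylorPart φ N 0) : 𝓢(Eu d, ℂ)).smooth i).contDiffAt, e2, sub_self]

/-- The remainder of the Taylor expansion is negligible at low frequencies. -/
theorem IsLPCutoff.fourier_low_sub_taylorPart (φ : 𝓢(Eu d, ℂ)) (N : ℕ) {n : ℕ} (hn : 1 ≤ n) :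
    mult (hχ.low n : Eu d → ℂ) φ - hχ.taylorPart φ N n = 𝓕⁻ (SchwartzMap.smulLeftCLM ℂ
      (fun ξ => ((χ ((2 * Real.pi) • ((2 ^ n : ℝ) • ξ)) : ℝ) : ℂ))
      (𝓕 φ - 𝓕 (hχ.taylorPart φ N 0))) := by
  have e : (fun ξ => ((χ ((2 * Real.pi) • ((2 ^ n : ℝ) • ξ)) : ℝ) : ℂ)) = (hχ.low n : Eu d → ℂ) := by
    ext ξ; rw [hχ.low_apply, smul_smul]
  rw [e]
  refine schwartz_ext_fourier fun ξ => ?_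
  rw [FourierTransform.fourier_fourierInv_eq, fourier_sub_apply,
    fourier_mult (hχ.low n).hasTemperateGrowth,
    SchwartzMap.smulLeftCLM_apply_apply (hχ.low n).hasTemperateGrowth, _root_.sub_apply,
    hχ.fourier_taylorPart, hχ.fourier_taylorPart, smul_eq_mul]
  by_cases h : hχ.low n ξ = 0
  · rw [h]; ring
  · rw [hχ.low_eq_one (n := 0), one_mul, mul_sub]
    have h1 := hχ.norm_le_of_low_ne_zero hn h
    have hpi := Real.pi_pos
    rw [le_div_iff₀ (by positivity)] at h1
    rw [pow_zero]; linarith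

end Low

set_option maxHeartbeats 800000 in
/-- The low-frequency block of a solution. -/
theorem exists_lowBlock_bound (hd : 1 ≤ d) {χ : Eu d → ℝ} (hχ : IsLPCutoff χ) {α : ℝ}
    (hα : α ∈ Set.Ioo (0 : ℝ) 2) : ∃ C : ℝ, 0 < C ∧
    ∀ {T : ℝ} {u₀ : 𝓢'(Eu d, ℂ)} {u f : ℝ → 𝓢'(Eu d, ℂ)}, 0 ≤ T → IsWeakSolution α T u₀ u f →
    ∀ {p p' : ℝ≥0∞} [Fact (1 ≤ p)] [Fact (1 ≤ p')] [p.HolderConjugate p']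
      {β : ℝ → ℝ}, (∀ s, 0 ≤ β s) → IntervalIntegrable β volume 0 T →
      (∀ ψ, ∀ᵐ s, s ∈ Set.Ioc 0 T → ‖block χ 0 (f s) ψ‖ ≤ β s * lpn p' ψ) →
      ∀ {m : ℝ}, 0 ≤ m → (∀ ψ, ‖block χ 0 u₀ ψ‖ ≤ m * lpn p' ψ) →
      ∀ {t : ℝ}, t ∈ Set.Icc 0 T → distLpNorm p (block χ 0 (u t)) ≤ ENNReal.ofReal
        (C * (m + ∫ s in 0..T, β s)) := by
  obtain ⟨l₀, hl₀, H⟩ := exists_block_decay hd hχ hα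
  set k₁ := kernelNorm (hχ.symbol Real.pi Real.pi_pos.ne')
  set k₂ := kernelNorm (hχ.low 0)
  have hk₁ : 0 ≤ k₁ := kernelNorm_nonneg _
  have hk₂ : 0 ≤ k₂ := kernelNorm_nonneg _
  refine ⟨k₁ + 2 * k₂ + 1, by positivity, ?_⟩
  intro T u₀ u f hT hw p p' _ hp' _ β hβ0 hβi hβ m hm0 hm t ht
  set B := ∫ s in 0..T, β s with hB
  have hB0 : 0 ≤ B := intervalIntegral.integral_nonneg hT fun s _ => hβ0 s
  set M := m + B with hM
  have hM0 : 0 ≤ M := by positivity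
  have hmono : ∀ s ∈ Set.Icc 0 T, ∫ τ in 0..s, β τ ≤ B := fun s hs =>
    intervalIntegral.integral_mono_interval le_rfl hs.1 hs.2 (Eventually.of_forall hβ0) hβi
  have hoff : ∀ s ∈ Set.Icc 0 T, ∀ r R : ℝ, 0 < r → r ≤ R → ∀ φ ∈ band r R,
      ‖block χ 0 (u s) φ‖ ≤ M * lpn p' φ := by
    intro s hs r R hr hrR φ hφ
    have h := H hT hw 0 (l := 0) hr hrR le_rfl (by positivity) hβ0 hβi (fun ψ _ => hβ ψ) hm0
      (fun ψ _ => hm ψ) hs hφ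
    simp only [neg_zero, zero_mul, Real.exp_zero, one_mul] at h
    exact h.trans (mul_le_mul_of_nonneg_right (by rw [hM]; linarith [hmono s hs]) (lpn_nonneg _ _))
  have hmain : ∀ φ, ‖block χ 0 (u t) φ‖ ≤ (k₁ + 2 * k₂) * M * lpn p' φ := by
    intro φ
    set L : 𝓢(Eu d, ℂ) →ₗ[ℂ] ℂ × Lp ℂ p' (volume : Measure (Eu d)) :=
      ((distLin (u t)).prod (SchwartzMap.toLpCLM ℂ ℂ p' volume).toLinearMap).comp
        (FourierTransform.fourierInvCLM ℂ 𝓢(Eu d, ℂ) : 𝓢(Eu d, ℂ) →L[ℂ] 𝓢(Eu d, ℂ)).toLinearMap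
    have hL : Continuous L := ((continuous_tempered (u t)).prodMk
      (SchwartzMap.toLpCLM ℂ ℂ p' volume).continuous).comp
        (FourierTransform.fourierInvCLM ℂ 𝓢(Eu d, ℂ)).continuous
    obtain ⟨N, C, hC0, hC⟩ := exists_norm_le_schNorm L hL
    have hC1 : ∀ Φ : 𝓢(Eu d, ℂ), ‖u t (𝓕⁻ Φ)‖ ≤ C * schNorm N Φ := fun Φ =>
      (le_max_left _ _).trans (hC Φ)
    have hC2 : ∀ Φ : 𝓢(Eu d, ℂ), lpn p' (𝓕⁻ Φ) ≤ C * schNorm N Φ := fun Φ =>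
      (le_max_right _ _).trans (hC Φ)
    have hb : ContDiff ℝ ((⊤ : ℕ∞) : WithTop ℕ∞) (fun ξ => ((χ ((2 * Real.pi) • ξ) : ℝ) : ℂ)) :=
      contDiff_dilate hχ.contDiff _
    have hlim := tendsto_schNorm_of_jet hb (fun ξ hξ => by
      rw [hχ.eq_zero, Complex.ofReal_zero]
      rw [norm_smul_of_nonneg' (by positivity)]
      nlinarith [Real.pi_gt_three]) (N := N) fun i hi => hχ.iteratedFDeriv_sub_taylorPart φ hi
    set S : ℕ → ℝ := fun n => C * schNorm N (SchwartzMap.smulLeftCLM ℂ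
      (fun ξ => ((χ ((2 * Real.pi) • ((2 ^ n : ℝ) • ξ)) : ℝ) : ℂ))
      (𝓕 φ - 𝓕 (hχ.taylorPart φ N 0))) with hS
    have hSlim : Tendsto S atTop (𝓝 0) := by
      have := hlim.const_mul C
      rwa [mul_zero] at this
    obtain ⟨ℓ, hℓ⟩ : ∃ ℓ : ℕ → ℕ → ℝ, ℓ = fun l n => (eLpNorm (fracLaplacian α
      (hχ.mode (contDiff_taylorTerm (𝓕 φ) l) n)) p' volume).toReal := ⟨_, rfl⟩
    have hℓ0 : ∀ l n, 0 ≤ ℓ l n := fun l n => by rw [hℓ]; exact ENNReal.toReal_nonneg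
    have hℓlim : ∀ l, Tendsto (ℓ l) atTop (𝓝 0) := fun l => by
      rw [hℓ]
      exact hχ.tendsto_eLpNorm_fracLaplacian_mode _ (taylorTerm_smul _ l) hd hα hp'.out
    have hwk : ∀ l n, ∃ w : ℝ → ℂ, (∀ᵐ s ∂(volume.restrict (Set.Icc 0 T)), HasPairing (u s)
        (fracLaplacian α (hχ.mode (contDiff_taylorTerm (𝓕 φ) l) n)) (w s)) ∧
        u t (hχ.mode (contDiff_taylorTerm (𝓕 φ) l) n) =
          u₀ (hχ.mode (contDiff_taylorTerm (𝓕 φ) l) n) + (∫ s in (0 : ℝ)..t, w s) +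
          ∫ s in (0 : ℝ)..t, f s (hχ.mode (contDiff_taylorTerm (𝓕 φ) l) n) := fun l n => by
      obtain ⟨-, w, h1, -, h2⟩ := hw (hχ.mode (contDiff_taylorTerm (𝓕 φ) l) n)
      exact ⟨w, h1, h2 t ht⟩
    choose w hw1 hw2 using hwk
    have hwb : ∀ l n, 1 ≤ n → ‖∫ s in (0 : ℝ)..t, w l n s‖ ≤ M * ℓ l n * T := by
      intro l n hn
      have hae : ∀ᵐ s ∂(volume.restrict (Set.Icc 0 T)), ‖w l n s‖ ≤ M * ℓ l n := by
        filter_upwards [ae_all_iff.2 (hw1 l), ae_restrict_mem measurableSet_Icc] with s hs hsT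
        obtain ⟨N', C', -, hC'⟩ := exists_norm_le_schNorm ((distLin (u s)).comp
          (FourierTransform.fourierInvCLM ℂ 𝓢(Eu d, ℂ) : 𝓢(Eu d, ℂ) →L[ℂ] 𝓢(Eu d, ℂ)).toLinearMap)
          ((continuous_tempered (u s)).comp (FourierTransform.fourierInvCLM ℂ 𝓢(Eu d, ℂ)).continuous)
        rw [hℓ]
        exact hχ.norm_pairing_mode_le _ (taylorTerm_smul _ l) hd hα hC' hM0 (hoff s hsT)
          (fun k _ => hs k) hn
      rw [ae_restrict_iff' measurableSet_Icc] at hae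
      refine (intervalIntegral.norm_integral_le_of_norm_le_const_ae (C := M * ℓ l n) ?_).trans ?_
      · filter_upwards [hae] with s hs hst
        rw [Set.uIoc_of_le ht.1] at hst
        exact hs ⟨hst.1.le, hst.2.trans ht.2⟩
      · rw [sub_zero, abs_of_nonneg ht.1]
        exact mul_le_mul_of_nonneg_left ht.2 (mul_nonneg hM0 (hℓ0 l n))
    have hn : ∀ n, 1 ≤ n → ‖block χ 0 (u t) φ‖ ≤ (k₁ + k₂) * M * lpn p' φ + (S n +
        (M * (k₂ * lpn p' φ + S n) + ∑ l ∈ Finset.range (N + 1), M * ℓ l n * T)) := by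
      intro n hn
      set P := hχ.taylorPart φ N n with hP
      have hrest := hχ.fourier_low_sub_taylorPart φ N hn
      have h1 : ‖u t (mult (hχ.low n : Eu d → ℂ) φ - P)‖ ≤ S n := by
        rw [hrest]; exact hC1 _
      have h2 : lpn p' P ≤ k₂ * lpn p' φ + S n := by
        have e : P = mult (hχ.low n : Eu d → ℂ) φ - (mult (hχ.low n : Eu d → ℂ) φ - P) := by abel
        rw [e]
        refine (lpn_sub_le p' _ _).trans (add_le_add ?_ ?_)
        · have := lpn_mult_le p' (hχ.low n) φ
          rwa [hχ.kernelNorm_low] at this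
        · rw [hrest]; exact hC2 _
      have hPb : ∀ v : 𝓢'(Eu d, ℂ), v P = block χ 0 v P := fun v => by
        rw [hχ.block_apply, hχ.mult_bsym_zero]
        intro ξ hξ
        rw [hP, hχ.fourier_taylorPart] at hξ
        exact hχ.norm_le_of_low_ne_zero hn (left_ne_zero_of_mul hξ)
      have hfi : ∀ ψ, IntervalIntegrable (fun s => f s ψ) volume 0 t := fun ψ =>
        (hw ψ).1.mono_set (by rw [Set.uIcc_of_le ht.1, Set.uIcc_of_le hT]; exact Set.Icc_subset_Icc_right ht.2)
      have hPe : u t P = u₀ P + (∑ l ∈ Finset.range (N + 1), ∫ s in (0 : ℝ)..t, w l n s) +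
          ∫ s in (0 : ℝ)..t, f s P := by
        have e : ∀ v : 𝓢'(Eu d, ℂ), v P = ∑ l ∈ Finset.range (N + 1),
            v (hχ.mode (contDiff_taylorTerm (𝓕 φ) l) n) := fun v => by
          rw [hP, IsLPCutoff.taylorPart, map_sum]
        simp_rw [e, hw2]
        rw [intervalIntegral.integral_finsetSum fun l _ => hfi _, Finset.sum_add_distrib,
          Finset.sum_add_distrib]
      have h3 : ‖u t P‖ ≤ M * lpn p' P + ∑ l ∈ Finset.range (N + 1), M * ℓ l n * T := by
        rw [hPe]
        have e1 : ‖u₀ P‖ ≤ m * lpn p' P := by rw [hPb]; exact hm P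
        have e2 : ‖∑ l ∈ Finset.range (N + 1), ∫ s in (0 : ℝ)..t, w l n s‖ ≤
            ∑ l ∈ Finset.range (N + 1), M * ℓ l n * T :=
          (norm_sum_le _ _).trans (Finset.sum_le_sum fun l _ => hwb l n hn)
        have e3 : ‖∫ s in (0 : ℝ)..t, f s P‖ ≤ B * lpn p' P := by
          refine (intervalIntegral.norm_integral_le_of_norm_le ht.1 (g := fun s => β s * lpn p' P) ?_ ?_).trans ?_
          · filter_upwards [hβ P] with s hs hst
            rw [hPb]
            exact hs ⟨hst.1, hst.2.trans ht.2⟩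
          · exact (hβi.mono_set (by
              rw [Set.uIcc_of_le ht.1, Set.uIcc_of_le hT]; exact Set.Icc_subset_Icc_right ht.2)).mul_const _
          · rw [intervalIntegral.integral_mul_const]
            exact mul_le_mul_of_nonneg_right (hmono t ht) (lpn_nonneg _ _)
        have e4 := norm_add_le (u₀ P + ∑ l ∈ Finset.range (N + 1), ∫ s in (0 : ℝ)..t, w l n s)
          (∫ s in (0 : ℝ)..t, f s P)
        have e5 := norm_add_le (u₀ P) (∑ l ∈ Finset.range (N + 1), ∫ s in (0 : ℝ)..t, w l n s)
        rw [hM, add_mul]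
        linarith
      refine (hχ.norm_block_zero_le hM0 (hoff t ht) φ hn).trans (add_le_add le_rfl ?_)
      have e : mult (hχ.low n : Eu d → ℂ) φ = (mult (hχ.low n : Eu d → ℂ) φ - P) + P := by abel
      rw [e, map_add]
      refine (norm_add_le _ _).trans (add_le_add h1 (h3.trans (add_le_add ?_ le_rfl)))
      exact mul_le_mul_of_nonneg_left h2 hM0
    have hfin : Tendsto (fun n => (k₁ + k₂) * M * lpn p' φ + (S n +
        (M * (k₂ * lpn p' φ + S n) + ∑ l ∈ Finset.range (N + 1), M * ℓ l n * T))) atTop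
        (𝓝 ((k₁ + k₂) * M * lpn p' φ + (0 +
        (M * (k₂ * lpn p' φ + 0) + ∑ l ∈ Finset.range (N + 1), M * 0 * T)))) :=
      (hSlim.add (((hSlim.const_add _).const_mul _).add (tendsto_finsetSum _ fun l _ =>
        ((hℓlim l).const_mul M).mul_const T))).const_add _
    have := ge_of_tendsto hfin (by filter_upwards [eventually_ge_atTop 1] with n h using hn n h)
    refine this.trans (le_of_eq ?_)
    simp only [mul_zero, zero_mul, Finset.sum_const_zero]
    ring
  refine distLpNorm_le_of_forall (p' := p') (by positivity) (fun φ => (hmain φ).trans ?_)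
    (hχ.symbol Real.pi Real.pi_pos.ne') fun φ => ?_
  · have := mul_nonneg hM0 (lpn_nonneg p' φ)
    rw [add_mul _ 1, add_mul _ (1 * M), one_mul]
    linarith
  · rw [hχ.block_apply, hχ.block_apply]
    congr 1
    refine schwartz_ext_fourier fun ξ => ?_
    rw [fourier_mult (hχ.hasTemperateGrowth_bsym 0), fourier_mult (hχ.hasTemperateGrowth_bsym 0),
      fourier_mult (hχ.symbol _ _).hasTemperateGrowth, hχ.symbol_apply, bsym_zero]
    rcases le_or_gt ‖Real.pi • ξ‖ 1 with h | h
    · rw [hχ.eq_one _ h]; simp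
    · rw [hχ.eq_zero ((2 * Real.pi) • ξ)]
      · simp
      · rw [mul_smul, norm_smul, Real.norm_ofNat]; linarith

end

section

/-- Every function has a largest measurable minorant. -/
theorem exists_measurable_minorant {X : Type*} [MeasurableSpace X] (μ : Measure X) [IsFiniteMeasure μ]
    (h : X → ℝ≥0∞) : ∃ g : X → ℝ≥0∞, Measurable g ∧ g ≤ h ∧
      ∀ k : X → ℝ≥0∞, AEMeasurable k μ → k ≤ h → k ≤ᵐ[μ] g := by
  choose g hg hgh hgi using fun N : ℕ => exists_measurable_le_lintegral_eq (μ := μ) fun x => min (h x) N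
  refine ⟨fun x => ⨆ N, g N x, Measurable.iSup hg,
    fun x => iSup_le fun N => (hgh N x).trans (min_le_left _ _), fun k hk hkh => ?_⟩
  have h1 : ∀ N : ℕ, ∀ᵐ x ∂μ, min (k x) N ≤ g N x := by
    intro N
    have hm : AEMeasurable (fun x => max (g N x) (min (k x) N)) μ :=
      (hg N).aemeasurable.max (hk.min aemeasurable_const)
    have hle : (∫⁻ x, max (g N x) (min (k x) N) ∂μ) ≤ ∫⁻ x, g N x ∂μ := by
      rw [← hgi N]
      exact lintegral_mono fun x => max_le (hgh N x) (min_le_min (hkh x) le_rfl)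
    have hfin : (∫⁻ x, g N x ∂μ) ≠ ⊤ := by
      refine ne_top_of_le_ne_top (b := ∫⁻ _, (N : ℝ≥0∞) ∂μ) ?_
        (lintegral_mono fun x => (hgh N x).trans (min_le_right _ _))
      rw [lintegral_const]
      exact ENNReal.mul_ne_top (ENNReal.natCast_ne_top N) (measure_ne_top μ _)
    filter_upwards [ae_eq_of_ae_le_of_lintegral_le (f := g N)
      (Eventually.of_forall fun x => le_max_left _ _) hfin hm hle] with x hx
    rw [hx]; exact le_max_right _ _
  filter_upwards [ae_all_iff.2 h1] with x hx
  have h2 : k x = ⨆ N : ℕ, min (k x) N := by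
    rw [← inf_iSup_eq (f := fun N : ℕ => (N : ℝ≥0∞)), ENNReal.iSup_natCast, inf_top_eq]
  rw [h2]
  exact iSup_mono hx

theorem eLpNorm_const_mul_ennreal {X : Type*} [MeasurableSpace X] {μ : Measure X} {q : ℝ≥0∞}
    (hq : q ≠ 0) (c : ℝ≥0∞) {g : X → ℝ≥0∞} (hg : AEMeasurable g μ) :
    eLpNorm (fun x => c * g x) q μ = c * eLpNorm g q μ := by
  rcases eq_or_ne q ⊤ with rfl | hqt
  · simp only [eLpNorm_exponent_top, eLpNormEssSup, enorm_eq_self]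
    exact ENNReal.essSup_const_mul
  · have hq0 := ENNReal.toReal_pos hq hqt
    rw [eLpNorm_eq_lintegral_rpow_enorm_toReal hq hqt, eLpNorm_eq_lintegral_rpow_enorm_toReal hq hqt]
    simp only [enorm_eq_self]
    simp_rw [ENNReal.mul_rpow_of_nonneg _ _ hq0.le]
    rw [lintegral_const_mul'' _ (hg.pow_const _), ENNReal.mul_rpow_of_nonneg _ _ (by positivity),
      ← ENNReal.rpow_mul, mul_one_div_cancel hq0.ne', ENNReal.rpow_one]

/-- The order of mixed norms in `L^q(ℓ^q)` does not matter. -/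
theorem eLpNorm_eLpNorm_count {X : Type*} [MeasurableSpace X] {μ : Measure X} {q : ℝ≥0∞}
    (hq : q ≠ 0) {x : ℕ → X → ℝ≥0∞} (hx : ∀ n, Measurable (x n)) :
    eLpNorm (fun t => eLpNorm (fun n => x n t) q Measure.count) q μ =
      eLpNorm (fun n => eLpNorm (x n) q μ) q Measure.count := by
  rcases eq_or_ne q ⊤ with rfl | hqt
  · simp only [eLpNorm_exponent_top, eLpNormEssSup_count, enorm_eq_self]
    simp only [eLpNormEssSup, enorm_eq_self]
    refine le_antisymm ?_ (iSup_le fun n => essSup_mono_ae (Eventually.of_forall fun t =>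
      le_iSup (fun n => x n t) n))
    refine essSup_le_of_ae_le _ ?_
    filter_upwards [ae_all_iff.2 fun n => ENNReal.ae_le_essSup (μ := μ) (x n)] with t ht
    exact iSup_mono ht
  · have hq0 := ENNReal.toReal_pos hq hqt
    simp only [eLpNorm_eq_lintegral_rpow_enorm_toReal hq hqt, enorm_eq_self, lintegral_count,
      ← ENNReal.rpow_mul, one_div_mul_cancel hq0.ne', ENNReal.rpow_one]
    rw [lintegral_tsum fun n => ((hx n).pow_const _).aemeasurable]

theorem besovNorm_eq_eLpNorm {d : ℕ} (χ : Eu d → ℝ) (s : ℝ) (p q : ℝ≥0∞) [Fact (1 ≤ p)] (hq : q ≠ 0)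
    (v : 𝓢'(Eu d, ℂ)) : besovNorm χ s p q v =
      eLpNorm (fun n : ℕ => (2 : ℝ≥0∞) ^ (s * ((n : ℝ) - 1)) * distLpNorm p (block χ n v)) q
        Measure.count := by
  rw [besovNorm]
  split_ifs with h
  · subst h
    simp only [eLpNorm_exponent_top, eLpNormEssSup_count, enorm_eq_self]
  · simp only [eLpNorm_eq_lintegral_rpow_enorm_toReal hq h, enorm_eq_self, lintegral_count]

/-- Young's inequality on a time interval. -/
theorem eLpNorm_convolution_Icc_le {T : ℝ} {q : ℝ≥0∞} (hq : 1 ≤ q) {g k : ℝ → ℝ≥0∞}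
    (hg : Measurable g) (hk : Measurable k) (hkt : ∫⁻ z, k z ≠ ⊤) :
    eLpNorm (fun t => ∫⁻ s in Set.Icc 0 T, g s * k (t - s)) q (volume.restrict (Set.Icc 0 T)) ≤
      (∫⁻ z, k z) * eLpNorm g q (volume.restrict (Set.Icc 0 T)) := by
  set f := (Set.Icc 0 T).indicator g
  have hf : Measurable f := hg.indicator measurableSet_Icc
  have : IsFiniteMeasure (volume.withDensity k) := isFiniteMeasure_withDensity hkt
  have h := eLpNorm_lintegral_sub_le (volume : Measure ℝ) (volume.withDensity k) hq hf
  have e : ∀ t, ∫⁻ s in Set.Icc 0 T, g s * k (t - s) = ∫⁻ z, f (t - z) ∂(volume.withDensity k) := by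
    intro t
    have hft : Measurable fun z => f (t - z) := hf.comp (measurable_const.sub measurable_id)
    rw [lintegral_withDensity_eq_lintegral_mul _ hk hft,
      ← lintegral_indicator measurableSet_Icc,
      ← lintegral_sub_left_eq_self (fun z => (k * fun z => f (t - z)) z) t]
    congr 1; ext s
    simp only [Pi.mul_apply, sub_sub_cancel, f, Set.indicator]
    split_ifs <;> simp [mul_comm]
  simp_rw [e]
  refine (eLpNorm_mono_measure _ Measure.restrict_le_self).trans (h.trans ?_)
  rw [withDensity_apply _ MeasurableSet.univ, Measure.restrict_univ,
    eLpNorm_indicator_eq_eLpNorm_restrict measurableSet_Icc]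

theorem ae_lt_top_of_eLpNorm_lt_top {X : Type*} [MeasurableSpace X] {μ : Measure X} {q : ℝ≥0∞}
    (hq : q ≠ 0) {g : X → ℝ≥0∞} (hg : Measurable g) (h : eLpNorm g q μ < ⊤) : ∀ᵐ x ∂μ, g x < ⊤ := by
  rcases eq_or_ne q ⊤ with rfl | hqt
  · rw [eLpNorm_exponent_top] at h
    filter_upwards [enorm_ae_le_eLpNormEssSup g μ] with x hx
    exact (hx.trans_lt h)
  · have hq0 := ENNReal.toReal_pos hq hqt
    have h1 := lintegral_rpow_enorm_lt_top_of_eLpNorm_lt_top hq hqt h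
    filter_upwards [ae_lt_top (hg.enorm.pow_const _) h1.ne] with x hx
    rw [enorm_eq_self] at hx
    exact (ENNReal.rpow_lt_top_iff_of_pos hq0).1 hx

theorem lintegral_exp_neg_mul {l : ℝ} (hl : 0 < l) :
    ∫⁻ z, (Set.Ici (0 : ℝ)).indicator (fun z => ENNReal.ofReal (Real.exp (-l * z))) z =
      ENNReal.ofReal l⁻¹ := by
  rw [lintegral_indicator measurableSet_Ici, setLIntegral_congr Ioi_ae_eq_Ici.symm, ← ofReal_integral_eq_lintegral_ofReal
    (integrableOn_exp_mul_Ioi (by linarith) 0) (Eventually.of_forall fun _ => Real.exp_nonneg _),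
    integral_exp_mul_Ioi (by linarith)]
  congr 1
  field_simp
  simp

end

section

variable {d : ℕ}

theorem norm_apply_le_of_distLpNorm {p p' : ℝ≥0∞} [Fact (1 ≤ p)] [p.HolderConjugate p']
    {v : 𝓢'(Eu d, ℂ)} (h : distLpNorm p v ≠ ⊤) (ψ : 𝓢(Eu d, ℂ)) :
    ‖v ψ‖ ≤ (distLpNorm p v).toReal * lpn p' ψ := by
  have h1 := enorm_apply_le_distLpNorm (p := p) (p' := p') v ψ
  rw [← ENNReal.ofReal_toReal h, ← ENNReal.ofReal_mul ENNReal.toReal_nonneg, ← ofReal_norm,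
    ENNReal.ofReal_le_ofReal_iff (mul_nonneg ENNReal.toReal_nonneg (lpn_nonneg _ _))] at h1
  exact h1

/-- A measurable bound for the blocks of the forcing term. -/
theorem IsWeakSolution.exists_forcing_bound {χ : Eu d → ℝ} (hχ : IsLPCutoff χ) {α T : ℝ}
    {u₀ : 𝓢'(Eu d, ℂ)} {u f : ℝ → 𝓢'(Eu d, ℂ)} (hT : 0 ≤ T) (hw : IsWeakSolution α T u₀ u f)
    {p p' q : ℝ≥0∞} [Fact (1 ≤ p)] [p.HolderConjugate p'] (hq : 1 ≤ q) (n : ℕ) :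
    ∃ G : ℝ → ℝ≥0∞, Measurable G ∧ (∀ s, G s ≤ distLpNorm p (block χ n (f s))) ∧
      (eLpNorm G q (volume.restrict (Set.Icc 0 T)) < ⊤ →
        IntervalIntegrable (fun s => (G s).toReal) volume 0 T ∧
        ∀ ψ, ∀ᵐ s, s ∈ Set.Ioc 0 T → ‖block χ n (f s) ψ‖ ≤ (G s).toReal * lpn p' ψ) := by
  set μ := (volume : Measure ℝ).restrict (Set.Icc 0 T) with hμ
  obtain ⟨G, hG, hGle, hGmax⟩ := exists_measurable_minorant μ fun s => distLpNorm p (block χ n (f s))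
  have hq0 : q ≠ 0 := (zero_lt_one.trans_le hq).ne'
  refine ⟨G, hG, hGle, fun hfin => ⟨?_, fun ψ => ?_⟩⟩
  · have h1 : MemLp (fun s => (G s).toReal) q μ := by
      refine ⟨hG.ennreal_toReal.aestronglyMeasurable, lt_of_le_of_lt ?_ hfin⟩
      refine eLpNorm_mono_enorm fun s => ?_
      rw [Real.enorm_of_nonneg ENNReal.toReal_nonneg, enorm_eq_self]
      exact ENNReal.ofReal_toReal_le
    rw [intervalIntegrable_iff_integrableOn_Icc_of_le hT]
    exact h1.integrable hq
  · have hmeas : AEMeasurable (fun s => ‖block χ n (f s) ψ‖ₑ / ENNReal.ofReal (lpn p' ψ)) μ := by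
      have h1 := (hw (mult (bsym χ n) ψ)).1
      rw [intervalIntegrable_iff_integrableOn_Icc_of_le hT] at h1
      simp only [hχ.block_apply]
      exact h1.aestronglyMeasurable.enorm.div_const _
    have hle := hGmax _ hmeas fun s => ENNReal.div_le_of_le_mul
      (enorm_apply_le_distLpNorm (p := p) (p' := p') (block χ n (f s)) ψ)
    have h2 : ∀ᵐ s ∂μ, ‖block χ n (f s) ψ‖ ≤ (G s).toReal * lpn p' ψ := by
      filter_upwards [hle, ae_lt_top_of_eLpNorm_lt_top hq0 hG hfin] with s hs hst
      have h3 := enorm_apply_le_distLpNorm (p := p) (p' := p') (block χ n (f s)) ψ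
      have h4 : ‖block χ n (f s) ψ‖ₑ ≤ G s * ENNReal.ofReal (lpn p' ψ) := by
        by_cases h0 : ENNReal.ofReal (lpn p' ψ) = 0
        · rw [h0, mul_zero] at h3 ⊢
          exact h3
        · exact (ENNReal.div_le_iff h0 ENNReal.ofReal_ne_top).1 hs
      rw [← ENNReal.ofReal_toReal hst.ne, ← ENNReal.ofReal_mul ENNReal.toReal_nonneg, ← ofReal_norm,
        ENNReal.ofReal_le_ofReal_iff (mul_nonneg ENNReal.toReal_nonneg (lpn_nonneg _ _))] at h4
      exact h4
    rw [hμ, ae_restrict_iff' measurableSet_Icc] at h2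
    filter_upwards [h2] with s hs hst using hs ⟨hst.1.le, hst.2⟩

/-- The convolution kernels of the Duhamel formula, block by block. -/
def blockKernel (α l T : ℝ) : ℕ → ℝ → ℝ≥0∞
  | 0 => (Set.Icc (-T) T).indicator fun _ => 1
  | j + 1 => (Set.Ici (0 : ℝ)).indicator fun z => ENNReal.ofReal (Real.exp (-(l * (2 ^ j) ^ α) * z))

theorem measurable_blockKernel (α l T : ℝ) (n : ℕ) : Measurable (blockKernel α l T n) := by
  cases n with
  | zero => exact measurable_const.indicator measurableSet_Icc
  | succ j => exact Measurable.indicator (by fun_prop) measurableSet_Ici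

theorem lintegral_blockKernel_zero (T α l : ℝ) :
    ∫⁻ z, blockKernel α l T 0 z = 2 * ENNReal.ofReal T := by
  rw [blockKernel, lintegral_indicator measurableSet_Icc, lintegral_const, one_mul,
    Measure.restrict_apply_univ, Real.volume_Icc, ← ENNReal.ofReal_ofNat 2,
    ← ENNReal.ofReal_mul (by norm_num)]
  congr 1; ring

theorem lintegral_blockKernel_succ (α T : ℝ) {l : ℝ} (hl : 0 < l) (j : ℕ) :
    ∫⁻ z, blockKernel α l T (j + 1) z = ENNReal.ofReal (l * (2 ^ j) ^ α)⁻¹ :=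
  lintegral_exp_neg_mul (by positivity)

theorem ofReal_integral_mul_toReal_le {T t : ℝ} (ht0 : 0 ≤ t) (htT : t ≤ T) {κ : ℝ → ℝ}
    (hκ : Measurable κ) (hκ0 : ∀ s, 0 ≤ κ s) {G k : ℝ → ℝ≥0∞} (hG : Measurable G)
    (hk : ∀ s ∈ Set.Ioc 0 t, ENNReal.ofReal (κ s) ≤ k s) :
    ENNReal.ofReal (∫ s in 0..t, κ s * (G s).toReal) ≤ ∫⁻ s in Set.Icc 0 T, G s * k s := by
  rw [intervalIntegral.integral_of_le ht0, integral_eq_lintegral_of_nonneg_ae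
    (Eventually.of_forall fun s => mul_nonneg (hκ0 s) ENNReal.toReal_nonneg)
    (hκ.mul hG.ennreal_toReal).aestronglyMeasurable]
  refine ENNReal.ofReal_toReal_le.trans ?_
  refine le_trans ?_ (lintegral_mono_set (Set.Ioc_subset_Icc_self.trans (Set.Icc_subset_Icc_right htT)))
  refine setLIntegral_mono' measurableSet_Ioc fun s hs => ?_
  rw [ENNReal.ofReal_mul (hκ0 s), mul_comm]
  exact mul_le_mul' ENNReal.ofReal_toReal_le (hk s hs)

/-- The weights of the Besov norms absorb the masses of the kernels. -/
theorem weight_mul_lintegral_blockKernel_le {α l T : ℝ} (β : ℝ) (hα : 0 < α) (hl : 0 < l) (hT : 0 ≤ T)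
    (n : ℕ) : (2 : ℝ≥0∞) ^ ((α + β) * ((n : ℝ) - 1)) * ∫⁻ z, blockKernel α l T n z ≤
      ENNReal.ofReal (2 + l⁻¹) * (1 + ENNReal.ofReal T) * (2 : ℝ≥0∞) ^ (β * ((n : ℝ) - 1)) := by
  have e : ∀ x : ℝ, (2 : ℝ≥0∞) ^ x = ENNReal.ofReal ((2 : ℝ) ^ x) := fun x => by
    rw [← ENNReal.ofReal_rpow_of_pos two_pos, ENNReal.ofReal_ofNat]
  have e1 : (1 : ℝ≥0∞) + ENNReal.ofReal T = ENNReal.ofReal (1 + T) := by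
    rw [ENNReal.ofReal_add zero_le_one hT, ENNReal.ofReal_one]
  have hl' : 0 < l⁻¹ := inv_pos.2 hl
  rw [e, e, e1, ← ENNReal.ofReal_mul (by positivity), ← ENNReal.ofReal_mul (by positivity)]
  cases n with
  | zero =>
    rw [lintegral_blockKernel_zero, ← ENNReal.ofReal_ofNat 2, ← ENNReal.ofReal_mul (by norm_num),
      ← ENNReal.ofReal_mul (by positivity)]
    refine ENNReal.ofReal_le_ofReal ?_
    have h1 : (2 : ℝ) ^ ((α + β) * (((0 : ℕ) : ℝ) - 1)) ≤ 2 ^ (β * (((0 : ℕ) : ℝ) - 1)) :=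
      Real.rpow_le_rpow_of_exponent_le (by norm_num) (by push_cast; linarith)
    calc _ ≤ (2 : ℝ) ^ (β * (((0 : ℕ) : ℝ) - 1)) * ((2 + l⁻¹) * (1 + T)) := by
          gcongr
          · linarith
          · linarith
      _ = _ := by ring
  | succ j =>
    rw [lintegral_blockKernel_succ α T hl, ← ENNReal.ofReal_mul (by positivity)]
    refine ENNReal.ofReal_le_ofReal ?_
    have e2 : (((j + 1 : ℕ) : ℝ) - 1) = j := by push_cast; ring
    rw [e2, add_mul, Real.rpow_add two_pos, mul_inv, ← Real.rpow_natCast 2 j, ← Real.rpow_mul two_pos.le,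
      mul_comm (j : ℝ) α]
    have h3 : (0 : ℝ) < 2 ^ (α * (j : ℝ)) := by positivity
    calc (2 : ℝ) ^ (α * (j : ℝ)) * 2 ^ (β * (j : ℝ)) * (l⁻¹ * (2 ^ (α * (j : ℝ)))⁻¹)
        = l⁻¹ * 1 * 2 ^ (β * (j : ℝ)) := by field_simp
      _ ≤ _ := by
          gcongr
          · linarith
          · linarith

/-- The Duhamel bound for all blocks in extended form. -/
theorem exists_block_bound (hd : 1 ≤ d) {χ : Eu d → ℝ} (hχ : IsLPCutoff χ) {α : ℝ}
    (hα : α ∈ Set.Ioo (0 : ℝ) 2) (p p' : ℝ≥0∞) [Fact (1 ≤ p)] [Fact (1 ≤ p')] [p.HolderConjugate p'] :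
    ∃ K l : ℝ, 0 < K ∧ 0 < l ∧
    ∀ {T : ℝ} {u₀ : 𝓢'(Eu d, ℂ)} {u f : ℝ → 𝓢'(Eu d, ℂ)}, 0 ≤ T → IsWeakSolution α T u₀ u f →
    ∀ (n : ℕ) {G : ℝ → ℝ≥0∞}, Measurable G → IntervalIntegrable (fun s => (G s).toReal) volume 0 T →
      (∀ ψ, ∀ᵐ s, s ∈ Set.Ioc 0 T → ‖block χ n (f s) ψ‖ ≤ (G s).toReal * lpn p' ψ) →
      distLpNorm p (block χ n u₀) ≠ ⊤ → ∀ t ∈ Set.Icc 0 T,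
      distLpNorm p (block χ n (u t)) ≤ ENNReal.ofReal K * (distLpNorm p (block χ n u₀) +
        ∫⁻ s in Set.Icc 0 T, G s * blockKernel α l T n (t - s)) := by
  obtain ⟨C₁, l, hC₁, hl, Hh⟩ := exists_highBlock_bound hd hχ hα
  obtain ⟨C₂, hC₂, Hl⟩ := exists_lowBlock_bound hd hχ hα
  refine ⟨max C₁ C₂, l, lt_max_of_lt_left hC₁, hl, ?_⟩
  intro T u₀ u f hT hw n G hG hGi hGf hu₀ t ht
  have hm := norm_apply_le_of_distLpNorm (p' := p') hu₀
  have key : ∀ {C m I : ℝ}, 0 ≤ C → 0 ≤ m → 0 ≤ I → C ≤ max C₁ C₂ →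
      ENNReal.ofReal m ≤ distLpNorm p (block χ n u₀) →
      ENNReal.ofReal I ≤ ∫⁻ s in Set.Icc 0 T, G s * blockKernel α l T n (t - s) →
      ENNReal.ofReal (C * (m + I)) ≤ ENNReal.ofReal (max C₁ C₂) * (distLpNorm p (block χ n u₀) +
        ∫⁻ s in Set.Icc 0 T, G s * blockKernel α l T n (t - s)) := by
    intro C m I hC hm0 hI0 hCm hm hI
    rw [ENNReal.ofReal_mul hC, ENNReal.ofReal_add hm0 hI0]
    exact mul_le_mul' (ENNReal.ofReal_le_ofReal hCm) (add_le_add hm hI)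
  cases n with
  | zero =>
    refine (Hl hT hw (fun s => ENNReal.toReal_nonneg) hGi hGf ENNReal.toReal_nonneg hm ht).trans ?_
    refine key hC₂.le ENNReal.toReal_nonneg
      (intervalIntegral.integral_nonneg hT fun s _ => ENNReal.toReal_nonneg) (le_max_right _ _)
      ENNReal.ofReal_toReal_le ?_
    have h := ofReal_integral_mul_toReal_le hT le_rfl (κ := fun _ => 1) measurable_const
      (fun _ => zero_le_one) hG (k := fun s => blockKernel α l T 0 (t - s)) fun s hs => by
        rw [blockKernel, Set.indicator_of_mem, ENNReal.ofReal_one]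
        exact ⟨by linarith [hs.2, ht.1], by linarith [hs.1, ht.2]⟩
    simpa only [one_mul] using h
  | succ j =>
    refine (Hh hT hw j (fun s => ENNReal.toReal_nonneg) hGi hGf ENNReal.toReal_nonneg hm ht).trans ?_
    refine key hC₁.le (mul_nonneg (Real.exp_nonneg _) ENNReal.toReal_nonneg)
      (intervalIntegral.integral_nonneg ht.1 fun s _ => mul_nonneg (Real.exp_nonneg _)
        ENNReal.toReal_nonneg) (le_max_left _ _) ?_ ?_
    · rw [ENNReal.ofReal_mul (Real.exp_nonneg _)]
      refine mul_le_of_le_one_of_le ?_ ENNReal.ofReal_toReal_le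
      rw [ENNReal.ofReal_le_one, Real.exp_le_one_iff]
      have : 0 ≤ l * (2 ^ j) ^ α * t := mul_nonneg (by positivity) ht.1
      linarith
    · refine ofReal_integral_mul_toReal_le ht.1 ht.2 (by fun_prop) (fun _ => Real.exp_nonneg _) hG
        fun s hs => ?_
      rw [blockKernel, Set.indicator_of_mem]
      exact sub_nonneg.2 hs.2

end

section

variable {d : ℕ}

theorem measurable_convolution_Icc {g k : ℝ → ℝ≥0∞} (hg : Measurable g) (hk : Measurable k) (T : ℝ) :
    Measurable fun t => ∫⁻ s in Set.Icc 0 T, g s * k (t - s) :=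
  Measurable.lintegral_prod_right' (f := fun x : ℝ × ℝ => g x.2 * k (x.1 - x.2))
    ((hg.comp measurable_snd).mul (hk.comp (measurable_fst.sub measurable_snd)))

/-- The time norm of the Duhamel bound. -/
theorem eLpNorm_add_convolution_le {T : ℝ} (hT : 0 < T) {q : ℝ≥0∞} (hq : 1 ≤ q) (K m : ℝ≥0∞)
    {g k : ℝ → ℝ≥0∞} (hg : Measurable g) (hk : Measurable k) (hkt : ∫⁻ z, k z ≠ ⊤) :
    eLpNorm (fun t => K * (m + ∫⁻ s in Set.Icc 0 T, g s * k (t - s))) q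
        (volume.restrict (Set.Icc 0 T)) ≤
      K * (ENNReal.ofReal T ^ (q⁻¹.toReal) * m +
        (∫⁻ z, k z) * eLpNorm g q (volume.restrict (Set.Icc 0 T))) := by
  have hq0 : q ≠ 0 := (zero_lt_one.trans_le hq).ne'
  have hm := measurable_convolution_Icc hg hk T
  have hvol : (volume.restrict (Set.Icc 0 T)) Set.univ = ENNReal.ofReal T := by
    rw [Measure.restrict_apply_univ, Real.volume_Icc, sub_zero]
  have hμ : (volume.restrict (Set.Icc 0 T)) ≠ 0 := fun h => by
    rw [h] at hvol
    exact (ENNReal.ofReal_pos.2 hT).ne hvol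
  have hadd : Measurable fun t => m + ∫⁻ s in Set.Icc 0 T, g s * k (t - s) :=
    measurable_const.add hm
  rw [eLpNorm_const_mul_ennreal hq0 K hadd.aemeasurable]
  refine mul_le_mul' le_rfl ?_
  refine (eLpNorm_add_le (f := fun _ => m) (g := fun t => ∫⁻ s in Set.Icc 0 T, g s * k (t - s))
    measurable_const.aestronglyMeasurable hm.aestronglyMeasurable hq).trans (add_le_add ?_ ?_)
  · rw [eLpNorm_const m hq0 hμ, hvol, enorm_eq_self, ENNReal.toReal_inv, one_div, mul_comm]
  · exact eLpNorm_convolution_Icc_le hq hg hk hkt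

theorem two_rpow_ne_zero (x : ℝ) : (2 : ℝ≥0∞) ^ x ≠ 0 := by simp

theorem lt_top_of_weighted_eLpNorm_count {q : ℝ≥0∞} (hq : q ≠ 0) {w x : ℕ → ℝ≥0∞} (hw : ∀ n, w n ≠ 0)
    (h : eLpNorm (fun n => w n * x n) q Measure.count < ⊤) (n : ℕ) : x n < ⊤ := by
  have h1 : w n * x n < ⊤ := (enorm_le_eLpNorm_count (fun n => w n * x n) n hq).trans_lt h
  by_contra h2
  rw [not_lt, top_le_iff] at h2
  rw [h2, ENNReal.mul_top (hw n)] at h1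
  exact lt_irrefl _ h1

end

end

theorem lemma3p3 (d : ℕ) (hd : 1 ≤ d) (χ : EuclideanSpace ℝ (Fin d) → ℝ) (hχ : IsLPCutoff χ)
    (α β : ℝ) (hα : α ∈ Set.Ioo (0 : ℝ) 2) (p q : ℝ≥0∞) [Fact (1 ≤ p)] (hq : 1 ≤ q) :
    ∃ c : ℝ, 0 < c ∧
      ∀ (u₀ : 𝓢'(EuclideanSpace ℝ (Fin d), ℂ)) (u f : ℝ → 𝓢'(EuclideanSpace ℝ (Fin d), ℂ))
        (T : ℝ), 0 < T → IsWeakSolution α T u₀ u f →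
        timeBesovNorm χ T (α + β) p q u ≤
          ENNReal.ofReal c *
            (ENNReal.ofReal T ^ (q⁻¹.toReal) * besovNorm χ (α + β) p q u₀ +
              (1 + ENNReal.ofReal T) * timeBesovNorm χ T β p q f) := by
  have hq0 : q ≠ 0 := (zero_lt_one.trans_le hq).ne'
  have : Fact (1 ≤ ENNReal.conjExponent p) := ⟨le_self_add⟩
  obtain ⟨K, l, hK, hl, H⟩ := exists_block_bound hd hχ hα p (ENNReal.conjExponent p)
  set D : ℝ := 2 + l⁻¹ with hD
  have hl' : 0 < l⁻¹ := inv_pos.2 hl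
  refine ⟨K * D, by positivity, fun u₀ u f T hT hw => ?_⟩
  set μ := (volume : Measure ℝ).restrict (Set.Icc 0 T) with hμ
  set Q := ENNReal.ofReal T ^ (q⁻¹.toReal) with hQ
  have hT0 : ENNReal.ofReal T ≠ 0 := (ENNReal.ofReal_pos.2 hT).ne'
  have hQ0 : Q ≠ 0 := (ENNReal.rpow_pos (pos_iff_ne_zero.2 hT0) ENNReal.ofReal_ne_top).ne'
  have hc0 : ENNReal.ofReal (K * D) ≠ 0 := (ENNReal.ofReal_pos.2 (by positivity)).ne'
  by_cases hB : besovNorm χ (α + β) p q u₀ = ⊤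
  · rw [hB, ENNReal.mul_top hQ0, top_add, ENNReal.mul_top hc0]
    exact le_top
  by_cases hF : timeBesovNorm χ T β p q f = ⊤
  · rw [hF, ENNReal.mul_top (by simp), add_top, ENNReal.mul_top hc0]
    exact le_top
  set W' : ℕ → ℝ≥0∞ := fun n => (2 : ℝ≥0∞) ^ ((α + β) * ((n : ℝ) - 1)) with hW'
  set W : ℕ → ℝ≥0∞ := fun n => (2 : ℝ≥0∞) ^ (β * ((n : ℝ) - 1)) with hW
  set m : ℕ → ℝ≥0∞ := fun n => distLpNorm p (block χ n u₀) with hm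
  have hBe : besovNorm χ (α + β) p q u₀ = eLpNorm (fun n => W' n * m n) q Measure.count :=
    besovNorm_eq_eLpNorm χ _ p q hq0 u₀
  choose G hG hGle hGfin using fun n => hw.exists_forcing_bound hχ hT.le (p := p)
    (p' := ENNReal.conjExponent p) hq n
  set A : ℕ → ℝ≥0∞ := fun n => eLpNorm (G n) q μ with hA
  have hFle : eLpNorm (fun n => W n * A n) q Measure.count ≤ timeBesovNorm χ T β p q f := by
    have e : (fun n => W n * A n) = fun n => eLpNorm (fun t => W n * G n t) q μ :=
      funext fun n => (eLpNorm_const_mul_ennreal hq0 (W n) (hG n).aemeasurable).symm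
    rw [e, ← eLpNorm_eLpNorm_count hq0 fun n => (hG n).const_mul (W n), timeBesovNorm]
    refine eLpNorm_mono_enorm fun t => ?_
    rw [enorm_eq_self, enorm_eq_self, besovNorm_eq_eLpNorm χ β p q hq0]
    refine eLpNorm_mono_enorm fun n => ?_
    rw [enorm_eq_self, enorm_eq_self]
    exact mul_le_mul' le_rfl (hGle n t)
  have hmt : ∀ n, m n ≠ ⊤ := fun n => (lt_top_of_weighted_eLpNorm_count hq0
    (fun n => two_rpow_ne_zero _) (lt_top_iff_ne_top.2 (hBe ▸ hB)) n).ne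
  have hAt : ∀ n, A n < ⊤ := lt_top_of_weighted_eLpNorm_count hq0 (fun n => two_rpow_ne_zero _)
    (hFle.trans_lt (lt_top_iff_ne_top.2 hF))
  set k := blockKernel α l T with hk
  have hkm : ∀ n, Measurable (k n) := measurable_blockKernel α l T
  have hkt : ∀ n, ∫⁻ z, k n z ≠ ⊤ := fun n => by
    cases n with
    | zero =>
      rw [hk, lintegral_blockKernel_zero]
      exact ENNReal.mul_ne_top ENNReal.ofNat_ne_top ENNReal.ofReal_ne_top
    | succ j =>
      rw [hk, lintegral_blockKernel_succ α T hl]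
      exact ENNReal.ofReal_ne_top
  set X : ℕ → ℝ → ℝ≥0∞ := fun n t =>
    ENNReal.ofReal K * (m n + ∫⁻ s in Set.Icc 0 T, G n s * k n (t - s)) with hX
  have hXm : ∀ n, Measurable (X n) := fun n =>
    (measurable_const.add (measurable_convolution_Icc (hG n) (hkm n) T)).const_mul _
  have h1 : timeBesovNorm χ T (α + β) p q u ≤
      eLpNorm (fun t => eLpNorm (fun n => W' n * X n t) q Measure.count) q μ := by
    rw [timeBesovNorm]
    refine eLpNorm_mono_enorm_ae ?_
    filter_upwards [ae_restrict_mem measurableSet_Icc] with t ht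
    rw [enorm_eq_self, enorm_eq_self, besovNorm_eq_eLpNorm χ _ p q hq0]
    refine eLpNorm_mono_enorm fun n => ?_
    rw [enorm_eq_self, enorm_eq_self]
    exact mul_le_mul' le_rfl (H hT.le hw n (hG n) (hGfin n (hAt n)).1 (hGfin n (hAt n)).2 (hmt n) t ht)
  have h2 : ∀ n, eLpNorm (fun t => W' n * X n t) q μ ≤
      ENNReal.ofReal (K * D) * (Q * (W' n * m n) + (1 + ENNReal.ofReal T) * (W n * A n)) := by
    intro n
    rw [eLpNorm_const_mul_ennreal hq0 _ (hXm n).aemeasurable]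
    have h3 := eLpNorm_add_convolution_le hT hq (ENNReal.ofReal K) (m n) (hG n) (hkm n) (hkt n)
    have h4 := weight_mul_lintegral_blockKernel_le β hα.1 hl hT.le n
    have hD1 : (1 : ℝ≥0∞) ≤ ENNReal.ofReal D := by
      rw [ENNReal.one_le_ofReal]; linarith
    rw [ENNReal.ofReal_mul hK.le]
    calc W' n * eLpNorm (X n) q μ
        ≤ W' n * (ENNReal.ofReal K * (Q * m n + (∫⁻ z, k n z) * A n)) := mul_le_mul' le_rfl h3
      _ = ENNReal.ofReal K * (1 * (Q * (W' n * m n)) + (W' n * ∫⁻ z, k n z) * A n) := by ring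
      _ ≤ ENNReal.ofReal K * (ENNReal.ofReal D * (Q * (W' n * m n)) +
          (ENNReal.ofReal D * (1 + ENNReal.ofReal T) * W n) * A n) :=
        mul_le_mul' le_rfl (add_le_add (mul_le_mul' hD1 le_rfl) (mul_le_mul' h4 le_rfl))
      _ = _ := by ring
  calc timeBesovNorm χ T (α + β) p q u
      ≤ eLpNorm (fun n => eLpNorm (fun t => W' n * X n t) q μ) q Measure.count := by
        rw [← eLpNorm_eLpNorm_count hq0 fun n => (hXm n).const_mul (W' n)]
        exact h1
    _ ≤ eLpNorm (fun n => ENNReal.ofReal (K * D) *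
          (Q * (W' n * m n) + (1 + ENNReal.ofReal T) * (W n * A n))) q Measure.count :=
        eLpNorm_mono_enorm fun n => by rw [enorm_eq_self, enorm_eq_self]; exact h2 n
    _ = ENNReal.ofReal (K * D) * eLpNorm (fun n =>
          Q * (W' n * m n) + (1 + ENNReal.ofReal T) * (W n * A n)) q Measure.count :=
        eLpNorm_const_mul_ennreal hq0 _ (measurable_of_countable _).aemeasurable
    _ ≤ ENNReal.ofReal (K * D) * (eLpNorm (fun n => Q * (W' n * m n)) q Measure.count +
          eLpNorm (fun n => (1 + ENNReal.ofReal T) * (W n * A n)) q Measure.count) :=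
        mul_le_mul' le_rfl (eLpNorm_add_le (f := fun n => Q * (W' n * m n))
          (g := fun n => (1 + ENNReal.ofReal T) * (W n * A n))
          (measurable_of_countable _).aestronglyMeasurable
          (measurable_of_countable _).aestronglyMeasurable hq)
    _ ≤ _ := by
        rw [eLpNorm_const_mul_ennreal hq0 _ (measurable_of_countable _).aemeasurable,
          eLpNorm_const_mul_ennreal hq0 _ (measurable_of_countable _).aemeasurable, ← hBe]
        exact mul_le_mul' le_rfl (add_le_add le_rfl (mul_le_mul' le_rfl hFle))
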